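/- Let $k$ be a field of characteristic zero, let $V$ be a $k$-vector space (in degree $0$, of any dimension), and let $R\subset k\oplus V\oplus \mathrm{Sym}^2(V)\subset \mathrm{Sym}(V)$ be a subspace with $$R\cap (k\oplus V)=0,\qquad (R)\cap (k\oplus V\oplus \mathrm{Sym}^2(V))=R ,$$ where $(R)$ is the ideal of $\mathrm{Sym}(V)$ generated by $R$. The commutative quadratic-linear-constant (QLC) algebra defined by these data is $A=\mathrm{Sym}(V)/(R)$. Let $q\colon \mathrm{Sym}(V)\to\mathrm{Sym}^2(V)$ be the projection, let $qA=\overline{\mathrm{Sym}}(V)/(qR)$ be the associated nonunital quadratic algebra, where $\overline{\mathrm{Sym}}(V)=\bigoplus_{n\ge1}\mathrm{Sym}^n(V)$, and let $\phi\colon qR\to V$ and $\theta\colon qR\to k$ be the linear maps with $R=\{x-\phi(x)+\theta(x)\mid x\in qR\}$. *Koszul dual.* Let $L^c(sV)$ be the cofree conilpotent graded Lie coalgebra on the suspension $sV$ (so $sV$ is in degree $1$); its weight-two part is identified with $s^2\mathrm{Sym}^2(V)$. Let $(qA)^{\text{¡}}\subset L^c(sV)$ be the largest weight-graded Lie subcoalgebra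 whose weight-two part lies in $s^2qR$. Let $\tilde\phi$ be the coderivation of degree $-1$ of $(qA)^{\text{¡}}$ whose corestriction to $sV$ is the composite $(qA)^{\text{¡}}\twoheadrightarrow s^2qR\xrightarrow{s^{-1}\phi}sV$, and let $\tilde\theta$ be the composite $(qA)^{\text{¡}}\twoheadrightarrow s^2qR\xrightarrow{s^{-2}\theta}k$, of degree $-2$. Then $\mathfrak G=((qA)^{\text{¡}},\tilde\phi,\tilde\theta)$ is a curved DG Lie coalgebra (with $d=\tilde\phi$, $h=\tilde\theta$ and cobracket $]\,\cdot\,[$, one has $d^2=(h\otimes\mathrm{id})\circ\,]\,\cdot\,[$ and $h\circ d=0$), the Koszul dual curved Lie coalgebra of $A$. *Lie cobar construction.* For a curved DG Lie coalgebra $(\mathfrak G,d,h)$, let $\Omega_{\mathrm{Lie}}(\mathfrak G)$ be the free graded commutative algebra $\mathrm{Sym}(\mathfrak G[-1])$ on the desuspension of $\mathfrak G$, with the derivation $d_0+d_1+d_2$ of degree $-1$ given on generators by $$d_0(s^{-1}\xi)=h(\xi),\qquad d_1(s^{-1}\xi)=-s^{-1}d\xi,\qquad d_2(s^{-1}\xi)=-\tfrac12\sum(-1)^{|\xi'|}\,s^{-1}\xi'\cdot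 s^{-1}\xi'' ,$$ where $]\xi[\,=\sum\xi'\otimes\xi''$. *Koszulness.* Let $\Omega_\alpha((qA)^{\text{¡}})$ be the augmentation ideal of $\Omega_{\mathrm{Lie}}((qA)^{\text{¡}})$, where $(qA)^{\text{¡}}$ is taken with $d=0$ and $h=0$, so that the differential is $d_2$. The algebra $qA$ is called Koszul if the map of nonunital commutative DG algebras $\Omega_\alpha((qA)^{\text{¡}})\to qA$ induced by $(qA)^{\text{¡}}\twoheadrightarrow sV\cong V\hookrightarrow qA$ is a quasi-isomorphism, where $qA$ is in degree $0$ with zero differential. **Theorem.** Suppose that $qA$ is Koszul. Then $\Omega_{\mathrm{Lie}}(\mathfrak G)$ is a commutative DG algebra (that is, $(d_0+d_1+d_2)^2=0$), and the algebra morphism $g_\kappa\colon\Omega_{\mathrm{Lie}}(\mathfrak G)\to A$ induced by the map $\kappa\colon(qA)^{\text{¡}}\twoheadrightarrow sV\cong V\to A$ of degree $-1$ is a morphism of commutative DG algebras (where $A$ is in degree $0$ with zero differential) and a quasi-isomorphism. -/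

import Mathlib

open scoped TensorProduct

noncomputable section

namespace CurvedKoszul

section Graded

variable {k : Type*} [Field k] {G : Type*} [AddCommGroup G] [Module k G]

/-- The linear endomorphism of a graded vector space that multiplies degree `n` by `c n`. -/
def gradeScale (gr : ℕ → Submodule k G) (hgr : DirectSum.IsInternal gr) (c : ℕ → k) :
    G →ₗ[k] G :=
  (DirectSum.toModule k ℕ G fun n => c n • (gr n).subtype) ∘ₗ
    ((LinearEquiv.ofBijective (DirectSum.coeLinearMap gr) hgr).symm :
      G →ₗ[k] DirectSum ℕ fun n => gr n)

theorem gradeScale_of_mem (gr : ℕ → Submodule k G) (hgr : DirectSum.IsInternal gr) (c : ℕ → k)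
    {n : ℕ} {x : G} (hx : x ∈ gr n) : gradeScale gr hgr c x = c n • x := by
  have h : (LinearEquiv.ofBijective (DirectSum.coeLinearMap gr) hgr).symm x
      = DirectSum.lof k ℕ (fun n => gr n) n ⟨x, hx⟩ := by
    rw [LinearEquiv.symm_apply_eq]
    exact (DirectSum.coeLinearMap_lof gr n ⟨x, hx⟩).symm
  simp only [gradeScale, LinearMap.comp_apply, LinearEquiv.coe_coe, h]
  rw [DirectSum.toModule_lof]
  simp

/-- The sign involution `x ↦ (-1)^|x| x`. -/
def parity (gr : ℕ → Submodule k G) (hgr : DirectSum.IsInternal gr) : G →ₗ[k] G :=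
  gradeScale gr hgr fun n => (-1) ^ n

/-- The symmetry `x ⊗ y ↦ (-1)^(|x||y|) y ⊗ x` of the tensor square (the sign depends only on
whether `x` is even or odd). -/
def koszulSwap (gr : ℕ → Submodule k G) (hgr : DirectSum.IsInternal gr) :
    G ⊗[k] G →ₗ[k] G ⊗[k] G :=
  (TensorProduct.comm k G G : G ⊗[k] G →ₗ[k] G ⊗[k] G) ∘ₗ
    (TensorProduct.map (gradeScale gr hgr fun n => if Even n then 1 else 0) LinearMap.id +
      TensorProduct.map (gradeScale gr hgr fun n => if Even n then 0 else 1) (parity gr hgr))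

theorem koszulSwap_tmul (gr : ℕ → Submodule k G) (hgr : DirectSum.IsInternal gr) {m n : ℕ}
    {x y : G} (hx : x ∈ gr m) (hy : y ∈ gr n) :
    koszulSwap gr hgr (x ⊗ₜ y) = (-1 : k) ^ (m * n) • (y ⊗ₜ[k] x) := by
  simp only [koszulSwap, LinearMap.comp_apply, LinearMap.add_apply, TensorProduct.map_tmul,
    parity, gradeScale_of_mem gr hgr _ hx, gradeScale_of_mem gr hgr _ hy, LinearMap.id_apply]
  rcases Nat.even_or_odd m with h | h
  · simp [h, (h.mul_right n).neg_one_pow]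
  · simp [Nat.not_even_iff_odd.mpr h, pow_mul, h.neg_one_pow]

/-- The cyclic permutation `x ⊗ y ⊗ z ↦ (-1)^(|z|(|x|+|y|)) z ⊗ x ⊗ y`. -/
def koszulCycle (gr : ℕ → Submodule k G) (hgr : DirectSum.IsInternal gr) :
    (G ⊗[k] G) ⊗[k] G →ₗ[k] (G ⊗[k] G) ⊗[k] G :=
  (koszulSwap gr hgr).rTensor G ∘ₗ
    ((TensorProduct.assoc k G G G).symm : G ⊗[k] (G ⊗[k] G) →ₗ[k] (G ⊗[k] G) ⊗[k] G) ∘ₗ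
    (koszulSwap gr hgr).lTensor G ∘ₗ
    (TensorProduct.assoc k G G G : (G ⊗[k] G) ⊗[k] G →ₗ[k] G ⊗[k] (G ⊗[k] G))

theorem koszulCycle_tmul (gr : ℕ → Submodule k G) (hgr : DirectSum.IsInternal gr) {l m n : ℕ}
    {x y z : G} (hx : x ∈ gr l) (hy : y ∈ gr m) (hz : z ∈ gr n) :
    koszulCycle gr hgr ((x ⊗ₜ y) ⊗ₜ z) =
      ((-1 : k) ^ (m * n) * (-1) ^ (l * n)) • ((z ⊗ₜ[k] x) ⊗ₜ[k] y) := by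
  simp only [koszulCycle, LinearMap.comp_apply, LinearEquiv.coe_coe, TensorProduct.assoc_tmul,
    LinearMap.lTensor_tmul, koszulSwap_tmul gr hgr hy hz, TensorProduct.tmul_smul, map_smul,
    TensorProduct.assoc_symm_tmul, LinearMap.rTensor_tmul, koszulSwap_tmul gr hgr hx hz]
  rw [← TensorProduct.smul_tmul', smul_smul]

/-- The image of `A ⊗ B` in `G ⊗ G`. -/
def tensorSub (A B : Submodule k G) : Submodule k (G ⊗[k] G) :=
  LinearMap.range (TensorProduct.map A.subtype B.subtype)

variable (k G) in
/-- A graded Lie coalgebra, concentrated in non-negative degrees. -/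
structure GradedLieCoalgebra where
  /-- the homogeneous part of each degree -/
  gr : ℕ → Submodule k G
  internal : DirectSum.IsInternal gr
  /-- the Lie cobracket -/
  cobr : G →ₗ[k] G ⊗[k] G
  cobr_mem : ∀ n, ∀ x ∈ gr n,
    cobr x ∈ ⨆ (i : ℕ) (j : ℕ) (_ : i + j = n), tensorSub (gr i) (gr j)
  antisymm : koszulSwap gr internal ∘ₗ cobr = -cobr
  coJacobi : (LinearMap.id + koszulCycle gr internal +
    koszulCycle gr internal ∘ₗ koszulCycle gr internal) ∘ₗ cobr.rTensor G ∘ₗ cobr = 0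

variable (k G) in
/-- A curved DG Lie coalgebra (in non-negative degrees): a coderivation `d` of degree `-1` and a
functional `h` of degree `-2` with `d² = (h ⊗ id) ∘ ]-[` and `h ∘ d = 0`. -/
structure CurvedDGLieCoalgebra extends GradedLieCoalgebra k G where
  d : G →ₗ[k] G
  d_zero : ∀ x ∈ gr 0, d x = 0
  d_mem : ∀ n, ∀ x ∈ gr (n + 1), d x ∈ gr n
  coderivation : cobr ∘ₗ d =
    (TensorProduct.map d LinearMap.id + TensorProduct.map (parity gr internal) d) ∘ₗ cobr
  h : G →ₗ[k] k
  h_mem : ∀ n, n ≠ 2 → ∀ x ∈ gr n, h x = 0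
  d_sq : d ∘ₗ d = (TensorProduct.lid k G : k ⊗[k] G →ₗ[k] G) ∘ₗ h.rTensor G ∘ₗ cobr
  h_d : h ∘ₗ d = 0

/-- A graded Lie coalgebra as a curved DG Lie coalgebra with `d = 0` and `h = 0`. -/
def GradedLieCoalgebra.toCurved (C : GradedLieCoalgebra k G) : CurvedDGLieCoalgebra k G where
  toGradedLieCoalgebra := C
  d := 0
  d_zero := by simp
  d_mem := by simp
  coderivation := by simp
  h := 0
  h_mem := by simp
  d_sq := by simp
  h_d := by simp

end Graded

section Cobar

variable {k : Type*} [Field k] {G : Type*} [AddCommGroup G] [Module k G]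

/-- Graded commutativity of the generators `s⁻¹x`, where `|s⁻¹x| = |x| - 1`. -/
inductive GSymRel (gr : ℕ → Submodule k G) : TensorAlgebra k G → TensorAlgebra k G → Prop
  | comm (m n : ℕ) (x y : G) (hx : x ∈ gr m) (hy : y ∈ gr n) :
      GSymRel gr (TensorAlgebra.ι k x * TensorAlgebra.ι k y)
        ((-1 : k) ^ ((m + 1) * (n + 1)) • (TensorAlgebra.ι k y * TensorAlgebra.ι k x))

/-- The graded symmetric algebra on the desuspension `G[-1]`: the quotient of the tensor algebra
by graded commutativity. -/
def GSym (gr : ℕ → Submodule k G) : Type _ := RingQuot (GSymRel gr)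

instance (gr : ℕ → Submodule k G) : Ring (GSym gr) := inferInstanceAs (Ring (RingQuot _))

instance (gr : ℕ → Submodule k G) : Algebra k (GSym gr) :=
  inferInstanceAs (Algebra k (RingQuot (GSymRel gr)))

/-- The quotient map from the tensor algebra. -/
def GSym.mk (gr : ℕ → Submodule k G) : TensorAlgebra k G →ₐ[k] GSym gr :=
  RingQuot.mkAlgHom k (GSymRel gr)

variable (gr : ℕ → Submodule k G)

/-- The generator `s⁻¹x`. -/
def GSym.ι : G →ₗ[k] GSym gr :=
  (GSym.mk gr).toLinearMap ∘ₗ TensorAlgebra.ι k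

variable {gr}

theorem GSym.ι_mul_ι {m n : ℕ} {x y : G} (hx : x ∈ gr m) (hy : y ∈ gr n) :
    GSym.ι gr x * GSym.ι gr y = (-1 : k) ^ ((m + 1) * (n + 1)) • (GSym.ι gr y * GSym.ι gr x) := by
  have : GSym.mk gr _ = GSym.mk gr _ :=
    RingQuot.mkAlgHom_rel k (GSymRel.comm (gr := gr) m n x y hx hy)
  simpa [GSym.ι] using this

/-- The universal property of the graded symmetric algebra. -/
def GSym.lift {B : Type*} [Ring B] [Algebra k B] (f : G →ₗ[k] B)
    (hf : ∀ m n : ℕ, ∀ x ∈ gr m, ∀ y ∈ gr n,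
      f x * f y = (-1 : k) ^ ((m + 1) * (n + 1)) • (f y * f x)) : GSym gr →ₐ[k] B :=
  RingQuot.liftAlgHom k ⟨TensorAlgebra.lift k f, by
    rintro _ _ ⟨m, n, x, y, hx, hy⟩
    simpa using hf m n x hx y hy⟩

theorem GSym.lift_ι {B : Type*} [Ring B] [Algebra k B] (f : G →ₗ[k] B) (hf) (x : G) :
    GSym.lift (gr := gr) f hf (GSym.ι gr x) = f x := by
  have h := RingQuot.liftAlgHom_mkAlgHom_apply k (TensorAlgebra.lift k f)
    (s := GSymRel gr) (by
      rintro _ _ ⟨m, n, x, y, hx, hy⟩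
      simpa using hf m n x hx y hy) (TensorAlgebra.ι k x)
  exact h.trans (TensorAlgebra.lift_ι_apply f x)

theorem GSym.hom_ext {B : Type*} [Ring B] [Algebra k B] {f g : GSym gr →ₐ[k] B}
    (h : ∀ x, f (GSym.ι gr x) = g (GSym.ι gr x)) : f = g := by
  apply RingQuot.ringQuot_ext'
  apply TensorAlgebra.hom_ext
  ext x
  exact h x

theorem GSym.induction {P : GSym gr → Prop} (one : P 1) (smul : ∀ (c : k) a, P a → P (c • a))
    (add : ∀ a b, P a → P b → P (a + b)) (mul : ∀ x a, P a → P (GSym.ι gr x * a))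
    (s : GSym gr) : P s := by
  obtain ⟨t, rfl⟩ : ∃ t, GSym.mk gr t = s := RingQuot.mkAlgHom_surjective k (GSymRel gr) s
  suffices h : ∀ u, P u → P (GSym.mk gr t * u) by
    simpa using h 1 one
  induction t using TensorAlgebra.induction with
  | algebraMap c =>
    intro u hu
    rw [AlgHom.commutes, ← Algebra.smul_def]
    exact smul _ _ hu
  | ι x => intro u hu; exact mul x u hu
  | mul a b ha hb => intro u hu; rw [map_mul, mul_assoc]; exact ha _ (hb _ hu)
  | add a b ha hb => intro u hu; rw [map_add, add_mul]; exact add _ _ (ha _ hu) (hb _ hu)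

variable (gr) in
/-- The degree-`p` part of the graded symmetric algebra: the span of the products
`s⁻¹x₁ ⋯ s⁻¹xᵣ` of homogeneous generators with `∑ (|xᵢ| - 1) = p`. -/
def GSym.deg (p : ℤ) : Submodule k (GSym gr) :=
  Submodule.span k {s | ∃ l : List (ℕ × G), (∀ a ∈ l, a.2 ∈ gr a.1) ∧
    (l.map fun a => (a.1 : ℤ) - 1).sum = p ∧ s = (l.map fun a => GSym.ι gr a.2).prod}

variable (gr) in
/-- The canonical augmentation `Sym(G[-1]) → k`. -/
def GSym.augmentation : GSym gr →ₐ[k] k := GSym.lift 0 (by simp)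

namespace CurvedDGLieCoalgebra

variable (C : CurvedDGLieCoalgebra k G)

/-- The underlying graded commutative algebra `Sym(G[-1])` of the Lie cobar construction. -/
abbrev LieCobar : Type _ := GSym C.gr

/-- The sign involution `s ↦ (-1)^|s| s` of `Sym(G[-1])`. -/
def cobarSign : C.LieCobar →ₐ[k] C.LieCobar :=
  GSym.lift (-(GSym.ι C.gr ∘ₗ parity C.gr C.internal)) (by
    intro m n x hx y hy
    simp only [LinearMap.neg_apply, LinearMap.comp_apply, parity,
      gradeScale_of_mem C.gr C.internal _ hx, gradeScale_of_mem C.gr C.internal _ hy, map_smul,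
      neg_mul_neg, smul_mul_smul_comm, GSym.ι_mul_ι hx hy, smul_smul]
    ring_nf)

/-- The three components of the differential on generators:
`d₀ s⁻¹x = h(x)`, `d₁ s⁻¹x = - s⁻¹ dx` and
`d₂ s⁻¹x = -½ ∑ (-1)^|x'| s⁻¹x' s⁻¹x''`, where `]x[ = ∑ x' ⊗ x''`. -/
def cobarGen₀ : G →ₗ[k] C.LieCobar := Algebra.linearMap k C.LieCobar ∘ₗ C.h

/-- The component `d₁` of the differential on generators. -/
def cobarGen₁ : G →ₗ[k] C.LieCobar := -(GSym.ι C.gr ∘ₗ C.d)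

/-- The component `d₂` of the differential on generators. -/
def cobarGen₂ : G →ₗ[k] C.LieCobar :=
  -(2⁻¹ : k) • (LinearMap.mul' k C.LieCobar ∘ₗ
    TensorProduct.map (GSym.ι C.gr ∘ₗ parity C.gr C.internal) (GSym.ι C.gr) ∘ₗ C.cobr)

/-- The differential on generators. -/
def cobarGen : G →ₗ[k] C.LieCobar := C.cobarGen₀ + C.cobarGen₁ + C.cobarGen₂

theorem cobarSign_ι {m : ℕ} {x : G} (hx : x ∈ C.gr m) :
    C.cobarSign (GSym.ι C.gr x) = (-1 : k) ^ (m + 1) • GSym.ι C.gr x := by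
  rw [cobarSign, GSym.lift_ι]
  simp [parity, gradeScale_of_mem C.gr C.internal _ hx, pow_succ]

theorem cobarGen_comm {m n : ℕ} {x y : G} (hx : x ∈ C.gr m) (hy : y ∈ C.gr n) :
    C.cobarGen y * GSym.ι C.gr x =
      (-1 : k) ^ (n * (m + 1)) • (GSym.ι C.gr x * C.cobarGen y) := by
  have h0 : C.cobarGen₀ y * GSym.ι C.gr x =
      (-1 : k) ^ (n * (m + 1)) • (GSym.ι C.gr x * C.cobarGen₀ y) := by
    by_cases hn : n = 2
    · subst hn
      simp [cobarGen₀, pow_mul, Algebra.commutes]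
    · simp [cobarGen₀, C.h_mem n hn y hy]
  have h1 : C.cobarGen₁ y * GSym.ι C.gr x =
      (-1 : k) ^ (n * (m + 1)) • (GSym.ι C.gr x * C.cobarGen₁ y) := by
    cases n with
    | zero => simp [cobarGen₁, C.d_zero y hy]
    | succ n =>
      simp [cobarGen₁, GSym.ι_mul_ι (C.d_mem n y hy) hx]
  have h2 : C.cobarGen₂ y * GSym.ι C.gr x =
      (-1 : k) ^ (n * (m + 1)) • (GSym.ι C.gr x * C.cobarGen₂ y) := by
    let L : G ⊗[k] G →ₗ[k] C.LieCobar := LinearMap.mul' k C.LieCobar ∘ₗ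
      TensorProduct.map (GSym.ι C.gr ∘ₗ parity C.gr C.internal) (GSym.ι C.gr)
    let N : G ⊗[k] G →ₗ[k] C.LieCobar :=
      (LinearMap.mulRight k (GSym.ι C.gr x) -
        (-1 : k) ^ (n * (m + 1)) • LinearMap.mulLeft k (GSym.ι C.gr x)) ∘ₗ L
    have key : (⨆ (i : ℕ) (j : ℕ) (_ : i + j = n), tensorSub (C.gr i) (C.gr j)) ≤
        LinearMap.ker N := by
      refine iSup_le fun i => iSup_le fun j => iSup_le fun hij => ?_
      rw [tensorSub, LinearMap.range_le_ker_iff]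
      refine TensorProduct.ext' fun a b => ?_
      have ha := GSym.ι_mul_ι a.2 hx
      have hb := GSym.ι_mul_ι b.2 hx
      simp only [N, L, LinearMap.comp_apply, TensorProduct.map_tmul, Submodule.subtype_apply,
        LinearMap.mul'_apply, parity, gradeScale_of_mem C.gr C.internal _ a.2, map_smul,
        LinearMap.sub_apply, LinearMap.mulRight_apply, LinearMap.smul_apply,
        LinearMap.mulLeft_apply, LinearMap.zero_apply, smul_mul_assoc]
      rw [mul_assoc, hb, mul_smul_comm, ← mul_assoc, ha, smul_mul_assoc, mul_assoc, smul_smul,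
        ← pow_add, ← hij, show (j + 1) * (m + 1) + (i + 1) * (m + 1) =
          (i + j) * (m + 1) + 2 * (m + 1) by ring, pow_add _ _ (2 * (m + 1)), pow_mul _ 2]
      simp
    have h := key (C.cobr_mem n y hy)
    simp only [N, LinearMap.mem_ker, LinearMap.comp_apply, LinearMap.sub_apply, sub_eq_zero,
      LinearMap.mulRight_apply, LinearMap.smul_apply, LinearMap.mulLeft_apply] at h
    have e : C.cobarGen₂ y = -(2⁻¹ : k) • L (C.cobr y) := rfl
    rw [e, smul_mul_assoc, h, mul_smul_comm, smul_comm]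
  simp only [cobarGen, LinearMap.add_apply, add_mul, mul_add, smul_add, h0, h1, h2]

/-- The algebra map `s ↦ [[σ s, D s], [0, s]]` whose corner is the derivation extending
`cobarGen`; multiplicativity of it is the signed Leibniz rule. -/
def cobarMatrix : C.LieCobar →ₐ[k] Matrix (Fin 2) (Fin 2) C.LieCobar :=
  GSym.lift
    { toFun := fun x => !![C.cobarSign (GSym.ι C.gr x), C.cobarGen x; 0, GSym.ι C.gr x]
      map_add' := fun x y => by ext i j; fin_cases i <;> fin_cases j <;> simp
      map_smul' := fun c x => by ext i j; fin_cases i <;> fin_cases j <;> simp } (by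
    intro m n x hx y hy
    have h1 := C.cobarGen_comm hx hy
    have h2 := C.cobarGen_comm hy hx
    have h3 := GSym.ι_mul_ι hx hy
    have e1 : (-1 : k) ^ ((m + 1) * (n + 1)) * (-1) ^ (n + 1) = (-1) ^ (m * (n + 1)) := by
      rw [← pow_add, show (m + 1) * (n + 1) + (n + 1) = m * (n + 1) + 2 * (n + 1) by ring,
        pow_add, pow_mul _ 2]
      simp
    have e2 : (-1 : k) ^ ((m + 1) * (n + 1)) * (-1) ^ (n * (m + 1)) = (-1) ^ (m + 1) := by
      rw [← pow_add, show (m + 1) * (n + 1) + n * (m + 1) = (m + 1) + 2 * ((m + 1) * n) by ring,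
        pow_add, pow_mul _ 2]
      simp
    simp only [LinearMap.coe_mk, AddHom.coe_mk, Matrix.mul_fin_two, Matrix.smul_of,
      Matrix.smul_cons, Matrix.smul_empty, cobarSign_ι C hx, cobarSign_ι C hy, mul_zero,
      zero_mul, add_zero, zero_add, smul_zero]
    rw [smul_mul_smul_comm, smul_mul_smul_comm, h3, h1, h2, smul_add, smul_smul, smul_mul_assoc,
      smul_mul_assoc, smul_smul, smul_smul, smul_smul, e1, e2,
      add_comm ((-1 : k) ^ (m * (n + 1)) • _), mul_comm ((-1 : k) ^ (m + 1) * (-1) ^ (n + 1)),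
      mul_comm ((-1 : k) ^ (m + 1)) ((-1) ^ (n + 1))])

/-- The differential `d₀ + d₁ + d₂` of the Lie cobar construction: the derivation of degree `-1`
of `Sym(G[-1])` given on generators by `cobarGen`. -/
def cobarD : C.LieCobar →ₗ[k] C.LieCobar where
  toFun s := C.cobarMatrix s 0 1
  map_add' s t := by simp
  map_smul' c s := by simp

theorem cobarMatrix_apply (s : C.LieCobar) :
    C.cobarMatrix s 0 0 = C.cobarSign s ∧ C.cobarMatrix s 1 0 = 0 ∧ C.cobarMatrix s 1 1 = s := by
  induction s using GSym.induction with
  | one => simp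
  | smul c a ha => simp [ha]
  | add a b ha hb => simp [ha, hb]
  | mul x a ha =>
    have h : C.cobarMatrix (GSym.ι C.gr x) =
      !![C.cobarSign (GSym.ι C.gr x), C.cobarGen x; 0, GSym.ι C.gr x] := by
      rw [cobarMatrix, GSym.lift_ι]; rfl
    simp [Matrix.mul_apply, Fin.sum_univ_two, ha, h]

theorem cobarD_ι (x : G) : C.cobarD (GSym.ι C.gr x) = C.cobarGen x := by
  show C.cobarMatrix (GSym.ι C.gr x) 0 1 = _
  rw [cobarMatrix, GSym.lift_ι]; rfl

/-- The signed Leibniz rule. -/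
theorem cobarD_mul (s t : C.LieCobar) :
    C.cobarD (s * t) = C.cobarD s * t + C.cobarSign s * C.cobarD t := by
  simp [cobarD, Matrix.mul_apply, Fin.sum_univ_two, (C.cobarMatrix_apply s).1,
    (C.cobarMatrix_apply t).2.2, add_comm]

end CurvedDGLieCoalgebra

end Cobar

section Cofree

set_option linter.unusedSectionVars false

variable {k : Type*} [Field k] {V : Type*} [AddCommGroup V] [Module k V]

instance : AddCommGroup (TensorAlgebra k V) := Ring.toAddCommGroup

instance : AddCommMonoid (TensorAlgebra k V) := AddCommGroup.toAddCommMonoid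

instance : Module k (TensorAlgebra k V) := Algebra.toModule

/-- The word `v₁ ⋯ vₙ` in the tensor algebra. -/
def word (k : Type*) [Field k] {V : Type*} [AddCommGroup V] [Module k V] (l : List V) :
    TensorAlgebra k V :=
  (l.map (TensorAlgebra.ι k)).prod

theorem word_nil : word k ([] : List V) = 1 := rfl

theorem word_cons (a : V) (l : List V) : word k (a :: l) = TensorAlgebra.ι k a * word k l := by
  simp [word]

theorem word_append (l m : List V) : word k (l ++ m) = word k l * word k m := by
  simp [word]

theorem span_word : Submodule.span k (Set.range (word k (V := V))) = ⊤ := by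
  rw [eq_top_iff]
  rintro t -
  suffices h : ∀ u ∈ Submodule.span k (Set.range (word k (V := V))),
      t * u ∈ Submodule.span k (Set.range (word k (V := V))) by
    simpa using h 1 (Submodule.subset_span ⟨[], rfl⟩)
  induction t using TensorAlgebra.induction with
  | algebraMap c => intro u hu; rw [← Algebra.smul_def]; exact Submodule.smul_mem _ _ hu
  | ι x =>
    intro u hu
    induction hu using Submodule.span_induction with
    | mem y hy =>
      obtain ⟨l, rfl⟩ := hy
      exact Submodule.subset_span ⟨x :: l, word_cons x l⟩
    | zero => simp
    | add a b _ _ ha hb => rw [mul_add]; exact Submodule.add_mem _ ha hb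
    | smul c a _ ha => rw [mul_smul_comm]; exact Submodule.smul_mem _ _ ha
  | mul a b ha hb => intro u hu; rw [mul_assoc]; exact ha _ (hb _ hu)
  | add a b ha hb => intro u hu; rw [add_mul]; exact Submodule.add_mem _ (ha _ hu) (hb _ hu)

theorem word_ext {M : Type*} [AddCommGroup M] [Module k M] {f g : TensorAlgebra k V →ₗ[k] M}
    (h : ∀ l, f (word k l) = g (word k l)) : f = g :=
  LinearMap.ext_on_range span_word h

/-- Linear recursion on the first letter of a tensor: `f 1 = m₀` and
`f (v * u) = step v (u, f u)`. -/
def tensorRec {M : Type*} [AddCommGroup M] [Module k M] (m₀ : M)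
    (step : V →ₗ[k] (TensorAlgebra k V × M) →ₗ[k] M) : TensorAlgebra k V →ₗ[k] M where
  toFun t := ((TensorAlgebra.lift k (A := Module.End k (TensorAlgebra k V × M))
    { toFun := fun v => LinearMap.prod
        (LinearMap.mulLeft k (TensorAlgebra.ι k v) ∘ₗ LinearMap.fst k _ _) (step v)
      map_add' := fun v w => by ext <;> simp [add_mul]
      map_smul' := fun c v => by ext <;> simp }) t (1, m₀)).2
  map_add' s t := by simp
  map_smul' c s := by simp

section Rec

variable {M : Type*} [AddCommGroup M] [Module k M] (m₀ : M)
  (step : V →ₗ[k] (TensorAlgebra k V × M) →ₗ[k] M)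

theorem tensorRec_one : tensorRec m₀ step 1 = m₀ := by simp [tensorRec]

theorem tensorRec_ι_mul (v : V) (u : TensorAlgebra k V) :
    tensorRec m₀ step (TensorAlgebra.ι k v * u) = step v (u, tensorRec m₀ step u) := by
  set L : TensorAlgebra k V →ₐ[k] Module.End k (TensorAlgebra k V × M) := TensorAlgebra.lift k
    { toFun := fun v => LinearMap.prod
        (LinearMap.mulLeft k (TensorAlgebra.ι k v) ∘ₗ LinearMap.fst k _ _) (step v)
      map_add' := fun v w => by ext <;> simp [add_mul]
      map_smul' := fun c v => by ext <;> simp } with hL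
  have h : ∀ t x, (L t x).1 = t * x.1 := by
    intro t
    induction t using TensorAlgebra.induction with
    | algebraMap c => intro x; simp [Algebra.smul_def]
    | ι x => intro y; simp [hL]
    | mul a b ha hb => intro x; simp [ha, hb, mul_assoc]
    | add a b ha hb => intro x; simp [ha, hb, add_mul]
  have h1 : L u (1, m₀) = (u, tensorRec m₀ step u) := Prod.ext (by simp [h]) rfl
  change (L (TensorAlgebra.ι k v * u) (1, m₀)).2 = _
  rw [map_mul, Module.End.mul_apply, h1]
  simp [hL]

end Rec

/-- The deconcatenation coproduct: `Δ(v₁ ⋯ vₙ) = ∑ᵢ v₁ ⋯ vᵢ ⊗ vᵢ₊₁ ⋯ vₙ`. -/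
def deconc : TensorAlgebra k V →ₗ[k] TensorAlgebra k V ⊗[k] TensorAlgebra k V :=
  tensorRec (1 ⊗ₜ 1)
    { toFun := fun v =>
        TensorProduct.mk k _ _ 1 ∘ₗ LinearMap.mulLeft k (TensorAlgebra.ι k v) ∘ₗ
            LinearMap.fst k _ _ +
          (LinearMap.mulLeft k (TensorAlgebra.ι k v)).rTensor _ ∘ₗ LinearMap.snd k _ _
      map_add' := fun v w => by
        ext <;> simp [add_mul, TensorProduct.tmul_add, TensorProduct.add_tmul]
      map_smul' := fun c v => by
        ext <;> simp [TensorProduct.smul_tmul'] }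

theorem deconc_one : deconc (1 : TensorAlgebra k V) = 1 ⊗ₜ 1 := tensorRec_one _ _

theorem deconc_ι_mul (v : V) (u : TensorAlgebra k V) :
    deconc (TensorAlgebra.ι k v * u) = 1 ⊗ₜ (TensorAlgebra.ι k v * u) +
      (LinearMap.mulLeft k (TensorAlgebra.ι k v)).rTensor _ (deconc u) := by
  rw [deconc, tensorRec_ι_mul]; rfl

/-- All ways to cut a list in two. -/
def splits : List V → List (List V × List V)
  | [] => [([], [])]
  | a :: l => ([], a :: l) :: (splits l).map fun p => (a :: p.1, p.2)

theorem splits_length (l : List V) : ∀ p ∈ splits l, p.1.length + p.2.length = l.length := by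
  induction l with
  | nil => simp [splits]
  | cons a l ih =>
    simp only [splits, List.mem_cons, List.mem_map]
    rintro p (rfl | ⟨q, hq, rfl⟩)
    · simp
    · have := ih q hq; simp; omega

/-- Sum of `f p q` over all cuts of a list. -/
def splitSum {M : Type*} [AddCommMonoid M] (l : List V) (f : List V → List V → M) : M :=
  ((splits l).map fun p => f p.1 p.2).sum

section splitSum

variable {M : Type*} [AddCommMonoid M]

theorem splitSum_nil (f : List V → List V → M) : splitSum [] f = f [] [] := by
  simp [splitSum, splits]

theorem splitSum_cons (a : V) (l : List V) (f : List V → List V → M) :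
    splitSum (a :: l) f = f [] (a :: l) + splitSum l fun p q => f (a :: p) q := by
  simp [splitSum, splits, Function.comp_def]

theorem splitSum_add (l : List V) (f g : List V → List V → M) :
    splitSum l (fun p q => f p q + g p q) = splitSum l f + splitSum l g := by
  simp [splitSum, List.sum_map_add]

theorem splitSum_map {N : Type*} [AddCommMonoid N] (φ : M →+ N) (l : List V)
    (f : List V → List V → M) : φ (splitSum l f) = splitSum l fun p q => φ (f p q) := by
  simp [splitSum, map_list_sum, Function.comp_def]

theorem splitSum_linear {N : Type*} [AddCommMonoid N] [Module k M] [Module k N] (φ : M →ₗ[k] N)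
    (l : List V) (f : List V → List V → M) :
    φ (splitSum l f) = splitSum l fun p q => φ (f p q) :=
  splitSum_map φ.toAddMonoidHom l f

theorem splitSum_smul [Module k M] (c : k) (l : List V) (f : List V → List V → M) :
    c • splitSum l f = splitSum l fun p q => c • f p q :=
  splitSum_map (DistribSMul.toAddMonoidHom M c) l f

theorem splitSum_congr (l : List V) {f g : List V → List V → M}
    (h : ∀ p q, p.length + q.length = l.length → f p q = g p q) : splitSum l f = splitSum l g := by
  simp only [splitSum]
  congr 1
  exact List.map_congr_left fun p hp => h _ _ (splits_length l p hp)

theorem splitSum_zero (l : List V) : splitSum l (fun _ _ => (0 : M)) = 0 := by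
  simp [splitSum]

theorem splitSum_assoc (l : List V) (f : List V → List V → List V → M) :
    splitSum l (fun p q => splitSum p fun p₁ p₂ => f p₁ p₂ q) =
      splitSum l (fun p q => splitSum q fun q₁ q₂ => f p q₁ q₂) := by
  induction l generalizing f with
  | nil => simp [splitSum_nil]
  | cons a l ih =>
    simp only [splitSum_cons, splitSum_nil, splitSum_add, ih fun p q r => f (a :: p) q r]
    abel

end splitSum

theorem deconc_word (l : List V) :
    deconc (word k l) = splitSum l fun p q => word k p ⊗ₜ[k] word k q := by
  induction l with
  | nil => simp [splitSum_nil, word_nil, deconc_one]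
  | cons a l ih =>
    simp [splitSum_cons, word_cons, deconc_ι_mul, ih, splitSum_linear, word_nil]

/-- The signed shuffle product of two words of letters of degree `1`. -/
def shuffle (k : Type*) [Field k] {V : Type*} [AddCommGroup V] [Module k V] :
    List V → List V → TensorAlgebra k V
  | [], m => word k m
  | a :: l, [] => word k (a :: l)
  | a :: l, b :: m => TensorAlgebra.ι k a * shuffle k l (b :: m) +
      (-1 : k) ^ (l.length + 1) • (TensorAlgebra.ι k b * shuffle k (a :: l) m)
termination_by l m => l.length + m.length

theorem shuffle_nil_left (m : List V) : shuffle k [] m = word k m := by rw [shuffle]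

theorem shuffle_nil_right (l : List V) : shuffle k l [] = word k l := by
  cases l <;> rw [shuffle]

theorem shuffle_cons_cons (a b : V) (l m : List V) : shuffle k (a :: l) (b :: m) =
    TensorAlgebra.ι k a * shuffle k l (b :: m) +
      (-1 : k) ^ (l.length + 1) • (TensorAlgebra.ι k b * shuffle k (a :: l) m) := by
  rw [shuffle]

/-- The span of `1` and of the shuffle products of two non-empty words. -/
def shuffleSub (k : Type*) [Field k] (V : Type*) [AddCommGroup V] [Module k V] :
    Submodule k (TensorAlgebra k V) :=
  Submodule.span k ({1} ∪ {t | ∃ (a b : V) (l m : List V), t = shuffle k (a :: l) (b :: m)})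

/-- The cofree conilpotent graded Lie coalgebra on `sV`, for a vector space `V` in degree `0`:
the reduced tensor coalgebra on `sV` modulo (signed) shuffle products. -/
abbrev CofreeLie (k : Type*) [Field k] (V : Type*) [AddCommGroup V] [Module k V] : Type _ :=
  TensorAlgebra k V ⧸ shuffleSub k V

instance : AddCommGroup (CofreeLie k V) := Submodule.Quotient.addCommGroup _

instance : Module k (CofreeLie k V) := Submodule.Quotient.module _

/-- The class of a word in the cofree Lie coalgebra. -/
def lword (k : Type*) [Field k] {V : Type*} [AddCommGroup V] [Module k V] (l : List V) :
    CofreeLie k V := (shuffleSub k V).mkQ (word k l)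

theorem lword_nil : lword k ([] : List V) = 0 := by
  rw [lword, Submodule.mkQ_apply, Submodule.Quotient.mk_eq_zero]
  exact Submodule.subset_span (Or.inl rfl)

theorem mkQ_shuffle (a b : V) (l m : List V) :
    (shuffleSub k V).mkQ (shuffle k (a :: l) (b :: m)) = 0 := by
  rw [Submodule.mkQ_apply, Submodule.Quotient.mk_eq_zero]
  exact Submodule.subset_span (Or.inr ⟨a, b, l, m, rfl⟩)

theorem lword_ext {M : Type*} [AddCommGroup M] [Module k M] {f g : CofreeLie k V →ₗ[k] M}
    (h : ∀ l, f (lword k l) = g (lword k l)) : f = g :=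
  Submodule.linearMap_qext _ (word_ext h)

/-- A linear map on the tensor algebra that kills `1` and shuffles descends. -/
theorem shuffleSub_le_ker {M : Type*} [AddCommGroup M] [Module k M]
    (f : TensorAlgebra k V →ₗ[k] M) (h1 : f 1 = 0)
    (h : ∀ a b l m, f (shuffle k (a :: l) (b :: m)) = 0) :
    shuffleSub k V ≤ LinearMap.ker f := by
  rw [shuffleSub, Submodule.span_le]
  rintro t (rfl | ⟨a, b, l, m, rfl⟩)
  · exact h1
  · exact h a b l m

end Cofree

section CofreeGrading

variable {k : Type*} [Field k] {V : Type*} [AddCommGroup V] [Module k V]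

/-- The components of a tensor in each weight. -/
def weightComp : TensorAlgebra k V →ₗ[k] (ℕ → TensorAlgebra k V) :=
  tensorRec (Pi.single 0 1)
    { toFun := fun v => LinearMap.pi fun n => match n with
        | 0 => 0
        | n + 1 => LinearMap.mulLeft k (TensorAlgebra.ι k v) ∘ₗ LinearMap.proj n ∘ₗ
            LinearMap.snd k _ _
      map_add' := fun v w => by
        ext x n <;> cases n <;> simp [add_mul]
      map_smul' := fun c v => by
        ext x n <;> cases n <;> simp }

theorem weightComp_one : weightComp (1 : TensorAlgebra k V) = Pi.single 0 1 := tensorRec_one _ _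

theorem weightComp_ι_mul (v : V) (u w : TensorAlgebra k V) (n : ℕ)
    (h : weightComp u = Pi.single n w) :
    weightComp (TensorAlgebra.ι k v * u) = Pi.single (n + 1) (TensorAlgebra.ι k v * w) := by
  rw [weightComp, tensorRec_ι_mul, ← weightComp, h]
  funext m
  cases m with
  | zero => simp
  | succ m =>
    simp only [LinearMap.coe_mk, AddHom.coe_mk, LinearMap.pi_apply, LinearMap.comp_apply,
      LinearMap.snd_apply, LinearMap.proj_apply, LinearMap.mulLeft_apply, Pi.single_apply,
      Nat.add_right_cancel_iff]
    split_ifs <;> simp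

theorem weightComp_word (l : List V) :
    weightComp (word k l) = Pi.single l.length (word k l) := by
  induction l with
  | nil => exact weightComp_one
  | cons a l ih => rw [word_cons, weightComp_ι_mul a _ _ _ ih]; rfl

theorem weightComp_shuffle (l m : List V) :
    weightComp (shuffle k l m) = Pi.single (l.length + m.length) (shuffle k l m) := by
  induction l, m using shuffle.induct with
  | case1 m => simp [shuffle_nil_left, weightComp_word]
  | case2 a l => rw [shuffle_nil_right, weightComp_word]; rfl
  | case3 a l b m ih1 ih2 =>
    rw [shuffle_cons_cons, map_add, map_smul, weightComp_ι_mul a _ _ _ ih1,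
      weightComp_ι_mul b _ _ _ ih2]
    have e : (a :: l).length + m.length + 1 = (a :: l).length + (b :: m).length := by simp; omega
    have e' : l.length + (b :: m).length + 1 = (a :: l).length + (b :: m).length := by simp; omega
    rw [e, e', Pi.single_add, Pi.single_smul]

/-- The weight-`n` part of the cofree Lie coalgebra on `sV`; it is also its part of degree `n`. -/
def lieGr (k : Type*) [Field k] (V : Type*) [AddCommGroup V] [Module k V] (n : ℕ) :
    Submodule k (CofreeLie k V) :=
  Submodule.span k {x | ∃ l : List V, l.length = n ∧ x = lword k l}

theorem lword_mem (l : List V) : lword k l ∈ lieGr k V l.length :=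
  Submodule.subset_span ⟨l, rfl, rfl⟩

theorem lieGr_zero : lieGr k V 0 = ⊥ := by
  rw [lieGr, Submodule.span_eq_bot]
  rintro x ⟨l, hl, rfl⟩
  rw [List.length_eq_zero_iff.mp hl, lword_nil]

theorem iSup_lieGr : ⨆ n, lieGr k V n = ⊤ := by
  rw [eq_top_iff]
  rintro x -
  obtain ⟨t, rfl⟩ := Submodule.mkQ_surjective _ x
  have ht : t ∈ Submodule.span k (Set.range (word k (V := V))) := by rw [span_word]; trivial
  induction ht using Submodule.span_induction with
  | mem y hy =>
    obtain ⟨l, rfl⟩ := hy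
    exact Submodule.mem_iSup_of_mem l.length (lword_mem l)
  | zero => simp
  | add a b _ _ ha hb => rw [map_add]; exact Submodule.add_mem _ ha hb
  | smul c a _ ha => rw [map_smul]; exact Submodule.smul_mem _ _ ha

/-- The projection of the cofree Lie coalgebra onto weight `n`. -/
def lieProj (n : ℕ) : CofreeLie k V →ₗ[k] CofreeLie k V :=
  (shuffleSub k V).liftQ ((shuffleSub k V).mkQ ∘ₗ LinearMap.proj n ∘ₗ weightComp) <|
    shuffleSub_le_ker _
      (by
        rw [LinearMap.comp_apply, LinearMap.comp_apply, weightComp_one, LinearMap.proj_apply,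
          Pi.single_apply]
        split_ifs
        · exact lword_nil
        · simp)
      (fun a b l m => by
        rw [LinearMap.comp_apply, LinearMap.comp_apply, weightComp_shuffle, LinearMap.proj_apply,
          Pi.single_apply]
        split_ifs
        · exact mkQ_shuffle a b l m
        · simp)

theorem lieProj_of_mem {m n : ℕ} {x : CofreeLie k V} (hx : x ∈ lieGr k V m) :
    lieProj n x = if m = n then x else 0 := by
  induction hx using Submodule.span_induction with
  | mem y hy =>
    obtain ⟨l, rfl, rfl⟩ := hy
    rw [lword, lieProj, Submodule.mkQ_apply, Submodule.liftQ_apply, LinearMap.comp_apply,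
      LinearMap.comp_apply, weightComp_word, LinearMap.proj_apply, Pi.single_apply]
    simp only [eq_comm]
    split_ifs <;> simp
  | zero => simp
  | add a b _ _ ha hb => rw [map_add, ha, hb]; split_ifs <;> simp
  | smul c a _ ha => rw [map_smul, ha]; split_ifs <;> simp

/-- A family of subspaces that spans and is separated by projections is a grading. -/
theorem internal_of_proj {G H : Type*} [AddCommGroup G] [Module k G] [AddCommGroup H]
    [Module k H] (gr : ℕ → Submodule k G) (i : G →ₗ[k] H) (hi : Function.Injective i)
    (p : ℕ → G →ₗ[k] H) (hp : ∀ m n, ∀ x ∈ gr m, p n x = if m = n then i x else 0)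
    (htop : ⨆ n, gr n = ⊤) : DirectSum.IsInternal gr := by
  rw [DirectSum.isInternal_submodule_iff_iSupIndep_and_iSup_eq_top]
  refine ⟨fun n => ?_, htop⟩
  rw [Submodule.disjoint_def]
  intro x hx hx'
  have h1 : p n x = i x := by rw [hp n n x hx, if_pos rfl]
  have h2 : (⨆ (j : ℕ) (_ : j ≠ n), gr j) ≤ LinearMap.ker (p n) := by
    refine iSup_le fun j => iSup_le fun hj y hy => ?_
    rw [LinearMap.mem_ker, hp j n y hy, if_neg hj]
  have h3 : p n x = 0 := h2 hx'
  exact hi (by rw [← h1, h3, map_zero])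

theorem lieGr_internal : DirectSum.IsInternal (lieGr k V) :=
  internal_of_proj (lieGr k V) LinearMap.id Function.injective_id lieProj
    (fun _ _ _ hx => lieProj_of_mem hx) iSup_lieGr

/-- Both sides of the coproduct, modulo shuffles. -/
def lieDeconc : TensorAlgebra k V →ₗ[k] CofreeLie k V ⊗[k] CofreeLie k V :=
  TensorProduct.map (shuffleSub k V).mkQ (shuffleSub k V).mkQ ∘ₗ deconc

theorem lieDeconc_word (l : List V) :
    lieDeconc (word k l) = splitSum l fun p q => lword k p ⊗ₜ[k] lword k q := by
  rw [lieDeconc, LinearMap.comp_apply, deconc_word, splitSum_linear]; rfl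

theorem lTensor_deconc_shuffle (l m : List V) :
    (shuffleSub k V).mkQ.lTensor _ (deconc (shuffle k l m)) =
      (splitSum l fun p q => (-1 : k) ^ (q.length * m.length) • (shuffle k p m ⊗ₜ lword k q)) +
      splitSum m fun p q => shuffle k l p ⊗ₜ lword k q := by
  have step : ∀ (a : V) (u : TensorAlgebra k V),
      (shuffleSub k V).mkQ.lTensor _ (deconc (TensorAlgebra.ι k a * u)) =
        1 ⊗ₜ (shuffleSub k V).mkQ (TensorAlgebra.ι k a * u) +
        (LinearMap.mulLeft k (TensorAlgebra.ι k a)).rTensor _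
          ((shuffleSub k V).mkQ.lTensor _ (deconc u)) := by
    intro a u
    rw [deconc_ι_mul, map_add, LinearMap.lTensor_tmul]
    congr 1
    generalize deconc u = X
    rw [← LinearMap.comp_apply, ← LinearMap.comp_apply, LinearMap.lTensor_comp_rTensor,
      LinearMap.rTensor_comp_lTensor]
  induction l, m using shuffle.induct with
  | case1 m =>
    rw [splitSum_nil, lword_nil, TensorProduct.tmul_zero, smul_zero, zero_add, shuffle_nil_left,
      deconc_word, splitSum_linear]
    simp only [shuffle_nil_left]
    rfl
  | case2 a l =>
    rw [splitSum_nil, lword_nil, TensorProduct.tmul_zero, add_zero, shuffle_nil_right,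
      deconc_word, splitSum_linear]
    simp only [shuffle_nil_right, List.length_nil, mul_zero, pow_zero, one_smul]
    rfl
  | case3 a l b m ih1 ih2 =>
    have h0 := mkQ_shuffle (k := k) a b l m
    rw [shuffle_cons_cons, map_add, map_smul] at h0
    rw [shuffle_cons_cons, map_add, map_add, map_smul, map_smul, step, step, smul_add]
    rw [add_add_add_comm, ← TensorProduct.tmul_smul, ← TensorProduct.tmul_add, h0,
      TensorProduct.tmul_zero, zero_add, ih1, ih2]
    simp only [map_add, splitSum_linear, splitSum_cons, map_smul, LinearMap.rTensor_tmul,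
      LinearMap.mulLeft_apply, smul_add, shuffle_nil_left, shuffle_nil_right, shuffle_cons_cons]
    simp only [TensorProduct.add_tmul, smul_add, splitSum_add, splitSum_smul]
    have e1 : (splitSum l fun p q => (-1 : k) ^ (q.length * (b :: m).length) •
          (((-1 : k) ^ (p.length + 1) • (TensorAlgebra.ι k b * shuffle k (a :: p) m)) ⊗ₜ[k]
            lword k q)) =
        splitSum l fun p q => (-1 : k) ^ (l.length + 1) • (-1 : k) ^ (q.length * m.length) •
          ((TensorAlgebra.ι k b * shuffle k (a :: p) m) ⊗ₜ[k] lword k q) := by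
      refine splitSum_congr _ fun p q hpq => ?_
      rw [← TensorProduct.smul_tmul', smul_smul, smul_smul, ← hpq, List.length_cons,
        ← pow_add, ← pow_add]
      congr 1
      rw [show p.length + q.length + 1 + q.length * m.length =
        q.length * (m.length + 1) + (p.length + 1) by ring]
    have e2 : (-1 : k) ^ (l.length + 1) • (-1 : k) ^ ((a :: l).length * m.length) •
        ((TensorAlgebra.ι k b * word k m) ⊗ₜ[k] lword k (a :: l)) =
        (-1 : k) ^ ((a :: l).length * (b :: m).length) •
          (word k (b :: m) ⊗ₜ[k] lword k (a :: l)) := by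
      rw [smul_smul, ← pow_add, word_cons b m, List.length_cons, List.length_cons]
      congr 2
      ring
    simp only [← TensorProduct.smul_tmul'] at e1
    simp only [e2, word_cons a l, ← TensorProduct.smul_tmul']
    rw [e1]
    abel

theorem lieDeconc_shuffle (a b : V) (l m : List V) :
    lieDeconc (shuffle k (a :: l) (b :: m)) =
      (-1 : k) ^ ((a :: l).length * (b :: m).length) • (lword k (b :: m) ⊗ₜ lword k (a :: l)) +
        lword k (a :: l) ⊗ₜ lword k (b :: m) := by
  have h : (lieDeconc : TensorAlgebra k V →ₗ[k] _) = (shuffleSub k V).mkQ.rTensor _ ∘ₗ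
      (shuffleSub k V).mkQ.lTensor _ ∘ₗ deconc := by
    rw [← LinearMap.comp_assoc, LinearMap.rTensor_comp_lTensor]; rfl
  rw [h, LinearMap.comp_apply, LinearMap.comp_apply, lTensor_deconc_shuffle, map_add,
    splitSum_linear, splitSum_linear, splitSum_cons, splitSum_cons]
  simp only [map_smul, LinearMap.rTensor_tmul, mkQ_shuffle, TensorProduct.zero_tmul, smul_zero,
    splitSum_zero, add_zero, shuffle_nil_left, shuffle_nil_right]
  rfl

theorem koszulSwap_lword (l m : List V) :
    koszulSwap (lieGr k V) lieGr_internal (lword k l ⊗ₜ lword k m) =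
      (-1 : k) ^ (l.length * m.length) • (lword k m ⊗ₜ[k] lword k l) :=
  koszulSwap_tmul _ _ (lword_mem l) (lword_mem m)

/-- The Lie cobracket `Δ - τ Δ` of the cofree Lie coalgebra. -/
def lieCobr : CofreeLie k V →ₗ[k] CofreeLie k V ⊗[k] CofreeLie k V :=
  (shuffleSub k V).liftQ
    (lieDeconc - koszulSwap (lieGr k V) lieGr_internal ∘ₗ lieDeconc) <|
    shuffleSub_le_ker _
      (by
        rw [← word_nil, LinearMap.sub_apply, LinearMap.comp_apply, lieDeconc_word, splitSum_nil,
          lword_nil]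
        simp)
      (fun a b l m => by
        rw [LinearMap.sub_apply, LinearMap.comp_apply, lieDeconc_shuffle, map_add, map_smul,
          koszulSwap_lword, koszulSwap_lword, smul_smul, ← pow_add, mul_comm (b :: m).length,
          ← two_mul, pow_mul]
        simp [add_comm])

theorem lieCobr_mkQ (t : TensorAlgebra k V) : lieCobr ((shuffleSub k V).mkQ t) =
    lieDeconc t - koszulSwap (lieGr k V) lieGr_internal (lieDeconc t) := by
  rw [lieCobr, Submodule.mkQ_apply, Submodule.liftQ_apply]; rfl

theorem lieCobr_lword (l : List V) : lieCobr (lword k l) = splitSum l fun p q =>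
    lword k p ⊗ₜ lword k q - (-1 : k) ^ (p.length * q.length) • (lword k q ⊗ₜ lword k p) := by
  rw [lword, lieCobr_mkQ, lieDeconc_word, splitSum_linear, ← sub_eq_zero]
  simp only [koszulSwap_lword]
  rw [sub_sub, ← splitSum_add, sub_eq_zero]
  exact splitSum_congr _ fun p q _ => by abel

theorem lieCobr_mem (n : ℕ) (x : CofreeLie k V) (hx : x ∈ lieGr k V n) :
    lieCobr x ∈ ⨆ (i : ℕ) (j : ℕ) (_ : i + j = n), tensorSub (lieGr k V i) (lieGr k V j) := by
  have aux : ∀ p q : List V, p.length + q.length = n → lword k p ⊗ₜ[k] lword k q ∈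
      ⨆ (i : ℕ) (j : ℕ) (_ : i + j = n), tensorSub (lieGr k V i) (lieGr k V j) := by
    intro p q h
    refine Submodule.mem_iSup_of_mem p.length (Submodule.mem_iSup_of_mem q.length
      (Submodule.mem_iSup_of_mem h ?_))
    exact ⟨⟨_, lword_mem p⟩ ⊗ₜ ⟨_, lword_mem q⟩, rfl⟩
  induction hx using Submodule.span_induction with
  | mem y hy =>
    obtain ⟨l, rfl, rfl⟩ := hy
    rw [lieCobr_lword, splitSum]
    refine list_sum_mem ?_
    intro z hz
    obtain ⟨p, hp, rfl⟩ := List.mem_map.mp hz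
    have h := splits_length l p hp
    exact Submodule.sub_mem _ (aux _ _ h) (Submodule.smul_mem _ _ (aux _ _ (by omega)))
  | zero => simp
  | add a b _ _ ha hb => rw [map_add]; exact Submodule.add_mem _ ha hb
  | smul c a _ ha => rw [map_smul]; exact Submodule.smul_mem _ _ ha

theorem lieCobr_antisymm :
    koszulSwap (lieGr k V) lieGr_internal ∘ₗ lieCobr = -(lieCobr (k := k) (V := V)) := by
  refine lword_ext fun l => ?_
  rw [LinearMap.comp_apply, LinearMap.neg_apply, lieCobr_lword, splitSum_linear, eq_neg_iff_add_eq_zero,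
    ← splitSum_add, ← splitSum_zero l]
  refine splitSum_congr _ fun p q _ => ?_
  rw [map_sub, map_smul, koszulSwap_lword, koszulSwap_lword, smul_smul, ← pow_add,
    mul_comm q.length, ← two_mul, pow_mul _ 2]
  simp

theorem koszulCycle_lword (p q r : List V) :
    koszulCycle (lieGr k V) lieGr_internal ((lword k p ⊗ₜ lword k q) ⊗ₜ lword k r) =
      ((-1 : k) ^ (q.length * r.length) * (-1) ^ (p.length * r.length)) •
        ((lword k r ⊗ₜ[k] lword k p) ⊗ₜ[k] lword k q) :=
  koszulCycle_tmul _ _ (lword_mem p) (lword_mem q) (lword_mem r)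

theorem lieCobr_coJacobi :
    (LinearMap.id + koszulCycle (lieGr k V) lieGr_internal +
      koszulCycle (lieGr k V) lieGr_internal ∘ₗ koszulCycle (lieGr k V) lieGr_internal) ∘ₗ
      (lieCobr (k := k) (V := V)).rTensor (CofreeLie k V) ∘ₗ lieCobr = 0 := by
  refine lword_ext (k := k) (V := V) 
    (M := (CofreeLie k V ⊗[k] CofreeLie k V) ⊗[k] CofreeLie k V) fun l => ?_
  set Z := LinearMap.id + koszulCycle (lieGr k V) lieGr_internal +
      koszulCycle (lieGr k V) lieGr_internal ∘ₗ koszulCycle (lieGr k V) lieGr_internal with hZ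
  have h : (lieCobr (k := k) (V := V)).rTensor (CofreeLie k V) (lieCobr (lword k l)) =
      splitSum l (fun p q => splitSum p fun p₁ p₂ =>
        ((lword k p₁ ⊗ₜ[k] lword k p₂) ⊗ₜ[k] lword k q -
          (-1 : k) ^ (p₁.length * p₂.length) • ((lword k p₂ ⊗ₜ[k] lword k p₁) ⊗ₜ[k] lword k q))) -
      splitSum l (fun p q => splitSum q fun q₁ q₂ => (-1 : k) ^ (p.length * (q₁.length + q₂.length)) •
        ((lword k q₁ ⊗ₜ[k] lword k q₂) ⊗ₜ[k] lword k p -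
          (-1 : k) ^ (q₁.length * q₂.length) • ((lword k q₂ ⊗ₜ[k] lword k q₁) ⊗ₜ[k] lword k p))) := by
    rw [lieCobr_lword, splitSum_linear, eq_sub_iff_add_eq, ← splitSum_add]
    refine splitSum_congr _ fun p q _ => ?_
    have e : ∀ s r : List V, lieCobr (lword k s) ⊗ₜ[k] lword k r = splitSum s fun p₁ p₂ =>
        ((lword k p₁ ⊗ₜ[k] lword k p₂) ⊗ₜ[k] lword k r -
          (-1 : k) ^ (p₁.length * p₂.length) • ((lword k p₂ ⊗ₜ[k] lword k p₁) ⊗ₜ[k] lword k r)) := by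
      intro s r
      rw [lieCobr_lword]
      have := splitSum_linear (k := k) ((TensorProduct.mk k _ _).flip (lword k r)) s fun p q =>
        lword k p ⊗ₜ[k] lword k q - (-1 : k) ^ (p.length * q.length) • (lword k q ⊗ₜ[k] lword k p)
      simp only [LinearMap.flip_apply, TensorProduct.mk_apply] at this
      rw [this]
      refine splitSum_congr _ fun p q _ => ?_
      rw [TensorProduct.sub_tmul, ← TensorProduct.smul_tmul']
    rw [map_sub, map_smul, LinearMap.rTensor_tmul, LinearMap.rTensor_tmul, e, e, splitSum_smul,
      sub_add_eq_add_sub, sub_eq_iff_eq_add]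
    congr 1
    refine splitSum_congr _ fun q₁ q₂ h => ?_
    rw [h]
  rw [LinearMap.comp_apply, LinearMap.comp_apply, h, ← splitSum_assoc, LinearMap.zero_apply,
    map_sub, sub_eq_zero]
  simp only [splitSum_linear]
  refine splitSum_congr _ fun s r _ => splitSum_congr _ fun p q _ => ?_
  simp only [hZ, LinearMap.add_apply, LinearMap.comp_apply, LinearMap.id_apply, map_sub, map_smul,
    koszulCycle_lword, smul_sub, smul_smul, Nat.mul_add, pow_add]
  rcases neg_one_pow_eq_or k (p.length * q.length) with h1 | h1 <;>
  rcases neg_one_pow_eq_or k (p.length * r.length) with h2 | h2 <;>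
  rcases neg_one_pow_eq_or k (q.length * r.length) with h3 | h3 <;>
  simp only [mul_comm q.length p.length, mul_comm r.length p.length, mul_comm r.length q.length,
    h1, h2, h3] <;>
  module

end CofreeGrading

section Corestrictions

variable {k : Type*} [Field k] {V : Type*} [AddCommGroup V] [Module k V]

variable (k V) in
/-- The cofree Lie coalgebra on `sV` with its weight grading and its cobracket. -/
def cofreeLie : GradedLieCoalgebra k (CofreeLie k V) where
  gr := lieGr k V
  internal := lieGr_internal
  cobr := lieCobr
  cobr_mem := lieCobr_mem
  antisymm := lieCobr_antisymm
  coJacobi := lieCobr_coJacobi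

/-- The projection of the tensor algebra onto words of length one. -/
def tprOne : TensorAlgebra k V →ₗ[k] V :=
  tensorRec 0
    { toFun := fun v =>
        (TensorAlgebra.algebraMapInv.toLinearMap ∘ₗ LinearMap.fst k _ _).smulRight v
      map_add' := fun v w => by ext <;> simp
      map_smul' := fun c v => by ext <;> simp [smul_comm c] }

theorem tprOne_one : tprOne (1 : TensorAlgebra k V) = 0 := tensorRec_one _ _

theorem tprOne_ι_mul (v : V) (u : TensorAlgebra k V) :
    tprOne (TensorAlgebra.ι k v * u) = TensorAlgebra.algebraMapInv u • v := by
  rw [tprOne, tensorRec_ι_mul]; rfl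

/-- The projection of the tensor algebra onto words of length two, with values in
`Sym² V ⊆ Sym V`. -/
def tprTwo : TensorAlgebra k V →ₗ[k] SymmetricAlgebra k V :=
  tensorRec 0
    { toFun := fun v => LinearMap.mulLeft k (SymmetricAlgebra.ι k V v) ∘ₗ
        SymmetricAlgebra.ι k V ∘ₗ tprOne ∘ₗ LinearMap.fst k _ _
      map_add' := fun v w => by ext <;> simp [add_mul]
      map_smul' := fun c v => by ext <;> simp }

theorem tprTwo_one : tprTwo (1 : TensorAlgebra k V) = 0 := tensorRec_one _ _

theorem tprTwo_ι_mul (v : V) (u : TensorAlgebra k V) :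
    tprTwo (TensorAlgebra.ι k v * u) =
      SymmetricAlgebra.ι k V v * SymmetricAlgebra.ι k V (tprOne u) := by
  rw [tprTwo, tensorRec_ι_mul]; rfl

theorem aug_shuffle (l : List V) (b : V) (m : List V) :
    TensorAlgebra.algebraMapInv (shuffle k l (b :: m)) = 0 := by
  have h : ∀ (a : V) (u : TensorAlgebra k V),
      TensorAlgebra.algebraMapInv (TensorAlgebra.ι k a * u) = 0 := by
    intro a u; simp [TensorAlgebra.algebraMapInv]
  cases l with
  | nil => rw [shuffle_nil_left, word_cons, h]
  | cons a l => rw [shuffle_cons_cons, map_add, map_smul, h, h, smul_zero, add_zero]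

theorem aug_shuffle' (l : List V) (b : V) (m : List V) :
    TensorAlgebra.algebraMapInv (shuffle k (b :: m) l) = 0 := by
  cases l with
  | nil =>
    rw [shuffle_nil_right, word_cons]; simp [TensorAlgebra.algebraMapInv]
  | cons a l => exact aug_shuffle _ _ _

theorem tprOne_shuffle (a b : V) (l m : List V) :
    tprOne (shuffle k (a :: l) (b :: m)) = 0 := by
  rw [shuffle_cons_cons, map_add, map_smul, tprOne_ι_mul, tprOne_ι_mul, aug_shuffle,
    aug_shuffle']
  simp

theorem tprTwo_shuffle (a b : V) (l m : List V) :
    tprTwo (shuffle k (a :: l) (b :: m)) = 0 := by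
  have h : ∀ (c d : V) (n : List V), tprOne (word k (c :: d :: n)) = 0 := by
    intro c d n
    rw [word_cons, tprOne_ι_mul, word_cons]; simp [TensorAlgebra.algebraMapInv]
  rw [shuffle_cons_cons, map_add, map_smul, tprTwo_ι_mul, tprTwo_ι_mul]
  have e : ∀ c : V, tprOne (word k [c]) = c := by
    intro c; rw [word_cons, tprOne_ι_mul, word_nil]; simp
  cases l with
  | nil =>
    cases m with
    | nil =>
      simp only [shuffle_nil_left, shuffle_nil_right, e, List.length_nil, zero_add, pow_one,
        neg_smul, one_smul]
      rw [mul_comm]; simp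
    | cons c m =>
      rw [shuffle_nil_left, h, tprOne_shuffle]; simp
  | cons c l =>
    rw [tprOne_shuffle]
    cases m with
    | nil => rw [shuffle_nil_right, h]; simp
    | cons d m => rw [tprOne_shuffle]; simp

/-- The cogenerator projection of the cofree Lie coalgebra onto `sV`. -/
def lprOne : CofreeLie k V →ₗ[k] V :=
  (shuffleSub k V).liftQ tprOne (shuffleSub_le_ker _ tprOne_one tprOne_shuffle)

/-- The projection of the cofree Lie coalgebra onto its weight-two part, which is `s²Sym² V`: the
class of the word `v w` corresponds to `v * w`, i.e. to the element of `sV ⊗ sV` with cobracket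
`sv ⊗ sw + sw ⊗ sv`. -/
def lprTwo : CofreeLie k V →ₗ[k] SymmetricAlgebra k V :=
  (shuffleSub k V).liftQ tprTwo (shuffleSub_le_ker _ tprTwo_one tprTwo_shuffle)

theorem lprOne_mkQ (t : TensorAlgebra k V) : lprOne ((shuffleSub k V).mkQ t) = tprOne t := by
  rw [lprOne, Submodule.mkQ_apply, Submodule.liftQ_apply]

theorem lprTwo_mkQ (t : TensorAlgebra k V) : lprTwo ((shuffleSub k V).mkQ t) = tprTwo t := by
  rw [lprTwo, Submodule.mkQ_apply, Submodule.liftQ_apply]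

theorem lprOne_lword (l : List V) : lprOne (lword k l) = match l with
    | [a] => a
    | _ => 0 := by
  rw [lword, lprOne_mkQ]
  match l with
  | [] => exact tprOne_one
  | [a] => rw [word_cons, tprOne_ι_mul, word_nil]; simp
  | a :: b :: l => rw [word_cons, tprOne_ι_mul, word_cons]; simp [TensorAlgebra.algebraMapInv]

theorem lprTwo_lword (l : List V) : lprTwo (lword k l) = match l with
    | [a, b] => SymmetricAlgebra.ι k V a * SymmetricAlgebra.ι k V b
    | _ => 0 := by
  rw [lword, lprTwo_mkQ]
  match l with
  | [] => exact tprTwo_one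
  | [a] => rw [word_cons, tprTwo_ι_mul, word_nil, tprOne_one]; simp
  | [a, b] => rw [word_cons, tprTwo_ι_mul, ← lprOne_mkQ]; erw [lprOne_lword]
  | a :: b :: c :: l =>
    rw [word_cons, tprTwo_ι_mul, ← lprOne_mkQ]; erw [lprOne_lword]; simp

theorem lprOne_of_mem {n : ℕ} (hn : n ≠ 1) {x : CofreeLie k V} (hx : x ∈ lieGr k V n) :
    lprOne x = 0 := by
  induction hx using Submodule.span_induction with
  | mem y hy =>
    obtain ⟨l, rfl, rfl⟩ := hy
    rw [lprOne_lword]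
    match l with
    | [] => rfl
    | [a] => simp at hn
    | a :: b :: l => rfl
  | zero => simp
  | add a b _ _ ha hb => rw [map_add, ha, hb, add_zero]
  | smul c a _ ha => rw [map_smul, ha, smul_zero]

theorem lprTwo_of_mem {n : ℕ} (hn : n ≠ 2) {x : CofreeLie k V} (hx : x ∈ lieGr k V n) :
    lprTwo x = 0 := by
  induction hx using Submodule.span_induction with
  | mem y hy =>
    obtain ⟨l, rfl, rfl⟩ := hy
    rw [lprTwo_lword]
    match l with
    | [] => rfl
    | [a] => rfl
    | [a, b] => simp at hn
    | a :: b :: c :: l => rfl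
  | zero => simp
  | add a b _ _ ha hb => rw [map_add, ha, hb, add_zero]
  | smul c a _ ha => rw [map_smul, ha, smul_zero]

end Corestrictions

section Coderivation

variable {k : Type*} [Field k] {V : Type*} [AddCommGroup V] [Module k V]
  (Φ : SymmetricAlgebra k V →ₗ[k] V)

/-- `Φ` on the product of two generators. -/
def pairing : V →ₗ[k] V →ₗ[k] V :=
  (LinearMap.mul k (SymmetricAlgebra k V)).compl₁₂ (SymmetricAlgebra.ι k V)
    (SymmetricAlgebra.ι k V) |>.compr₂ Φ

theorem pairing_apply (a b : V) :
    pairing Φ a b = Φ (SymmetricAlgebra.ι k V a * SymmetricAlgebra.ι k V b) := rfl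

theorem pairing_comm (a b : V) : pairing Φ a b = pairing Φ b a := by
  rw [pairing_apply, pairing_apply, mul_comm]

/-- `contract a (b * u) = Φ(ab) * u`. -/
def contract (a : V) : TensorAlgebra k V →ₗ[k] TensorAlgebra k V :=
  tensorRec 0
    ((LinearMap.mul k (TensorAlgebra k V)).compl₁₂ (TensorAlgebra.ι k ∘ₗ pairing Φ a)
      (LinearMap.fst k _ (TensorAlgebra k V)))

theorem contract_one (a : V) : contract Φ a 1 = 0 := tensorRec_one _ _

theorem contract_ι_mul (a b : V) (u : TensorAlgebra k V) :
    contract Φ a (TensorAlgebra.ι k b * u) = TensorAlgebra.ι k (pairing Φ a b) * u := by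
  rw [contract, tensorRec_ι_mul]; rfl

theorem contract_add (a b : V) : contract Φ (a + b) = contract Φ a + contract Φ b := by
  refine word_ext fun l => ?_
  cases l with
  | nil => simp [word_nil, contract_one]
  | cons c l => simp [word_cons, contract_ι_mul, add_mul]

theorem contract_smul (r : k) (a : V) : contract Φ (r • a) = r • contract Φ a := by
  refine word_ext fun l => ?_
  cases l with
  | nil => simp [word_nil, contract_one]
  | cons c l => simp [word_cons, contract_ι_mul]

/-- The coderivation of the tensor coalgebra on `sV` with corestriction `Φ`:
`v₁ ⋯ vₙ ↦ ∑ᵢ (-1)^(i-1) v₁ ⋯ Φ(vᵢ vᵢ₊₁) ⋯ vₙ`. -/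
def tder : TensorAlgebra k V →ₗ[k] TensorAlgebra k V :=
  tensorRec 0
    { toFun := fun v => contract Φ v ∘ₗ LinearMap.fst k _ _ -
        LinearMap.mulLeft k (TensorAlgebra.ι k v) ∘ₗ LinearMap.snd k _ _
      map_add' := fun v w => by
        ext x
        · simp [contract_add]
        · simp [add_mul]; abel
      map_smul' := fun c v => by
        ext x
        · simp [contract_smul]
        · simp }

theorem tder_one : tder Φ 1 = 0 := tensorRec_one _ _

theorem tder_ι_mul (a : V) (u : TensorAlgebra k V) :
    tder Φ (TensorAlgebra.ι k a * u) = contract Φ a u - TensorAlgebra.ι k a * tder Φ u := by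
  rw [tder, tensorRec_ι_mul]; rfl

/-- The terms of `tder Φ` on a word, with their signs. -/
def contractions : List V → List (k × List V)
  | [] => []
  | [_] => []
  | a :: b :: l => (1, pairing Φ a b :: l) ::
      (contractions (b :: l)).map fun p => (-p.1, a :: p.2)

theorem contractions_length (l : List V) :
    ∀ p ∈ contractions Φ l, p.2.length + 1 = l.length ∧ p.2 ≠ [] := by
  induction l using contractions.induct with
  | case1 => simp [contractions]
  | case2 => simp [contractions]
  | case3 a b l ih =>
    simp only [contractions, List.mem_cons, List.mem_map]
    rintro p (rfl | ⟨q, hq, rfl⟩)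
    · simp
    · have := (ih q hq).1; simpa using this

/-- Sum of `s • f l'` over the contractions `(s, l')` of `l`. -/
def contractSum {M : Type*} [AddCommGroup M] [Module k M] (l : List V) (f : List V → M) : M :=
  ((contractions Φ l).map fun p => p.1 • f p.2).sum

section contractSum

variable {M : Type*} [AddCommGroup M] [Module k M]

theorem contractSum_nil (f : List V → M) : contractSum Φ [] f = 0 := by
  simp [contractSum, contractions]

theorem contractSum_single (a : V) (f : List V → M) : contractSum Φ [a] f = 0 := by
  simp [contractSum, contractions]

theorem contractSum_cons (a b : V) (l : List V) (f : List V → M) :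
    contractSum Φ (a :: b :: l) f = f (pairing Φ a b :: l) -
      contractSum Φ (b :: l) fun l' => f (a :: l') := by
  simp only [contractSum, contractions, List.map_cons, List.sum_cons, one_smul, List.map_map,
    Function.comp_def, neg_smul, sub_eq_add_neg, List.sum_neg]

theorem contractSum_linear {N : Type*} [AddCommGroup N] [Module k N] (φ : M →ₗ[k] N)
    (l : List V) (f : List V → M) :
    φ (contractSum Φ l f) = contractSum Φ l fun l' => φ (f l') := by
  simp [contractSum, map_list_sum, Function.comp_def]

theorem contractSum_add (l : List V) (f g : List V → M) :
    contractSum Φ l (fun l' => f l' + g l') = contractSum Φ l f + contractSum Φ l g := by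
  simp [contractSum, List.sum_map_add]

theorem contractSum_congr (l : List V) {f g : List V → M}
    (h : ∀ l', l'.length + 1 = l.length → l' ≠ [] → f l' = g l') :
    contractSum Φ l f = contractSum Φ l g := by
  simp only [contractSum]
  congr 1
  exact List.map_congr_left fun p hp => by
    rw [h _ (contractions_length Φ l p hp).1 (contractions_length Φ l p hp).2]

end contractSum

theorem tder_word (l : List V) : tder Φ (word k l) = contractSum Φ l (word k) := by
  induction l using contractions.induct with
  | case1 => rw [word_nil, tder_one, contractSum_nil]
  | case2 a => rw [word_cons, tder_ι_mul, word_nil, contract_one, tder_one, contractSum_single]; simp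
  | case3 a b l ih =>
    rw [word_cons, tder_ι_mul, ih, word_cons, contract_ι_mul, contractSum_cons, word_cons]
    congr 1
    exact contractSum_linear Φ (LinearMap.mulLeft k (TensorAlgebra.ι k a)) _ _

/-- The contraction of `a` with the first letter of `l`, shuffled with `m`. -/
def headL (a : V) (l m : List V) : TensorAlgebra k V :=
  match l with
  | [] => 0
  | c :: l' => TensorAlgebra.ι k (pairing Φ a c) * shuffle k l' m

/-- The contraction of `b` with the first letter of `m`, shuffled with `l`. -/
def headR (b : V) (l m : List V) : TensorAlgebra k V :=
  match m with
  | [] => 0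
  | c :: m' => TensorAlgebra.ι k (pairing Φ b c) * shuffle k l m'

theorem contract_shuffle (a b : V) (l m : List V) :
    contract Φ a (shuffle k l (b :: m)) =
      headL Φ a l (b :: m) +
      (-1 : k) ^ l.length • (TensorAlgebra.ι k (pairing Φ a b) * shuffle k l m) := by
  cases l with
  | nil => rw [shuffle_nil_left, word_cons, contract_ι_mul, shuffle_nil_left]; simp [headL]
  | cons c l => rw [shuffle_cons_cons, map_add, map_smul, contract_ι_mul, contract_ι_mul]; simp [headL]

theorem contract_shuffle' (a b : V) (l m : List V) :
    contract Φ b (shuffle k (a :: l) m) =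
      TensorAlgebra.ι k (pairing Φ b a) * shuffle k l m +
      (-1 : k) ^ (l.length + 1) • headR Φ b (a :: l) m := by
  cases m with
  | nil => rw [shuffle_nil_right, word_cons, contract_ι_mul, shuffle_nil_right]; simp [headR]
  | cons c m => rw [shuffle_cons_cons, map_add, map_smul, contract_ι_mul, contract_ι_mul, headR]

theorem contractSum_shuffle_left (a b : V) (l m : List V) : contractSum Φ (a :: l) (fun l' => shuffle k l' (b :: m)) =
    headL Φ a l (b :: m) -
    TensorAlgebra.ι k a * contractSum Φ l (fun l' => shuffle k l' (b :: m)) +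
    (-1 : k) ^ l.length • (TensorAlgebra.ι k b *
      contractSum Φ (a :: l) fun l' => shuffle k l' m) := by
  cases l with
  | nil => simp [contractSum_nil, contractSum_single, headL]
  | cons c l =>
    have e : contractSum Φ (c :: l) (fun l' => shuffle k (a :: l') (b :: m)) =
        TensorAlgebra.ι k a * contractSum Φ (c :: l) (fun l' => shuffle k l' (b :: m)) +
        (-1 : k) ^ (l.length + 1) • (TensorAlgebra.ι k b *
          contractSum Φ (c :: l) (fun l' => shuffle k (a :: l') m)) := by
      have e1 := contractSum_linear Φ (LinearMap.mulLeft k (TensorAlgebra.ι k a)) (c :: l)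
        (fun l' => shuffle k l' (b :: m))
      have e2 := contractSum_linear Φ
        ((-1 : k) ^ (l.length + 1) • LinearMap.mulLeft k (TensorAlgebra.ι k b)) (c :: l)
        (fun l' => shuffle k (a :: l') m)
      simp only [LinearMap.smul_apply, LinearMap.mulLeft_apply] at e1 e2
      rw [e1, e2, ← contractSum_add]
      refine contractSum_congr Φ _ fun l' h _ => ?_
      rw [shuffle_cons_cons, h]; rfl
    rw [contractSum_cons, contractSum_cons, e, shuffle_cons_cons, mul_sub, smul_sub,
      List.length_cons]
    rw [headL]
    abel

theorem contractSum_shuffle_right (a b : V) (l m : List V) : contractSum Φ (b :: m) (fun m' => shuffle k (a :: l) m') =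
    TensorAlgebra.ι k a * contractSum Φ (b :: m) (fun m' => shuffle k l m') +
    (-1 : k) ^ (l.length + 1) • (headR Φ b (a :: l) m -
      TensorAlgebra.ι k b * contractSum Φ m (fun m' => shuffle k (a :: l) m')) := by
  cases m with
  | nil => simp [contractSum_nil, contractSum_single, headR]
  | cons c m =>
    have e : contractSum Φ (c :: m) (fun m' => shuffle k (a :: l) (b :: m')) =
        TensorAlgebra.ι k a * contractSum Φ (c :: m) (fun m' => shuffle k l (b :: m')) +
        (-1 : k) ^ (l.length + 1) • (TensorAlgebra.ι k b *
          contractSum Φ (c :: m) (fun m' => shuffle k (a :: l) m')) := by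
      have e1 := contractSum_linear Φ (LinearMap.mulLeft k (TensorAlgebra.ι k a)) (c :: m)
        (fun m' => shuffle k l (b :: m'))
      have e2 := contractSum_linear Φ
        ((-1 : k) ^ (l.length + 1) • LinearMap.mulLeft k (TensorAlgebra.ι k b)) (c :: m)
        (fun m' => shuffle k (a :: l) m')
      simp only [LinearMap.smul_apply, LinearMap.mulLeft_apply] at e1 e2
      rw [e1, e2, ← contractSum_add]
      refine contractSum_congr Φ _ fun m' _ _ => ?_
      rw [shuffle_cons_cons]
    rw [contractSum_cons, contractSum_cons, e, shuffle_cons_cons, mul_sub, smul_sub]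
    rw [headR]
    abel

theorem tder_shuffle (l m : List V) : tder Φ (shuffle k l m) =
    contractSum Φ l (fun l' => shuffle k l' m) +
      (-1 : k) ^ l.length • contractSum Φ m (fun m' => shuffle k l m') := by
  induction l, m using shuffle.induct with
  | case1 m =>
    rw [shuffle_nil_left, tder_word, contractSum_nil]
    simp only [shuffle_nil_left]
    simp
  | case2 a l =>
    rw [shuffle_nil_right, tder_word, contractSum_nil]
    simp only [shuffle_nil_right]
    simp
  | case3 a l b m ih1 ih2 =>
    rw [contractSum_shuffle_left, contractSum_shuffle_right, shuffle_cons_cons, map_add, map_smul, tder_ι_mul, tder_ι_mul, ih1, ih2,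
      contract_shuffle, contract_shuffle', pairing_comm Φ b a, List.length_cons, pow_succ]
    rcases neg_one_pow_eq_or k l.length with h | h <;> cases m <;>
      simp only [h, mul_add, mul_smul_comm] <;> module

/-- The induced coderivation of the cofree Lie coalgebra. -/
def lieDer : CofreeLie k V →ₗ[k] CofreeLie k V :=
  (shuffleSub k V).liftQ ((shuffleSub k V).mkQ ∘ₗ tder Φ) <|
    shuffleSub_le_ker _ (by rw [LinearMap.comp_apply, tder_one, map_zero])
      (fun a b l m => by
        rw [LinearMap.comp_apply, tder_shuffle, map_add, map_smul, contractSum_linear,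
          contractSum_linear]
        have h1 : contractSum Φ (a :: l) (fun l' => (shuffleSub k V).mkQ (shuffle k l' (b :: m)))
            = contractSum Φ (a :: l) (fun _ => 0) :=
          contractSum_congr Φ _ fun l' _ h => by
            obtain ⟨c, n, rfl⟩ := List.exists_cons_of_ne_nil h
            exact mkQ_shuffle c b n m
        have h2 : contractSum Φ (b :: m) (fun m' => (shuffleSub k V).mkQ (shuffle k (a :: l) m'))
            = contractSum Φ (b :: m) (fun _ => 0) :=
          contractSum_congr Φ _ fun m' _ h => by
            obtain ⟨c, n, rfl⟩ := List.exists_cons_of_ne_nil h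
            exact mkQ_shuffle a c l n
        rw [h1, h2]
        simp [contractSum])

theorem lieDer_mkQ (t : TensorAlgebra k V) :
    lieDer Φ ((shuffleSub k V).mkQ t) = (shuffleSub k V).mkQ (tder Φ t) := by
  rw [lieDer, Submodule.mkQ_apply, Submodule.liftQ_apply]; rfl

theorem lieDer_lword (l : List V) : lieDer Φ (lword k l) = contractSum Φ l (lword k) := by
  rw [lword, lieDer_mkQ, tder_word, contractSum_linear]; rfl

theorem lieDer_mem (n : ℕ) (x : CofreeLie k V) (hx : x ∈ lieGr k V (n + 1)) :
    lieDer Φ x ∈ lieGr k V n := by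
  induction hx using Submodule.span_induction with
  | mem y hy =>
    obtain ⟨l, hl, rfl⟩ := hy
    rw [lieDer_lword, contractSum]
    refine list_sum_mem ?_
    intro z hz
    obtain ⟨p, hp, rfl⟩ := List.mem_map.mp hz
    have h := (contractions_length Φ l p hp).1
    have h' : p.2.length = n := by omega
    exact Submodule.smul_mem _ _ (h' ▸ lword_mem p.2)
  | zero => simp
  | add a b _ _ ha hb => rw [map_add]; exact Submodule.add_mem _ ha hb
  | smul c a _ ha => rw [map_smul]; exact Submodule.smul_mem _ _ ha

/-- The sign involution of the tensor algebra. -/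
def tsign : TensorAlgebra k V →ₐ[k] TensorAlgebra k V :=
  TensorAlgebra.lift k (-TensorAlgebra.ι k)

theorem tsign_ι_mul (a : V) (u : TensorAlgebra k V) :
    tsign (TensorAlgebra.ι k a * u) = -(TensorAlgebra.ι k a * tsign u) := by
  rw [map_mul, tsign, TensorAlgebra.lift_ι_apply]; simp

theorem tsign_word (l : List V) : tsign (word k l) = (-1 : k) ^ l.length • word k l := by
  induction l with
  | nil => simp [word_nil]
  | cons a l ih => rw [word_cons, tsign_ι_mul, ih, List.length_cons, pow_succ]; simp

theorem deconc_contract (a : V) (u : TensorAlgebra k V) :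
    deconc (contract Φ a u) = 1 ⊗ₜ contract Φ a u + (contract Φ a).rTensor _ (deconc u) := by
  suffices h : deconc ∘ₗ contract Φ a = TensorProduct.mk k _ _ 1 ∘ₗ contract Φ a +
      (contract Φ a).rTensor _ ∘ₗ deconc from LinearMap.congr_fun h u
  refine word_ext fun l => ?_
  cases l with
  | nil => simp [word_nil, contract_one, deconc_one]
  | cons b l =>
    have e : contract Φ a ∘ₗ LinearMap.mulLeft k (TensorAlgebra.ι k b) =
        LinearMap.mulLeft k (TensorAlgebra.ι k (pairing Φ a b)) :=
      LinearMap.ext fun u => contract_ι_mul Φ a b u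
    simp only [LinearMap.comp_apply, LinearMap.add_apply, word_cons, contract_ι_mul, deconc_ι_mul,
      map_add, LinearMap.rTensor_tmul, contract_one, TensorProduct.zero_tmul, zero_add,
      TensorProduct.mk_apply]
    congr 1
    generalize deconc (word k l) = X
    rw [← LinearMap.comp_apply (LinearMap.rTensor _ (contract Φ a)), ← LinearMap.rTensor_comp, e]

theorem deconc_tder (t : TensorAlgebra k V) : deconc (tder Φ t) =
    TensorProduct.map (tder Φ) LinearMap.id (deconc t) +
      TensorProduct.map tsign.toLinearMap (tder Φ) (deconc t) := by
  suffices h : deconc ∘ₗ tder Φ = TensorProduct.map (tder Φ) LinearMap.id ∘ₗ deconc +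
      TensorProduct.map tsign.toLinearMap (tder Φ) ∘ₗ deconc from LinearMap.congr_fun h t
  refine word_ext fun l => ?_
  induction l with
  | nil => simp [word_nil, tder_one, deconc_one]
  | cons a l ih =>
    simp only [LinearMap.comp_apply, LinearMap.add_apply] at ih ⊢
    rw [word_cons, tder_ι_mul, map_sub, deconc_contract, deconc_ι_mul, deconc_ι_mul, ih]
    generalize deconc (word k l) = X
    clear ih
    have e1 : (TensorProduct.map (tder Φ) LinearMap.id)
        ((LinearMap.mulLeft k (TensorAlgebra.ι k a)).rTensor _ X) =
        (contract Φ a).rTensor _ X - (LinearMap.mulLeft k (TensorAlgebra.ι k a)).rTensor _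
          (TensorProduct.map (tder Φ) LinearMap.id X) := by
      induction X using TensorProduct.induction_on with
      | zero => simp
      | add x y hx hy => simp only [map_add, hx, hy]; abel
      | tmul x y =>
        simp [tder_ι_mul, TensorProduct.sub_tmul]
    have e2 : (TensorProduct.map tsign.toLinearMap (tder Φ))
        ((LinearMap.mulLeft k (TensorAlgebra.ι k a)).rTensor _ X) =
        -(LinearMap.mulLeft k (TensorAlgebra.ι k a)).rTensor _
          (TensorProduct.map tsign.toLinearMap (tder Φ) X) := by
      clear e1
      induction X using TensorProduct.induction_on with
      | zero => simp
      | add x y hx hy => simp only [map_add, hx, hy]; abel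
      | tmul x y =>
        rw [LinearMap.rTensor_tmul, TensorProduct.map_tmul, LinearMap.mulLeft_apply,
          AlgHom.toLinearMap_apply, tsign_ι_mul, TensorProduct.neg_tmul]
        rfl
    simp only [map_add, e1, e2, TensorProduct.map_tmul, tder_one,
      TensorProduct.zero_tmul, tder_ι_mul, LinearMap.id_apply, AlgHom.toLinearMap_apply, map_one,
      TensorProduct.tmul_sub]
    abel

end Coderivation

section Graded

variable {k : Type*} [Field k] {G : Type*} [AddCommGroup G] [Module k G]

theorem graded_ext {M : Type*} [AddCommGroup M] [Module k M] {gr : ℕ → Submodule k G}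
    (hgr : ⨆ n, gr n = ⊤) {f g : G →ₗ[k] M} (h : ∀ n, ∀ x ∈ gr n, f x = g x) : f = g := by
  have : (⨆ n, gr n) ≤ LinearMap.ker (f - g) :=
    iSup_le fun n x hx => by rw [LinearMap.mem_ker, LinearMap.sub_apply, h n x hx, sub_self]
  rw [hgr] at this
  ext x
  have hx := this (Submodule.mem_top (x := x))
  rwa [LinearMap.mem_ker, LinearMap.sub_apply, sub_eq_zero] at hx

theorem graded_ext₂ {M : Type*} [AddCommGroup M] [Module k M] {gr : ℕ → Submodule k G}
    (hgr : ⨆ n, gr n = ⊤) {f g : G ⊗[k] G →ₗ[k] M}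
    (h : ∀ m n, ∀ x ∈ gr m, ∀ y ∈ gr n, f (x ⊗ₜ y) = g (x ⊗ₜ y)) : f = g := by
  apply TensorProduct.ext
  refine graded_ext hgr fun m x hx => ?_
  refine graded_ext hgr fun n y hy => ?_
  exact h m n x hx y hy

/-- The extension of a map of degree `-1` to the tensor square commutes with the symmetry. -/
theorem koszulSwap_der (gr : ℕ → Submodule k G) (hgr : DirectSum.IsInternal gr) (D : G →ₗ[k] G)
    (h0 : ∀ x ∈ gr 0, D x = 0) (h1 : ∀ n, ∀ x ∈ gr (n + 1), D x ∈ gr n) :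
    koszulSwap gr hgr ∘ₗ
        (TensorProduct.map D LinearMap.id + TensorProduct.map (parity gr hgr) D) =
      (TensorProduct.map D LinearMap.id + TensorProduct.map (parity gr hgr) D) ∘ₗ
        koszulSwap gr hgr := by
  refine graded_ext₂ hgr.submodule_iSup_eq_top fun m n x hx y hy => ?_
  have a1 : koszulSwap gr hgr (D x ⊗ₜ y) = ((-1 : k) ^ (m * n) * (-1) ^ n) • (y ⊗ₜ[k] D x) := by
    cases m with
    | zero => simp [h0 x hx]
    | succ m =>
      rw [koszulSwap_tmul gr hgr (h1 m x hx) hy, add_mul, pow_add, one_mul, mul_assoc,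
        ← mul_pow]
      simp
  have a2 : koszulSwap gr hgr (x ⊗ₜ D y) = ((-1 : k) ^ (m * n) * (-1) ^ m) • (D y ⊗ₜ[k] x) := by
    cases n with
    | zero => simp [h0 y hy]
    | succ n =>
      rw [koszulSwap_tmul gr hgr hx (h1 n y hy), mul_add, pow_add, mul_one, mul_assoc,
        ← mul_pow]
      simp
  simp only [LinearMap.comp_apply, LinearMap.add_apply, TensorProduct.map_tmul,
    koszulSwap_tmul gr hgr hx hy, map_smul, map_add, LinearMap.id_apply, parity,
    gradeScale_of_mem gr hgr _ hx, gradeScale_of_mem gr hgr _ hy, a1, ← TensorProduct.smul_tmul',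
    a2, smul_smul]
  rw [← mul_assoc, mul_comm ((-1 : k) ^ m), mul_assoc, ← mul_pow]
  simp only [mul_neg, mul_one, neg_neg, one_pow, smul_add, smul_smul]
  rw [add_comm]

variable {H : Type*} [AddCommGroup H] [Module k H]

theorem gradeScale_natural {gr : ℕ → Submodule k G} (hgr : DirectSum.IsInternal gr)
    {gr' : ℕ → Submodule k H} (hgr' : DirectSum.IsInternal gr') (f : G →ₗ[k] H)
    (hf : ∀ n, ∀ x ∈ gr n, f x ∈ gr' n) (c : ℕ → k) :
    gradeScale gr' hgr' c ∘ₗ f = f ∘ₗ gradeScale gr hgr c := by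
  refine graded_ext hgr.submodule_iSup_eq_top fun n x hx => ?_
  rw [LinearMap.comp_apply, LinearMap.comp_apply, gradeScale_of_mem gr hgr c hx,
    gradeScale_of_mem gr' hgr' c (hf n x hx), map_smul]

theorem koszulSwap_natural {gr : ℕ → Submodule k G} (hgr : DirectSum.IsInternal gr)
    {gr' : ℕ → Submodule k H} (hgr' : DirectSum.IsInternal gr') (f : G →ₗ[k] H)
    (hf : ∀ n, ∀ x ∈ gr n, f x ∈ gr' n) :
    koszulSwap gr' hgr' ∘ₗ TensorProduct.map f f = TensorProduct.map f f ∘ₗ koszulSwap gr hgr := by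
  refine graded_ext₂ hgr.submodule_iSup_eq_top fun m n x hx y hy => ?_
  rw [LinearMap.comp_apply, LinearMap.comp_apply, TensorProduct.map_tmul,
    koszulSwap_tmul gr' hgr' (hf m x hx) (hf n y hy), koszulSwap_tmul gr hgr hx hy, map_smul,
    TensorProduct.map_tmul]

theorem koszulCycle_natural {gr : ℕ → Submodule k G} (hgr : DirectSum.IsInternal gr)
    {gr' : ℕ → Submodule k H} (hgr' : DirectSum.IsInternal gr') (f : G →ₗ[k] H)
    (hf : ∀ n, ∀ x ∈ gr n, f x ∈ gr' n) :
    koszulCycle gr' hgr' ∘ₗ TensorProduct.map (TensorProduct.map f f) f =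
      TensorProduct.map (TensorProduct.map f f) f ∘ₗ koszulCycle gr hgr := by
  apply TensorProduct.ext
  refine graded_ext₂ (k := k) (G := G) (M := G →ₗ[k] (H ⊗[k] H) ⊗[k] H)
    hgr.submodule_iSup_eq_top fun l m x hx y hy => ?_
  refine graded_ext hgr.submodule_iSup_eq_top fun n z hz => ?_
  change koszulCycle gr' hgr' (TensorProduct.map (TensorProduct.map f f) f ((x ⊗ₜ y) ⊗ₜ z)) =
    TensorProduct.map (TensorProduct.map f f) f (koszulCycle gr hgr ((x ⊗ₜ y) ⊗ₜ z))
  simp only [TensorProduct.map_tmul, koszulCycle_tmul gr' hgr' (hf l x hx) (hf m y hy) (hf n z hz),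
    koszulCycle_tmul gr hgr hx hy hz, map_smul]

/-- The projection of a graded vector space to its part of degree `n`. -/
def gradeProj (gr : ℕ → Submodule k G) (hgr : DirectSum.IsInternal gr) (n : ℕ) : G →ₗ[k] G :=
  gradeScale gr hgr (Pi.single n 1)

theorem gradeProj_of_mem (gr : ℕ → Submodule k G) (hgr : DirectSum.IsInternal gr) {m : ℕ} (n : ℕ)
    {x : G} (hx : x ∈ gr m) : gradeProj gr hgr n x = if m = n then x else 0 := by
  rw [gradeProj, gradeScale_of_mem gr hgr _ hx, Pi.single_apply]
  split_ifs <;> simp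

theorem gradeProj_mem (gr : ℕ → Submodule k G) (hgr : DirectSum.IsInternal gr) (n : ℕ) (x : G) :
    gradeProj gr hgr n x ∈ gr n := by
  have hx : x ∈ ⨆ n, gr n := by rw [hgr.submodule_iSup_eq_top]; trivial
  induction hx using Submodule.iSup_induction' with
  | mem m x hx =>
    rw [gradeProj_of_mem gr hgr n hx]
    split_ifs with h
    · exact h ▸ hx
    · exact zero_mem _
  | zero => simp
  | add x y _ _ hx hy => rw [map_add]; exact add_mem hx hy

/-- The projection of the tensor square to its part of degree `n`. -/
def gradeProj₂ (gr : ℕ → Submodule k G) (hgr : DirectSum.IsInternal gr) (n : ℕ) :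
    G ⊗[k] G →ₗ[k] G ⊗[k] G :=
  ∑ p ∈ Finset.HasAntidiagonal.antidiagonal n, TensorProduct.map (gradeProj gr hgr p.1) (gradeProj gr hgr p.2)

theorem gradeProj₂_mem (gr : ℕ → Submodule k G) (hgr : DirectSum.IsInternal gr) (n : ℕ)
    (z : G ⊗[k] G) : gradeProj₂ gr hgr n z ∈
      ⨆ (i : ℕ) (j : ℕ) (_ : i + j = n), tensorSub (gr i) (gr j) := by
  induction z using TensorProduct.induction_on with
  | zero => simp
  | add x y hx hy => rw [map_add]; exact add_mem hx hy
  | tmul x y =>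
    rw [gradeProj₂, LinearMap.sum_apply]
    refine sum_mem fun p hp => ?_
    refine Submodule.mem_iSup_of_mem p.1 (Submodule.mem_iSup_of_mem p.2
      (Submodule.mem_iSup_of_mem (Finset.HasAntidiagonal.mem_antidiagonal.mp hp) ?_))
    exact ⟨⟨_, gradeProj_mem gr hgr p.1 x⟩ ⊗ₜ ⟨_, gradeProj_mem gr hgr p.2 y⟩, rfl⟩

theorem gradeProj₂_of_mem (gr : ℕ → Submodule k G) (hgr : DirectSum.IsInternal gr) (n : ℕ)
    (z : G ⊗[k] G) (hz : z ∈ ⨆ (i : ℕ) (j : ℕ) (_ : i + j = n), tensorSub (gr i) (gr j)) :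
    gradeProj₂ gr hgr n z = z := by
  suffices h : (⨆ (i : ℕ) (j : ℕ) (_ : i + j = n), tensorSub (gr i) (gr j)) ≤
      LinearMap.ker (gradeProj₂ gr hgr n - LinearMap.id) by
    have := h hz
    rwa [LinearMap.mem_ker, LinearMap.sub_apply, sub_eq_zero] at this
  refine iSup_le fun i => iSup_le fun j => iSup_le fun hij => ?_
  rw [tensorSub, LinearMap.range_le_ker_iff]
  refine TensorProduct.ext' fun a b => ?_
  have e : ∀ p ∈ Finset.HasAntidiagonal.antidiagonal n, p ≠ (i, j) →
      TensorProduct.map (gradeProj gr hgr p.1) (gradeProj gr hgr p.2) ((a : G) ⊗ₜ[k] (b : G))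
        = 0 := by
    intro p hp hne
    rw [TensorProduct.map_tmul, gradeProj_of_mem gr hgr p.1 a.2, gradeProj_of_mem gr hgr p.2 b.2]
    have := Finset.HasAntidiagonal.mem_antidiagonal.mp hp
    by_cases h : i = p.1
    · exact absurd (Prod.ext h.symm (by simp; omega)) hne
    · simp [h]
  rw [LinearMap.comp_apply, LinearMap.sub_apply, LinearMap.zero_apply, TensorProduct.map_tmul,
    gradeProj₂, LinearMap.sum_apply]
  simp only [Submodule.subtype_apply]
  rw [Finset.sum_eq_single (i, j) e (fun h => absurd (Finset.HasAntidiagonal.mem_antidiagonal.mpr hij) h),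
    TensorProduct.map_tmul, gradeProj_of_mem gr hgr i a.2, gradeProj_of_mem gr hgr j b.2]
  simp

theorem gradeProj₂_natural {gr : ℕ → Submodule k G} (hgr : DirectSum.IsInternal gr)
    {gr' : ℕ → Submodule k H} (hgr' : DirectSum.IsInternal gr') (f : G →ₗ[k] H)
    (hf : ∀ n, ∀ x ∈ gr n, f x ∈ gr' n) (n : ℕ) :
    gradeProj₂ gr' hgr' n ∘ₗ TensorProduct.map f f =
      TensorProduct.map f f ∘ₗ gradeProj₂ gr hgr n := by
  have h : ∀ i, gradeProj gr' hgr' i ∘ₗ f = f ∘ₗ gradeProj gr hgr i :=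
    fun i => gradeScale_natural hgr hgr' f hf _
  refine LinearMap.ext fun z => ?_
  simp only [LinearMap.comp_apply, gradeProj₂, LinearMap.sum_apply, map_sum]
  refine Finset.sum_congr rfl fun p _ => ?_
  rw [← LinearMap.comp_apply, ← LinearMap.comp_apply, ← TensorProduct.map_comp,
    ← TensorProduct.map_comp, h, h]

namespace GradedLieCoalgebra

variable (C : GradedLieCoalgebra k G)

/-- A graded subspace `S` with `]S[ ⊆ S ⊗ S`. -/
structure IsSubcoalgebra (S : Submodule k G) : Prop where
  graded : S ≤ ⨆ n, S ⊓ C.gr n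
  cobr_mem : ∀ x ∈ S, C.cobr x ∈ tensorSub S S

variable {C} {S : Submodule k G}

theorem tensorSub_injective (S : Submodule k G) :
    Function.Injective (TensorProduct.map S.subtype S.subtype) :=
  TensorProduct.map_injective_of_flat_flat _ _ S.injective_subtype S.injective_subtype

/-- The cobracket of a Lie subcoalgebra. -/
def subCobr (hS : C.IsSubcoalgebra S) : S →ₗ[k] S ⊗[k] S :=
  ((LinearEquiv.ofInjective _ (tensorSub_injective S)).symm :
      LinearMap.range (TensorProduct.map S.subtype S.subtype) →ₗ[k] S ⊗[k] S) ∘ₗ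
    LinearMap.codRestrict _ (C.cobr ∘ₗ S.subtype) fun x => hS.cobr_mem x x.2

theorem map_subCobr (hS : C.IsSubcoalgebra S) (x : S) :
    TensorProduct.map S.subtype S.subtype (subCobr hS x) = C.cobr x := by
  have h := LinearEquiv.apply_symm_apply (LinearEquiv.ofInjective _ (tensorSub_injective S))
    (LinearMap.codRestrict _ (C.cobr ∘ₗ S.subtype) (fun x => hS.cobr_mem x x.2) x)
  exact congrArg Subtype.val h

theorem sub_internal (hS : C.IsSubcoalgebra S) :
    DirectSum.IsInternal fun n => (C.gr n).comap S.subtype := by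
  refine internal_of_proj _ S.subtype S.injective_subtype
    (fun n => gradeProj C.gr C.internal n ∘ₗ S.subtype)
    (fun m n x hx => gradeProj_of_mem C.gr C.internal n hx) ?_
  rw [eq_top_iff]
  rintro ⟨x, hx⟩ -
  have key : (⨆ n, S ⊓ C.gr n) ≤
      (⨆ n, (C.gr n).comap S.subtype).map S.subtype := by
    refine iSup_le fun n y hy => ⟨⟨y, hy.1⟩, ?_, rfl⟩
    exact Submodule.mem_iSup_of_mem n hy.2
  obtain ⟨y, hy, hxy⟩ := key (hS.graded hx)
  have : y = ⟨x, hx⟩ := Subtype.ext hxy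
  exact this ▸ hy

/-- A Lie subcoalgebra as a graded Lie coalgebra. -/
def restrict (hS : C.IsSubcoalgebra S) : GradedLieCoalgebra k S where
  gr n := (C.gr n).comap S.subtype
  internal := sub_internal hS
  cobr := subCobr hS
  cobr_mem n x hx := by
    have h1 := LinearMap.congr_fun (gradeProj₂_natural (sub_internal hS) C.internal S.subtype
      (fun _ _ h => h) n) (subCobr hS x)
    rw [LinearMap.comp_apply, LinearMap.comp_apply, map_subCobr,
      gradeProj₂_of_mem _ _ _ _ (C.cobr_mem n x hx), ← map_subCobr hS] at h1
    rw [tensorSub_injective S h1]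
    exact gradeProj₂_mem _ _ _ _
  antisymm := by
    refine LinearMap.ext fun x => tensorSub_injective S ?_
    have h1 := LinearMap.congr_fun (koszulSwap_natural (sub_internal hS) C.internal S.subtype
      (fun _ _ h => h)) (subCobr hS x)
    have h2 := LinearMap.congr_fun C.antisymm x
    rw [LinearMap.comp_apply, LinearMap.comp_apply, map_subCobr] at h1
    rw [LinearMap.comp_apply, ← h1, LinearMap.neg_apply, map_neg, map_subCobr]
    exact h2
  coJacobi := by
    have hinj : Function.Injective
        (TensorProduct.map (TensorProduct.map S.subtype S.subtype) S.subtype) :=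
      TensorProduct.map_injective_of_flat_flat _ _ (tensorSub_injective S) S.injective_subtype
    have hc := koszulCycle_natural (sub_internal hS) C.internal S.subtype (fun _ _ h => h)
    have hr : C.cobr.rTensor G ∘ₗ TensorProduct.map S.subtype S.subtype =
        TensorProduct.map (TensorProduct.map S.subtype S.subtype) S.subtype ∘ₗ
          (subCobr hS).rTensor S := by
      refine TensorProduct.ext' fun x y => ?_
      simp only [LinearMap.comp_apply, TensorProduct.map_tmul, LinearMap.rTensor_tmul, map_subCobr,
        Submodule.subtype_apply]
    refine LinearMap.ext fun x => hinj ?_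
    have h2 := LinearMap.congr_fun C.coJacobi x
    have hc' := fun z => LinearMap.congr_fun hc z
    have hr' := LinearMap.congr_fun hr (subCobr hS x)
    simp only [LinearMap.comp_apply, LinearMap.add_apply, LinearMap.id_apply, map_subCobr,
      LinearMap.zero_apply] at h2 hc' hr' ⊢
    rw [map_zero, ← h2, hr', hc', hc', map_add, map_add]

end GradedLieCoalgebra

end Graded

section LieDer

variable {k : Type*} [Field k] {V : Type*} [AddCommGroup V] [Module k V]
  (Φ : SymmetricAlgebra k V →ₗ[k] V)

theorem parity_lword (l : List V) : parity (lieGr k V) lieGr_internal (lword k l) =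
    (-1 : k) ^ l.length • lword k l :=
  gradeScale_of_mem _ _ _ (lword_mem l)

theorem lieDer_zero (x : CofreeLie k V) (hx : x ∈ lieGr k V 0) : lieDer Φ x = 0 := by
  rw [lieGr_zero, Submodule.mem_bot] at hx
  rw [hx, map_zero]

theorem lieDeconc_tder (t : TensorAlgebra k V) : lieDeconc (tder Φ t) =
    TensorProduct.map (lieDer Φ) LinearMap.id (lieDeconc t) +
      TensorProduct.map (parity (lieGr k V) lieGr_internal) (lieDer Φ) (lieDeconc t) := by
  have hp : (shuffleSub k V).mkQ ∘ₗ tsign.toLinearMap =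
      parity (lieGr k V) lieGr_internal ∘ₗ (shuffleSub k V).mkQ := by
    refine word_ext fun l => ?_
    rw [LinearMap.comp_apply, LinearMap.comp_apply, AlgHom.toLinearMap_apply, tsign_word, map_smul]
    exact (parity_lword l).symm
  have hd : (shuffleSub k V).mkQ ∘ₗ tder Φ = lieDer Φ ∘ₗ (shuffleSub k V).mkQ :=
    LinearMap.ext fun t => (lieDer_mkQ Φ t).symm
  rw [lieDeconc, LinearMap.comp_apply, LinearMap.comp_apply, deconc_tder, map_add]
  generalize deconc t = X
  simp only [← LinearMap.comp_apply, ← TensorProduct.map_comp, hp, hd, LinearMap.id_comp,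
    LinearMap.comp_id]

theorem lieDer_coderivation : lieCobr ∘ₗ lieDer Φ =
    (TensorProduct.map (lieDer Φ) LinearMap.id +
      TensorProduct.map (parity (lieGr k V) lieGr_internal) (lieDer Φ)) ∘ₗ lieCobr := by
  refine lword_ext fun l => ?_
  have h := fun z => LinearMap.congr_fun (koszulSwap_der (lieGr k V) lieGr_internal (lieDer Φ)
    (lieDer_zero Φ) (lieDer_mem Φ)) z
  simp only [LinearMap.comp_apply] at h ⊢
  rw [lword, lieDer_mkQ, lieCobr_mkQ, lieCobr_mkQ, lieDeconc_tder, ← LinearMap.add_apply, h,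
    map_sub]

end LieDer

section Primitive

variable {k : Type*} [Field k] {V : Type*} [AddCommGroup V] [Module k V]

theorem shuffle_snoc_single (l : List V) (y z : V) : shuffle k (l ++ [y]) ([] ++ [z]) =
    (-1 : k) ^ (([] : List V).length + 1) • (shuffle k l ([] ++ [z]) * TensorAlgebra.ι k y) +
      shuffle k (l ++ [y]) [] * TensorAlgebra.ι k z := by
  induction l with
  | nil =>
    simp only [List.nil_append, shuffle_cons_cons, shuffle_nil_left, shuffle_nil_right]
    simp [word, add_comm]
  | cons a l ih =>
    simp only [List.nil_append, List.cons_append, shuffle_cons_cons, shuffle_nil_right] at ih ⊢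
    rw [ih]
    simp only [word_cons, word_append, word_nil, List.length_cons, List.length_append,
      List.length_nil, pow_succ, mul_add, add_mul, mul_smul_comm, smul_mul_assoc, mul_assoc,
      mul_one]
    module

theorem shuffle_snoc (l m : List V) (y z : V) : shuffle k (l ++ [y]) (m ++ [z]) =
    (-1 : k) ^ (m.length + 1) • (shuffle k l (m ++ [z]) * TensorAlgebra.ι k y) +
      shuffle k (l ++ [y]) m * TensorAlgebra.ι k z := by
  induction l, m using shuffle.induct with
  | case1 m =>
    induction m with
    | nil =>
      simp only [List.nil_append, shuffle_cons_cons, shuffle_nil_left, shuffle_nil_right]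
      simp [word, add_comm]
    | cons b m ih =>
      simp only [List.nil_append, List.cons_append, shuffle_cons_cons, shuffle_nil_left] at ih ⊢
      rw [ih]
      simp only [word_cons, word_append, word_nil, List.length_cons, List.length_nil, pow_succ,
        mul_add, add_mul, mul_smul_comm, smul_mul_assoc, mul_assoc, mul_one]
      module
  | case2 a l => exact shuffle_snoc_single (a :: l) y z
  | case3 a l b m ih1 ih2 =>
    simp only [List.cons_append] at ih1 ih2 ⊢
    rw [shuffle_cons_cons, ih1, ih2, shuffle_cons_cons, shuffle_cons_cons]
    simp only [List.length_cons, List.length_append, List.length_nil, pow_succ, mul_add, add_mul,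
      mul_smul_comm, smul_mul_assoc, mul_assoc, smul_add, smul_smul]
    module

/-- `∑ ± a (rev p ⧢ q)` over the factorisations `l = p a q`, with `p` prepended in reverse order
to `acc`. -/
def dyn : List V → List V → TensorAlgebra k V
  | _, [] => 0
  | acc, a :: q => TensorAlgebra.ι k a * shuffle k acc q +
      (-1 : k) ^ acc.length • dyn (a :: acc) q

theorem dyn_snoc (t acc : List V) (y z : V) : dyn (k := k) (acc ++ [y]) (t ++ [z]) =
    dyn (acc ++ [y]) t * TensorAlgebra.ι k z +
      (-1 : k) ^ t.length • (dyn acc (t ++ [z]) * TensorAlgebra.ι k y) := by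
  induction t generalizing acc with
  | nil => simp [dyn, shuffle_nil_right, word_append, word_cons, word_nil, mul_assoc]
  | cons b t ih =>
    have h := ih (b :: acc)
    simp only [List.cons_append] at h ⊢
    rw [dyn, h, shuffle_snoc, dyn, dyn]
    simp only [List.length_cons, List.length_append, List.length_nil, pow_succ, mul_add, add_mul,
      mul_smul_comm, smul_mul_assoc, mul_assoc, smul_add, smul_smul]
    module

theorem dyn_rec (a z : V) (t : List V) : dyn (k := k) [] (a :: (t ++ [z])) =
    dyn [] (a :: t) * TensorAlgebra.ι k z +
      (-1 : k) ^ t.length • (dyn [] (t ++ [z]) * TensorAlgebra.ι k a) := by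
  have h := dyn_snoc (k := k) t [] a z
  rw [List.nil_append] at h
  rw [dyn, h, dyn, shuffle_nil_left, shuffle_nil_left, word_append, word_cons z, word_nil]
  simp only [List.length_nil, pow_zero, one_smul, mul_one, add_mul, mul_assoc]
  abel

theorem mkQ_dyn (a : V) (q acc : List V) : (shuffleSub k V).mkQ (dyn acc (a :: q)) =
    ((q.length + 1 : ℕ) : k) • (shuffleSub k V).mkQ (TensorAlgebra.ι k a * shuffle k acc q) := by
  induction q generalizing a acc with
  | nil => rw [dyn, dyn]; simp
  | cons b q ih =>
    have h := mkQ_shuffle (k := k) a b acc q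
    rw [shuffle_cons_cons, map_add, map_smul, add_eq_zero_iff_eq_neg] at h
    rw [dyn, map_add, map_smul, ih, h, pow_succ, List.length_cons]
    push_cast
    module

theorem mkQ_dyn_nil (l : List V) : (shuffleSub k V).mkQ (dyn [] l) = (l.length : k) • lword k l := by
  cases l with
  | nil => simp [dyn]
  | cons a l => rw [mkQ_dyn, shuffle_nil_left, ← word_cons]; rfl

/-- The iterated corestriction. -/
def dynMap : ℕ → CofreeLie k V →ₗ[k] TensorAlgebra k V
  | 0 => 0
  | n + 1 => TensorAlgebra.ι k ∘ₗ lprOne + LinearMap.mul' k (TensorAlgebra k V) ∘ₗ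
      TensorProduct.map (dynMap n) (TensorAlgebra.ι k ∘ₗ lprOne) ∘ₗ lieCobr

section

variable {M : Type*} [AddCommMonoid M]

theorem splitSum_first (l : List V) (f : List V → List V → M)
    (hf : ∀ a p q, f (a :: p) q = 0) : splitSum l f = f [] l := by
  cases l with
  | nil => rw [splitSum_nil]
  | cons a l => rw [splitSum_cons]; simp only [hf, splitSum_zero, add_zero]

theorem splitSum_last (l : List V) (f : List V → List V → M)
    (hf : ∀ p a q, f p (a :: q) = 0) : splitSum l f = f l [] := by
  induction l generalizing f with
  | nil => rw [splitSum_nil]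
  | cons a l ih => rw [splitSum_cons, hf, zero_add, ih _ fun p b q => hf _ _ _]

theorem splitSum_snoc (l : List V) (z : V) (f : List V → List V → M) :
    splitSum (l ++ [z]) f = splitSum l (fun p q => f p (q ++ [z])) + f (l ++ [z]) [] := by
  induction l generalizing f with
  | nil => rw [List.nil_append, splitSum_cons, splitSum_nil, splitSum_nil]; rfl
  | cons a l ih => rw [List.cons_append, splitSum_cons, ih, splitSum_cons, add_assoc]; rfl

end

theorem dynMap_lword (n : ℕ) (l : List V) (hl : l.length ≤ n) :
    dynMap (k := k) n (lword k l) = dyn [] l := by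
  induction n generalizing l with
  | zero => rw [List.length_eq_zero_iff.mp (Nat.le_zero.mp hl), lword_nil, map_zero, dyn]
  | succ n ih =>
    have e : dynMap (n + 1) (lword k l) = TensorAlgebra.ι k (lprOne (lword k l)) +
        (splitSum l fun p q => dynMap n (lword k p) * TensorAlgebra.ι k (lprOne (lword k q)) -
          (-1 : k) ^ (p.length * q.length) •
            (dynMap n (lword k q) * TensorAlgebra.ι k (lprOne (lword k p)))) := by
      rw [dynMap, LinearMap.add_apply, LinearMap.comp_apply, LinearMap.comp_apply,
        LinearMap.comp_apply, lieCobr_lword, splitSum_linear, splitSum_linear]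
      simp only [map_sub, map_smul, TensorProduct.map_tmul, LinearMap.comp_apply,
        LinearMap.mul'_apply]
    have l0 : lprOne (lword k ([] : List V)) = 0 := lprOne_lword _
    have l1 : ∀ a : V, lprOne (lword k [a]) = a := fun a => lprOne_lword _
    have l2 : ∀ (a b : V) m, lprOne (lword k (a :: b :: m)) = 0 := fun a b m => lprOne_lword _
    have d0 : dynMap n (lword k ([] : List V)) = 0 := by rw [lword_nil, map_zero]
    match l with
    | [] => rw [lword_nil, map_zero, dyn]
    | [a] =>
      rw [e, splitSum_cons, splitSum_nil, l1, l0, d0]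
      simp [dyn, shuffle_nil_left, word_nil]
    | a :: b :: m =>
      obtain ⟨t, z, htz⟩ : ∃ t z, b :: m = t ++ [z] :=
        ⟨(b :: m).dropLast, (b :: m).getLast (by simp), (List.dropLast_append_getLast _).symm⟩
      rw [e, l2, map_zero, zero_add, htz, dyn_rec]
      have hlen : (t ++ [z]).length ≤ n := by rw [← htz]; simpa using hl
      have hlen' : (a :: t).length ≤ n := by simpa using hlen
      rw [splitSum_cons, ← ih _ hlen, ← ih _ hlen', splitSum_snoc, l0, d0]
      have e1 : (splitSum t fun p q =>
          dynMap n (lword k (a :: p)) * TensorAlgebra.ι k (lprOne (lword k (q ++ [z]))) -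
            (-1 : k) ^ ((a :: p).length * (q ++ [z]).length) •
              (dynMap n (lword k (q ++ [z])) * TensorAlgebra.ι k (lprOne (lword k (a :: p))))) =
          dynMap n (lword k (a :: t)) * TensorAlgebra.ι k z +
            (-1 : k) ^ t.length • (dynMap n (lword k (t ++ [z])) * TensorAlgebra.ι k a) := by
        simp only [sub_eq_add_neg]
        rw [splitSum_add]
        congr 1
        · rw [splitSum_last]
          · simp [l1]
          · intro p c q
            obtain ⟨d, q', h⟩ := List.exists_cons_of_ne_nil (show q ++ [z] ≠ [] by simp)
            rw [List.cons_append, h, l2, map_zero, mul_zero]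
        · rw [splitSum_first]
          · rw [l1, ← neg_smul]; simp [pow_succ]
          · intro c p q; rw [l2]; simp
      rw [e1]
      simp

theorem eq_zero_of_primitive [CharZero k] {n : ℕ} {x : CofreeLie k V} (hx : x ∈ lieGr k V n)
    (h1 : lprOne x = 0) (h2 : lieCobr x = 0) : x = 0 := by
  rcases Nat.eq_zero_or_pos n with rfl | hn
  · rwa [lieGr_zero] at hx
  have h : ∀ x ∈ lieGr k V n, (shuffleSub k V).mkQ (dynMap n x) = (n : k) • x := by
    intro x hx
    induction hx using Submodule.span_induction with
    | mem y hy =>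
      obtain ⟨l, rfl, rfl⟩ := hy
      rw [dynMap_lword _ _ le_rfl, mkQ_dyn_nil]
    | zero => simp
    | add a b _ _ ha hb => rw [map_add, map_add, ha, hb, smul_add]
    | smul c a _ ha => rw [map_smul, map_smul, ha, smul_comm]
  have h0 : dynMap n x = 0 := by
    cases n with
    | zero => rfl
    | succ n => simp [dynMap, h1, h2]
  have h3 := h x hx
  rw [h0, map_zero] at h3
  exact (smul_eq_zero.mp h3.symm).resolve_left (by exact_mod_cast hn.ne')

end Primitive

section SymWeights

variable {k : Type*} [Field k] {V : Type*} [AddCommGroup V] [Module k V]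

variable (k V) in
/-- The weight-`n` part `Symⁿ V` of the symmetric algebra. -/
def symWeight (n : ℕ) : Submodule k (SymmetricAlgebra k V) :=
  LinearMap.range (SymmetricAlgebra.ι k V) ^ n

/-- The map `x ↦ ∑ xₙ tⁿ` that collects the components `xₙ ∈ Symⁿ V` of `x`. -/
def symPoly : SymmetricAlgebra k V →ₐ[k] Polynomial (SymmetricAlgebra k V) :=
  SymmetricAlgebra.lift
    ((LinearMap.mulRight k (Polynomial.X : Polynomial (SymmetricAlgebra k V))) ∘ₗ
      (Polynomial.CAlgHom (R := k) (A := SymmetricAlgebra k V)).toLinearMap ∘ₗ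
        SymmetricAlgebra.ι k V)

theorem symPoly_ι (v : V) : symPoly (SymmetricAlgebra.ι k V v) =
    Polynomial.C (SymmetricAlgebra.ι k V v) * Polynomial.X := by
  rw [symPoly, SymmetricAlgebra.lift_ι_apply]; rfl

variable (k V) in
/-- The projection `q : Sym V → Sym² V` onto the quadratic part. -/
def quadPart : SymmetricAlgebra k V →ₗ[k] SymmetricAlgebra k V where
  toFun x := (symPoly x).coeff 2
  map_add' x y := by simp
  map_smul' c x := by simp

variable (k V) in
/-- The projection `Sym V → V` onto the linear part. -/
def linPart : SymmetricAlgebra k V →ₗ[k] V :=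
  letI : Module kᵐᵒᵖ V := Module.compHom _ ((RingHom.id k).fromOpposite mul_comm)
  haveI : IsCentralScalar k V := ⟨fun _ _ => rfl⟩
  TrivSqZeroExt.sndHom k V ∘ₗ
    (SymmetricAlgebra.lift (TrivSqZeroExt.inrHom k V) :
      SymmetricAlgebra k V →ₐ[k] TrivSqZeroExt k V).toLinearMap

theorem linPart_ι (v : V) : linPart k V (SymmetricAlgebra.ι k V v) = v := by
  simp [linPart]

theorem linPart_one : linPart k V 1 = 0 := by
  let _ : Module kᵐᵒᵖ V := Module.compHom _ ((RingHom.id k).fromOpposite mul_comm)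
  have _ : IsCentralScalar k V := ⟨fun _ _ => rfl⟩
  have h : (SymmetricAlgebra.lift (TrivSqZeroExt.inrHom k V) :
      SymmetricAlgebra k V →ₐ[k] TrivSqZeroExt k V) 1 = 1 := map_one _
  exact (congrArg TrivSqZeroExt.snd h).trans TrivSqZeroExt.snd_one

theorem linPart_ι_mul_ι (v w : V) :
    linPart k V (SymmetricAlgebra.ι k V v * SymmetricAlgebra.ι k V w) = 0 := by
  simp [linPart]

theorem quadPart_one : quadPart k V 1 = 0 := by
  simp [quadPart, Polynomial.coeff_one]

theorem quadPart_ι (v : V) : quadPart k V (SymmetricAlgebra.ι k V v) = 0 := by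
  simp [quadPart, symPoly_ι]

theorem quadPart_ι_mul_ι (v w : V) :
    quadPart k V (SymmetricAlgebra.ι k V v * SymmetricAlgebra.ι k V w) =
      SymmetricAlgebra.ι k V v * SymmetricAlgebra.ι k V w := by
  have : symPoly (SymmetricAlgebra.ι k V v * SymmetricAlgebra.ι k V w) =
      Polynomial.C (SymmetricAlgebra.ι k V v * SymmetricAlgebra.ι k V w) * Polynomial.X ^ 2 := by
    rw [map_mul, symPoly_ι, symPoly_ι, Polynomial.C_mul]; ring
  simp only [quadPart, LinearMap.coe_mk, AddHom.coe_mk]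
  rw [this, Polynomial.coeff_C_mul_X_pow]
  simp

theorem symWeight_one_mem (v : V) : SymmetricAlgebra.ι k V v ∈ symWeight k V 1 := by
  rw [symWeight, pow_one]; exact ⟨v, rfl⟩

theorem symWeight_two_mem (v w : V) :
    SymmetricAlgebra.ι k V v * SymmetricAlgebra.ι k V w ∈ symWeight k V 2 := by
  rw [symWeight, pow_two]; exact Submodule.mul_mem_mul ⟨v, rfl⟩ ⟨w, rfl⟩

theorem symWeight_two_induction {P : SymmetricAlgebra k V → Prop}
    (h : ∀ v w, P (SymmetricAlgebra.ι k V v * SymmetricAlgebra.ι k V w))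
    (add : ∀ x y, P x → P y → P (x + y)) {x : SymmetricAlgebra k V} (hx : x ∈ symWeight k V 2) :
    P x := by
  rw [symWeight, pow_two] at hx
  induction hx using Submodule.mul_induction_on' with
  | mem_mul_mem m hm n hn =>
    obtain ⟨v, rfl⟩ := hm
    obtain ⟨w, rfl⟩ := hn
    exact h v w
  | add x _ y _ hx hy => exact add x y hx hy

theorem quadPart_of_mem {x : SymmetricAlgebra k V} (hx : x ∈ symWeight k V 2) :
    quadPart k V x = x :=
  symWeight_two_induction (P := fun x => quadPart k V x = x) quadPart_ι_mul_ι (fun x y hx hy => by rw [map_add, hx, hy]) hx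

theorem linPart_of_mem {x : SymmetricAlgebra k V} (hx : x ∈ symWeight k V 2) :
    linPart k V x = 0 :=
  symWeight_two_induction (P := fun x => linPart k V x = 0) linPart_ι_mul_ι (fun x y hx hy => by rw [map_add, hx, hy, add_zero]) hx

theorem aug_of_mem {x : SymmetricAlgebra k V} (hx : x ∈ symWeight k V 2) :
    SymmetricAlgebra.algebraMapInv x = 0 :=
  symWeight_two_induction (P := fun x => SymmetricAlgebra.algebraMapInv x = 0)
    (fun v w => by rw [map_mul, SymmetricAlgebra.algebraMapInv_ι, zero_mul])
    (fun x y hx hy => by rw [map_add, hx, hy, add_zero]) hx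

theorem sym_decomp {x : SymmetricAlgebra k V}
    (hx : x ∈ symWeight k V 0 ⊔ symWeight k V 1 ⊔ symWeight k V 2) :
    quadPart k V x ∈ symWeight k V 2 ∧
      x = quadPart k V x + SymmetricAlgebra.ι k V (linPart k V x) +
        algebraMap k _ (SymmetricAlgebra.algebraMapInv x) := by
  obtain ⟨y, hy, c, hc, rfl⟩ := Submodule.mem_sup.mp hx
  obtain ⟨a, ha, b, hb, rfl⟩ := Submodule.mem_sup.mp hy
  rw [symWeight, pow_zero] at ha
  rw [symWeight, pow_one] at hb
  obtain ⟨r, rfl⟩ := Submodule.mem_one.mp ha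
  obtain ⟨v, rfl⟩ := hb
  have h : quadPart k V (algebraMap k _ r + SymmetricAlgebra.ι k V v + c) = c := by
    rw [map_add, map_add, quadPart_of_mem hc, quadPart_ι, Algebra.algebraMap_eq_smul_one, map_smul,
      quadPart_one, smul_zero, zero_add, zero_add]
  rw [h]
  refine ⟨hc, ?_⟩
  have h1 : linPart k V (algebraMap k _ r) = 0 := by
    rw [Algebra.algebraMap_eq_smul_one, map_smul, linPart_one, smul_zero]
  have h2 : SymmetricAlgebra.algebraMapInv (algebraMap k (SymmetricAlgebra k V) r) = r :=
    SymmetricAlgebra.algebraMap_leftInverse V r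
  simp only [map_add, linPart_ι, linPart_of_mem hc, aug_of_mem hc, h1, h2,
    SymmetricAlgebra.algebraMapInv_ι, add_zero, zero_add]
  abel

end SymWeights

section QLC

variable (k : Type*) [Field k] (V : Type*) [AddCommGroup V] [Module k V]

/-- Commutative quadratic-linear-constant data: a subspace `R ⊆ k ⊕ V ⊕ Sym² V` with
`R ∩ (k ⊕ V) = 0` and `(R) ∩ (k ⊕ V ⊕ Sym² V) = R`. -/
structure CommQLC where
  R : Submodule k (SymmetricAlgebra k V)
  R_le : R ≤ symWeight k V 0 ⊔ symWeight k V 1 ⊔ symWeight k V 2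
  R_inf : R ⊓ (symWeight k V 0 ⊔ symWeight k V 1) = ⊥
  span_inf : (Ideal.span (R : Set (SymmetricAlgebra k V))).restrictScalars k ⊓
    (symWeight k V 0 ⊔ symWeight k V 1 ⊔ symWeight k V 2) = R

variable {k V}

namespace CommQLC

variable (Q : CommQLC k V)

/-- The space `qR ⊆ Sym² V` of quadratic parts of relations. -/
def qR : Submodule k (SymmetricAlgebra k V) := Q.R.map (quadPart k V)

theorem quadPart_injective : Function.Injective ((quadPart k V).domRestrict Q.R) := by
  rw [← LinearMap.ker_eq_bot, LinearMap.ker_eq_bot']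
  rintro ⟨x, hx⟩ h
  have h' : quadPart k V x = 0 := h
  have h2 := (sym_decomp (Q.R_le hx)).2
  rw [h', zero_add] at h2
  have : x ∈ Q.R ⊓ (symWeight k V 0 ⊔ symWeight k V 1) := by
    refine ⟨hx, ?_⟩
    rw [h2]
    refine add_mem (Submodule.mem_sup_right (symWeight_one_mem _)) (Submodule.mem_sup_left ?_)
    rw [symWeight, pow_zero]
    exact Submodule.algebraMap_mem _
  rw [Q.R_inf, Submodule.mem_bot] at this
  exact Subtype.ext this

/-- The bijection `q : R → qR`. -/
def quadEquiv : Q.R ≃ₗ[k] Q.qR :=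
  LinearEquiv.ofBijective (((quadPart k V).submoduleMap Q.R : Q.R →ₗ[k] Q.R.map (quadPart k V)))
    ⟨fun _ _ h => Q.quadPart_injective (congrArg Subtype.val h),
      (quadPart k V).submoduleMap_surjective Q.R⟩

/-- The inverse `x ↦ x - φ(x) + θ(x)` of the bijection `q : R → qR`. -/
def sec : Q.qR →ₗ[k] SymmetricAlgebra k V :=
  Q.R.subtype ∘ₗ (Q.quadEquiv.symm : Q.qR →ₗ[k] Q.R)

theorem sec_mem (x : Q.qR) : Q.sec x ∈ Q.R := Subtype.property _

theorem quadPart_sec (x : Q.qR) : quadPart k V (Q.sec x) = x :=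
  congrArg Subtype.val (Q.quadEquiv.apply_symm_apply x)

theorem sec_quadPart {s : SymmetricAlgebra k V} (hs : s ∈ Q.R) (x : Q.qR)
    (hx : (x : SymmetricAlgebra k V) = quadPart k V s) : Q.sec x = s :=
  congrArg Subtype.val (Q.quadPart_injective (a₁ := ⟨_, Q.sec_mem x⟩) (a₂ := ⟨s, hs⟩)
    ((Q.quadPart_sec x).trans hx))

/-- The map `φ : qR → V`. -/
def phi : Q.qR →ₗ[k] V := -(linPart k V ∘ₗ Q.sec)

/-- The map `θ : qR → k`. -/
def theta : Q.qR →ₗ[k] k := SymmetricAlgebra.algebraMapInv.toLinearMap ∘ₗ Q.sec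

theorem sec_eq (x : Q.qR) : Q.sec x =
    x - SymmetricAlgebra.ι k V (Q.phi x) + algebraMap k _ (Q.theta x) := by
  have h := (sym_decomp (Q.R_le (Q.sec_mem x))).2
  rw [quadPart_sec] at h
  rw [h]
  simp [phi, theta]

theorem qR_le : Q.qR ≤ symWeight k V 2 := by
  rintro _ ⟨x, hx, rfl⟩
  exact (sym_decomp (Q.R_le hx)).1

/-- A linear extension of `φ` to `Sym V`; only its values on `qR` matter. -/
def Phi : SymmetricAlgebra k V →ₗ[k] V := (LinearMap.exists_extend Q.phi).choose

/-- A linear extension of `θ` to `Sym V`; only its values on `qR` matter. -/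
def Theta : SymmetricAlgebra k V →ₗ[k] k := (LinearMap.exists_extend Q.theta).choose

theorem Phi_apply (x : Q.qR) : Q.Phi x = Q.phi x :=
  LinearMap.congr_fun (LinearMap.exists_extend Q.phi).choose_spec x

theorem Theta_apply (x : Q.qR) : Q.Theta x = Q.theta x :=
  LinearMap.congr_fun (LinearMap.exists_extend Q.theta).choose_spec x

/-- The Lie subcoalgebras of the cofree Lie coalgebra on `sV` whose part of weight two lies in
`s²qR`. -/
structure IsAdmissible (S : Submodule k (CofreeLie k V)) : Prop extends
    (cofreeLie k V).IsSubcoalgebra S where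
  lprTwo_mem : ∀ x ∈ S, lprTwo x ∈ Q.qR

/-- The Koszul dual coalgebra `(qA)^¡`: the largest Lie subcoalgebra of the cofree Lie coalgebra on
`sV` whose part of weight two lies in `s²qR`. -/
def dual : Submodule k (CofreeLie k V) := sSup {S | Q.IsAdmissible S}

theorem le_dual {S : Submodule k (CofreeLie k V)} (hS : Q.IsAdmissible S) : S ≤ Q.dual :=
  le_sSup hS

theorem tensorSub_mono {S T : Submodule k (CofreeLie k V)} (h : S ≤ T) :
    tensorSub S S ≤ tensorSub T T := by
  have e : TensorProduct.map S.subtype S.subtype = TensorProduct.map T.subtype T.subtype ∘ₗ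
      TensorProduct.map (Submodule.inclusion h) (Submodule.inclusion h) := by
    rw [← TensorProduct.map_comp]; rfl
  rw [tensorSub, e]
  exact LinearMap.range_comp_le_range _ _

theorem dual_admissible : Q.IsAdmissible Q.dual where
  graded := sSup_le fun S hS => hS.graded.trans <|
    iSup_mono fun n => inf_le_inf_right _ (Q.le_dual hS)
  cobr_mem := by
    have h : Q.dual ≤ (tensorSub Q.dual Q.dual).comap (cofreeLie k V).cobr :=
      sSup_le fun S hS x hx => tensorSub_mono (Q.le_dual hS) (hS.cobr_mem x hx)
    exact h
  lprTwo_mem := by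
    have h : Q.dual ≤ Q.qR.comap lprTwo := sSup_le fun S hS x hx => hS.lprTwo_mem x hx
    exact h

end CommQLC

end QLC

section LowWeight

variable {k : Type*} [Field k] {V : Type*} [AddCommGroup V] [Module k V]

theorem lprTwo_mem_symWeight (x : CofreeLie k V) : lprTwo x ∈ symWeight k V 2 := by
  suffices h : ∀ l : List V, lprTwo (lword k l) ∈ symWeight k V 2 by
    have e : (symWeight k V 2).mkQ ∘ₗ lprTwo = 0 := lword_ext fun l => by
      rw [LinearMap.comp_apply, Submodule.mkQ_apply, LinearMap.zero_apply,
        Submodule.Quotient.mk_eq_zero]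
      exact h l
    have := LinearMap.congr_fun e x
    rwa [LinearMap.comp_apply, Submodule.mkQ_apply, LinearMap.zero_apply,
      Submodule.Quotient.mk_eq_zero] at this
  intro l
  by_cases hl : l.length = 2
  · obtain ⟨a, b, rfl⟩ := List.length_eq_two.mp hl
    rw [lprTwo_lword]
    exact symWeight_two_mem a b
  · rw [lprTwo_of_mem hl (lword_mem l)]
    exact zero_mem _

theorem lprOne_lieDer (Φ : SymmetricAlgebra k V →ₗ[k] V) (x : CofreeLie k V) :
    lprOne (lieDer Φ x) = Φ (lprTwo x) := by
  suffices h : lprOne ∘ₗ lieDer Φ = Φ ∘ₗ lprTwo from LinearMap.congr_fun h x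
  refine lword_ext fun l => ?_
  rw [LinearMap.comp_apply, LinearMap.comp_apply]
  by_cases hl : l.length = 2
  · obtain ⟨a, b, rfl⟩ := List.length_eq_two.mp hl
    rw [lprTwo_lword, lieDer_lword, contractSum_cons, contractSum_single, sub_zero, lprOne_lword,
      pairing_apply]
  · rw [lprTwo_of_mem hl (lword_mem l), map_zero]
    cases l with
    | nil => rw [lword_nil, map_zero, map_zero]
    | cons a l =>
      exact lprOne_of_mem (n := l.length) (by simpa using hl) (lieDer_mem Φ _ _ (lword_mem (a :: l)))

/-- The part of the cobracket with values in `s²Sym² V ⊗ sV`. -/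
def cobrTwoOne : CofreeLie k V →ₗ[k] SymmetricAlgebra k V ⊗[k] V :=
  TensorProduct.map lprTwo lprOne ∘ₗ lieCobr

/-- The multiplication `Sym V ⊗ V → Sym V`. -/
def mulV : SymmetricAlgebra k V ⊗[k] V →ₗ[k] SymmetricAlgebra k V :=
  LinearMap.mul' k _ ∘ₗ (SymmetricAlgebra.ι k V).lTensor _

theorem mulV_tmul (x : SymmetricAlgebra k V) (v : V) :
    mulV (x ⊗ₜ[k] v) = x * SymmetricAlgebra.ι k V v := rfl

theorem cobrTwoOne_lword (a b c : V) : cobrTwoOne (lword k [a, b, c]) =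
    (SymmetricAlgebra.ι k V a * SymmetricAlgebra.ι k V b) ⊗ₜ c -
      (SymmetricAlgebra.ι k V b * SymmetricAlgebra.ι k V c) ⊗ₜ a := by
  rw [cobrTwoOne, LinearMap.comp_apply, lieCobr_lword]
  simp only [splitSum_cons, splitSum_nil, map_add, map_sub, map_smul, TensorProduct.map_tmul,
    lprTwo_lword, lprOne_lword]
  simp only [TensorProduct.tmul_zero, List.length_cons, List.length_nil]
  simp [neg_add_eq_sub]

theorem cobrTwoOne_of_length {l : List V} (hl : l.length ≠ 3) :
    cobrTwoOne (lword k l) = 0 := by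
  rw [cobrTwoOne, LinearMap.comp_apply, lieCobr_lword, splitSum_linear, ← splitSum_zero l]
  refine splitSum_congr _ fun p q h => ?_
  have aux : ∀ p q : List V, p.length + q.length = l.length →
      lprTwo (lword k p) ⊗ₜ[k] lprOne (lword k q) = 0 := by
    intro p q h
    by_cases hp : p.length = 2
    · rw [lprOne_of_mem (by omega) (lword_mem q), TensorProduct.tmul_zero]
    · rw [lprTwo_of_mem hp (lword_mem p), TensorProduct.zero_tmul]
  rw [map_sub, map_smul, TensorProduct.map_tmul, TensorProduct.map_tmul, aux p q h,
    aux q p (by omega), smul_zero, sub_zero]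

theorem mulV_cobrTwoOne (x : CofreeLie k V) : mulV (cobrTwoOne x) = 0 := by
  suffices h : mulV ∘ₗ cobrTwoOne = (0 : CofreeLie k V →ₗ[k] _) from LinearMap.congr_fun h x
  refine lword_ext fun l => ?_
  rw [LinearMap.comp_apply, LinearMap.zero_apply]
  by_cases hl : l.length = 3
  · obtain ⟨a, b, c, rfl⟩ := List.length_eq_three.mp hl
    rw [cobrTwoOne_lword, map_sub, mulV_tmul, mulV_tmul]
    ring
  · rw [cobrTwoOne_of_length hl, map_zero]

theorem lprTwo_lieDer (Φ : SymmetricAlgebra k V →ₗ[k] V) (x : CofreeLie k V) :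
    lprTwo (lieDer Φ x) =
      mulV ((SymmetricAlgebra.ι k V ∘ₗ Φ).rTensor V (cobrTwoOne x)) := by
  suffices h : lprTwo ∘ₗ lieDer Φ = mulV ∘ₗ (SymmetricAlgebra.ι k V ∘ₗ Φ).rTensor V ∘ₗ cobrTwoOne
    from LinearMap.congr_fun h x
  refine lword_ext fun l => ?_
  rw [LinearMap.comp_apply, LinearMap.comp_apply, LinearMap.comp_apply]
  by_cases hl : l.length = 3
  · obtain ⟨a, b, c, rfl⟩ := List.length_eq_three.mp hl
    rw [cobrTwoOne_lword, map_sub, map_sub, LinearMap.rTensor_tmul, LinearMap.rTensor_tmul,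
      mulV_tmul, mulV_tmul, lieDer_lword, contractSum_cons, contractSum_cons, contractSum_single,
      sub_zero, map_sub, lprTwo_lword, lprTwo_lword, pairing_apply, pairing_apply]
    simp only [LinearMap.comp_apply]
    ring
  · rw [cobrTwoOne_of_length hl, map_zero, map_zero]
    cases l with
    | nil => rw [lword_nil, map_zero, map_zero]
    | cons a l =>
      exact lprTwo_of_mem (n := l.length) (by simpa using hl) (lieDer_mem Φ _ _ (lword_mem (a :: l)))

/-- The map `(Θ ⊗ id) ∘ ]-[` on the cofree Lie coalgebra, where `Θ` is a functional on weight
two. -/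
def lieCurv (Θ : SymmetricAlgebra k V →ₗ[k] k) : CofreeLie k V →ₗ[k] CofreeLie k V :=
  (TensorProduct.lid k (CofreeLie k V) : k ⊗[k] CofreeLie k V →ₗ[k] CofreeLie k V) ∘ₗ
    (Θ ∘ₗ lprTwo).rTensor (CofreeLie k V) ∘ₗ lieCobr

theorem lprOne_lieCurv (Θ : SymmetricAlgebra k V →ₗ[k] k) (x : CofreeLie k V) :
    lprOne (lieCurv Θ x) = TensorProduct.lid k V (Θ.rTensor V (cobrTwoOne x)) := by
  rw [lieCurv, cobrTwoOne, LinearMap.comp_apply, LinearMap.comp_apply, LinearMap.comp_apply]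
  generalize lieCobr x = X
  induction X using TensorProduct.induction_on with
  | zero => simp
  | add x y hx hy => simp only [map_add, hx, hy]
  | tmul x y => simp

end LowWeight

namespace CommQLC

variable {k : Type*} [Field k] {V : Type*} [AddCommGroup V] [Module k V] (Q : CommQLC k V)

theorem cobrTwoOne_mem {x : CofreeLie k V} (hx : x ∈ Q.dual) :
    ∃ w : Q.qR ⊗[k] V, Q.qR.subtype.rTensor V w = cobrTwoOne x := by
  obtain ⟨w, hw⟩ := Q.dual_admissible.cobr_mem x hx
  refine ⟨TensorProduct.map
    (LinearMap.codRestrict Q.qR (lprTwo ∘ₗ Q.dual.subtype)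
      fun y => Q.dual_admissible.lprTwo_mem y y.2) (lprOne ∘ₗ Q.dual.subtype) w, ?_⟩
  have hw' : TensorProduct.map Q.dual.subtype Q.dual.subtype w = lieCobr x := hw
  rw [cobrTwoOne, LinearMap.comp_apply, ← hw', ← LinearMap.comp_apply, ← LinearMap.comp_apply,
    LinearMap.rTensor_comp_map, ← TensorProduct.map_comp]
  rfl

theorem weight_three {x : CofreeLie k V} (hx : x ∈ Q.dual) :
    SymmetricAlgebra.ι k V (lprOne (lieCurv Q.Theta x)) - lprTwo (lieDer Q.Phi x) ∈ Q.R := by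
  obtain ⟨w, hw⟩ := Q.cobrTwoOne_mem hx
  have h1 : mulV (Q.sec.rTensor V w) = mulV (cobrTwoOne x) - lprTwo (lieDer Q.Phi x) +
      SymmetricAlgebra.ι k V (lprOne (lieCurv Q.Theta x)) := by
    rw [lprTwo_lieDer, lprOne_lieCurv, ← hw]
    generalize w = w
    induction w using TensorProduct.induction_on with
    | zero => simp
    | add x y hx hy => simp only [map_add, hx, hy]; abel
    | tmul r v =>
      simp only [LinearMap.rTensor_tmul, mulV_tmul, sec_eq, Submodule.subtype_apply,
        LinearMap.comp_apply, Phi_apply, Theta_apply, TensorProduct.lid_tmul, map_smul,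
        Algebra.smul_def]
      ring
  have h2 : mulV (Q.sec.rTensor V w) ∈
      (Ideal.span (Q.R : Set (SymmetricAlgebra k V))).restrictScalars k := by
    generalize w = w
    induction w using TensorProduct.induction_on with
    | zero => simp
    | add x y hx hy => rw [map_add, map_add]; exact add_mem hx hy
    | tmul r v =>
      exact Ideal.mul_mem_right _ _ (Ideal.subset_span (Q.sec_mem r))
  rw [mulV_cobrTwoOne, zero_sub, neg_add_eq_sub] at h1
  rw [h1] at h2
  have h3 : SymmetricAlgebra.ι k V (lprOne (lieCurv Q.Theta x)) - lprTwo (lieDer Q.Phi x) ∈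
      symWeight k V 0 ⊔ symWeight k V 1 ⊔ symWeight k V 2 :=
    sub_mem (Submodule.mem_sup_left (Submodule.mem_sup_right (symWeight_one_mem _)))
      (Submodule.mem_sup_right (lprTwo_mem_symWeight _))
  have h4 := Q.span_inf
  rw [← h4]
  exact ⟨h2, h3⟩

theorem lprTwo_lieDer_eq {x : CofreeLie k V} (hx : x ∈ Q.dual) :
    ∃ r : Q.qR, (r : SymmetricAlgebra k V) = lprTwo (lieDer Q.Phi x) ∧
      Q.phi r = lprOne (lieCurv Q.Theta x) ∧ Q.theta r = 0 := by
  have h := neg_mem (Q.weight_three hx)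
  rw [neg_sub] at h
  have hq : quadPart k V (lprTwo (lieDer Q.Phi x) -
      SymmetricAlgebra.ι k V (lprOne (lieCurv Q.Theta x))) = lprTwo (lieDer Q.Phi x) := by
    rw [map_sub, quadPart_ι, sub_zero, quadPart_of_mem (lprTwo_mem_symWeight _)]
  have hr : lprTwo (lieDer Q.Phi x) ∈ Q.qR := ⟨_, h, hq⟩
  have hs := Q.sec_quadPart h ⟨_, hr⟩ hq.symm
  refine ⟨⟨_, hr⟩, rfl, ?_, ?_⟩
  · rw [phi, LinearMap.neg_apply, LinearMap.comp_apply, hs, map_sub, linPart_ι,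
      linPart_of_mem (lprTwo_mem_symWeight _), zero_sub, neg_neg]
  · rw [theta, LinearMap.comp_apply, hs, AlgHom.toLinearMap_apply, map_sub,
      SymmetricAlgebra.algebraMapInv_ι, aug_of_mem (lprTwo_mem_symWeight _), sub_zero]

end CommQLC

section Curvature

variable {k : Type*} [Field k] {V : Type*} [AddCommGroup V] [Module k V]

/-- The extension of a map of degree `-2` to the tensor square commutes with the symmetry. -/
theorem koszulSwap_der_even {G : Type*} [AddCommGroup G] [Module k G] (gr : ℕ → Submodule k G)
    (hgr : DirectSum.IsInternal gr) (E : G →ₗ[k] G)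
    (h0 : ∀ n, n < 2 → ∀ x ∈ gr n, E x = 0) (h1 : ∀ n, ∀ x ∈ gr (n + 2), E x ∈ gr n) :
    koszulSwap gr hgr ∘ₗ (TensorProduct.map E LinearMap.id + TensorProduct.map LinearMap.id E) =
      (TensorProduct.map E LinearMap.id + TensorProduct.map LinearMap.id E) ∘ₗ
        koszulSwap gr hgr := by
  refine graded_ext₂ hgr.submodule_iSup_eq_top fun m n x hx y hy => ?_
  have a1 : koszulSwap gr hgr (E x ⊗ₜ y) = (-1 : k) ^ (m * n) • (y ⊗ₜ[k] E x) := by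
    by_cases hm : m < 2
    · simp [h0 m hm x hx]
    · obtain ⟨m, rfl⟩ := Nat.exists_eq_add_of_le' (not_lt.mp hm)
      rw [koszulSwap_tmul gr hgr (h1 m x hx) hy, add_mul, pow_add, pow_mul _ 2]
      simp
  have a2 : koszulSwap gr hgr (x ⊗ₜ E y) = (-1 : k) ^ (m * n) • (E y ⊗ₜ[k] x) := by
    by_cases hn : n < 2
    · simp [h0 n hn y hy]
    · obtain ⟨n, rfl⟩ := Nat.exists_eq_add_of_le' (not_lt.mp hn)
      rw [koszulSwap_tmul gr hgr hx (h1 n y hy), mul_add, pow_add, mul_comm m 2, pow_mul _ 2]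
      simp
  simp only [LinearMap.comp_apply, LinearMap.add_apply, TensorProduct.map_tmul,
    koszulSwap_tmul gr hgr hx hy, map_smul, map_add, LinearMap.id_apply, a1, a2]
  rw [add_comm, smul_add]

/-- The square of the extension of a map of degree `-1` to the tensor square. -/
theorem der_sq {G : Type*} [AddCommGroup G] [Module k G] (gr : ℕ → Submodule k G)
    (hgr : DirectSum.IsInternal gr) (D : G →ₗ[k] G)
    (h0 : ∀ x ∈ gr 0, D x = 0) (h1 : ∀ n, ∀ x ∈ gr (n + 1), D x ∈ gr n) :
    (TensorProduct.map D LinearMap.id + TensorProduct.map (parity gr hgr) D) ∘ₗ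
      (TensorProduct.map D LinearMap.id + TensorProduct.map (parity gr hgr) D) =
      TensorProduct.map (D ∘ₗ D) LinearMap.id + TensorProduct.map LinearMap.id (D ∘ₗ D) := by
  refine graded_ext₂ hgr.submodule_iSup_eq_top fun m n x hx y hy => ?_
  have a : parity gr hgr (D x) = -(-1 : k) ^ m • D x := by
    cases m with
    | zero => simp [h0 x hx]
    | succ m => rw [parity, gradeScale_of_mem gr hgr _ (h1 m x hx), pow_succ]; simp
  have b : parity gr hgr x = (-1 : k) ^ m • x := gradeScale_of_mem gr hgr _ hx
  simp only [LinearMap.comp_apply, LinearMap.add_apply, TensorProduct.map_tmul, map_add,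
    LinearMap.id_apply, a, b, map_smul, ← TensorProduct.smul_tmul']
  rcases neg_one_pow_eq_or k m with h | h <;> rw [h] <;> module

variable (Θ : SymmetricAlgebra k V →ₗ[k] k)

theorem lieCurv_lword (l : List V) : lieCurv Θ (lword k l) = splitSum l fun p q =>
    Θ (lprTwo (lword k p)) • lword k q - Θ (lprTwo (lword k q)) • lword k p := by
  rw [lieCurv, LinearMap.comp_apply, LinearMap.comp_apply, lieCobr_lword, splitSum_linear,
    splitSum_linear]
  refine splitSum_congr _ fun p q _ => ?_
  have e : (-1 : k) ^ (p.length * q.length) • (Θ (lprTwo (lword k q)) • lword k p) =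
      Θ (lprTwo (lword k q)) • lword k p := by
    by_cases h : q.length = 2
    · rw [h, mul_comm, pow_mul]; simp
    · rw [lprTwo_of_mem h (lword_mem q)]; simp
  simp only [map_sub, map_smul, LinearMap.rTensor_tmul, LinearMap.comp_apply, LinearEquiv.coe_coe,
    TensorProduct.lid_tmul]
  rw [e]

theorem lieCurv_mem (n : ℕ) (x : CofreeLie k V) (hx : x ∈ lieGr k V (n + 2)) :
    lieCurv Θ x ∈ lieGr k V n := by
  induction hx using Submodule.span_induction with
  | mem y hy =>
    obtain ⟨l, hl, rfl⟩ := hy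
    rw [lieCurv_lword, splitSum]
    refine list_sum_mem ?_
    intro z hz
    obtain ⟨p, hp, rfl⟩ := List.mem_map.mp hz
    have h := splits_length l p hp
    have aux : ∀ p q : List V, p.length + q.length = n + 2 →
        Θ (lprTwo (lword k p)) • lword k q ∈ lieGr k V n := by
      intro p q h
      by_cases hp : p.length = 2
      · have : q.length = n := by omega
        exact Submodule.smul_mem _ _ (this ▸ lword_mem q)
      · rw [lprTwo_of_mem hp (lword_mem p)]; simp
    exact sub_mem (aux _ _ (by omega)) (aux _ _ (by omega))
  | zero => simp
  | add a b _ _ ha hb => rw [map_add]; exact Submodule.add_mem _ ha hb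
  | smul c a _ ha => rw [map_smul]; exact Submodule.smul_mem _ _ ha

theorem lieCurv_eq_zero (n : ℕ) (hn : n < 2) (x : CofreeLie k V) (hx : x ∈ lieGr k V n) :
    lieCurv Θ x = 0 := by
  induction hx using Submodule.span_induction with
  | mem y hy =>
    obtain ⟨l, hl, rfl⟩ := hy
    rw [lieCurv_lword, ← splitSum_zero l]
    refine splitSum_congr _ fun p q h => ?_
    rw [lprTwo_of_mem (by omega) (lword_mem p), lprTwo_of_mem (by omega) (lword_mem q)]
    simp
  | zero => simp
  | add a b _ _ ha hb => rw [map_add, ha, hb, add_zero]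
  | smul c a _ ha => rw [map_smul, ha, smul_zero]

theorem splitSum_neg {M : Type*} [AddCommGroup M] (l : List V) (f : List V → List V → M) :
    -splitSum l f = splitSum l fun p q => -f p q :=
  splitSum_map (-AddMonoidHom.id M) l f

theorem lieDeconc_curv (l : List V) :
    (splitSum l fun p q => Θ (lprTwo (lword k p)) • lieDeconc (word k q) -
        Θ (lprTwo (lword k q)) • lieDeconc (word k p)) =
      TensorProduct.map (lieCurv Θ) LinearMap.id (lieDeconc (word k l)) +
        TensorProduct.map LinearMap.id (lieCurv Θ) (lieDeconc (word k l)) := by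
  have e1 : ∀ s r : List V, lieCurv Θ (lword k s) ⊗ₜ[k] lword k r =
      (splitSum s fun p q => Θ (lprTwo (lword k p)) • (lword k q ⊗ₜ[k] lword k r)) +
        splitSum s fun p q => -(Θ (lprTwo (lword k q)) • (lword k p ⊗ₜ[k] lword k r)) := by
    intro s r
    rw [lieCurv_lword, ← splitSum_add]
    have := splitSum_linear (k := k) ((TensorProduct.mk k _ _).flip (lword k r)) s fun p q =>
      Θ (lprTwo (lword k p)) • lword k q - Θ (lprTwo (lword k q)) • lword k p
    simp only [LinearMap.flip_apply, TensorProduct.mk_apply] at this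
    rw [this]
    refine splitSum_congr _ fun p q _ => ?_
    rw [TensorProduct.sub_tmul, ← TensorProduct.smul_tmul', ← TensorProduct.smul_tmul',
      sub_eq_add_neg]
  have e2 : ∀ s r : List V, lword k r ⊗ₜ[k] lieCurv Θ (lword k s) =
      (splitSum s fun p q => Θ (lprTwo (lword k p)) • (lword k r ⊗ₜ[k] lword k q)) +
        splitSum s fun p q => -(Θ (lprTwo (lword k q)) • (lword k r ⊗ₜ[k] lword k p)) := by
    intro s r
    rw [lieCurv_lword, ← splitSum_add]
    have := splitSum_linear (k := k) (TensorProduct.mk k _ _ (lword k r)) s fun p q =>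
      Θ (lprTwo (lword k p)) • lword k q - Θ (lprTwo (lword k q)) • lword k p
    simp only [TensorProduct.mk_apply] at this
    rw [this]
    refine splitSum_congr _ fun p q _ => ?_
    rw [TensorProduct.tmul_sub, TensorProduct.tmul_smul, TensorProduct.tmul_smul, sub_eq_add_neg]
  simp only [lieDeconc_word, splitSum_linear, TensorProduct.map_tmul, LinearMap.id_apply, e1, e2,
    splitSum_add, sub_eq_add_neg, splitSum_smul, splitSum_neg]
  have s1 := splitSum_assoc l fun a b c =>
    Θ (lprTwo (lword k a)) • (lword k b ⊗ₜ[k] lword k c)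
  have s2 := splitSum_assoc l fun a b c =>
    -(Θ (lprTwo (lword k b)) • (lword k a ⊗ₜ[k] lword k c))
  have s3 := splitSum_assoc l fun a b c =>
    Θ (lprTwo (lword k b)) • (lword k a ⊗ₜ[k] lword k c)
  have s4 := splitSum_assoc l fun a b c =>
    -(Θ (lprTwo (lword k c)) • (lword k a ⊗ₜ[k] lword k b))
  have s5 : (splitSum l fun p q => splitSum q fun b c =>
      -(Θ (lprTwo (lword k b)) • (lword k p ⊗ₜ[k] lword k c))) +
      (splitSum l fun p q => splitSum q fun b c =>
      Θ (lprTwo (lword k b)) • (lword k p ⊗ₜ[k] lword k c)) = 0 := by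
    rw [← splitSum_add, ← splitSum_zero l]
    refine splitSum_congr _ fun p q _ => ?_
    rw [← splitSum_add, ← splitSum_zero q]
    refine splitSum_congr _ fun b c _ => ?_
    module
  rw [s1, s2, ← s4, add_assoc, ← add_assoc (splitSum l fun p q => splitSum q fun b c => -_), s5,
    zero_add]

theorem lieCurv_coderivation : lieCobr ∘ₗ lieCurv Θ =
    (TensorProduct.map (lieCurv Θ) LinearMap.id + TensorProduct.map LinearMap.id (lieCurv Θ)) ∘ₗ
      lieCobr := by
  refine lword_ext fun l => ?_
  have h := fun z => LinearMap.congr_fun (koszulSwap_der_even (lieGr k V) lieGr_internal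
    (lieCurv Θ) (lieCurv_eq_zero Θ) (lieCurv_mem Θ)) z
  have e := lieDeconc_curv Θ l
  have e' := congrArg (koszulSwap (lieGr k V) lieGr_internal) e
  rw [← LinearMap.add_apply] at e e'
  simp only [LinearMap.comp_apply] at h ⊢
  rw [h] at e'
  rw [lieCurv_lword, splitSum_linear]
  have e3 : ∀ l : List V, lieCobr (lword k l) = lieDeconc (word k l) -
      koszulSwap (lieGr k V) lieGr_internal (lieDeconc (word k l)) := fun l => lieCobr_mkQ _
  rw [e3, map_sub, ← e, ← e', splitSum_linear, eq_sub_iff_add_eq, ← splitSum_add]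
  refine splitSum_congr _ fun p q _ => ?_
  simp only [map_sub, map_smul, e3]
  module

end Curvature

namespace CommQLC

variable {k : Type*} [Field k] {V : Type*} [AddCommGroup V] [Module k V] (Q : CommQLC k V)

theorem gradeScale_mem_dual (c : ℕ → k) {x : CofreeLie k V} (hx : x ∈ Q.dual) :
    gradeScale (lieGr k V) lieGr_internal c x ∈ Q.dual := by
  have h : (⨆ n, Q.dual ⊓ lieGr k V n) ≤
      Q.dual.comap (gradeScale (lieGr k V) lieGr_internal c) := by
    refine iSup_le fun n y hy => ?_
    rw [Submodule.mem_comap, gradeScale_of_mem _ _ _ hy.2]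
    exact Submodule.smul_mem _ _ hy.1
  exact h (Q.dual_admissible.graded hx)

theorem lieDer_admissible : Q.IsAdmissible (Q.dual ⊔ Q.dual.map (lieDer Q.Phi)) where
  graded := by
    refine sup_le (Q.dual_admissible.graded.trans
      (iSup_mono fun n => inf_le_inf_right _ le_sup_left)) ?_
    rw [Submodule.map_le_iff_le_comap]
    refine Q.dual_admissible.graded.trans (iSup_le fun n x hx => ?_)
    rw [Submodule.mem_comap]
    cases n with
    | zero =>
      rw [lieDer_zero Q.Phi x hx.2]; exact zero_mem _
    | succ n =>
      exact Submodule.mem_iSup_of_mem n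
        ⟨Submodule.mem_sup_right ⟨x, hx.1, rfl⟩, lieDer_mem Q.Phi n x hx.2⟩
  cobr_mem := by
    have h : Q.dual ⊔ Q.dual.map (lieDer Q.Phi) ≤
        (tensorSub (Q.dual ⊔ Q.dual.map (lieDer Q.Phi))
          (Q.dual ⊔ Q.dual.map (lieDer Q.Phi))).comap lieCobr := by
      refine sup_le (fun x hx => tensorSub_mono le_sup_left (Q.dual_admissible.cobr_mem x hx)) ?_
      rintro _ ⟨x, hx, rfl⟩
      obtain ⟨w, hw⟩ := Q.dual_admissible.cobr_mem x hx
      have hw' : TensorProduct.map Q.dual.subtype Q.dual.subtype w = lieCobr x := hw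
      have e := LinearMap.congr_fun (lieDer_coderivation Q.Phi) x
      rw [LinearMap.comp_apply, LinearMap.comp_apply, ← hw'] at e
      rw [Submodule.mem_comap, e]
      clear e hw hw'
      induction w using TensorProduct.induction_on with
      | zero => simp
      | add x y hx hy => rw [map_add, map_add]; exact add_mem hx hy
      | tmul a b =>
        rw [LinearMap.add_apply, TensorProduct.map_tmul, TensorProduct.map_tmul,
          TensorProduct.map_tmul]
        have aux : ∀ {S : Submodule k (CofreeLie k V)} {u v : CofreeLie k V}, u ∈ S → v ∈ S →
            u ⊗ₜ[k] v ∈ tensorSub S S := fun hu hv => ⟨⟨_, hu⟩ ⊗ₜ ⟨_, hv⟩, rfl⟩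
        exact add_mem
          (aux (Submodule.mem_sup_right ⟨a, a.2, rfl⟩) (Submodule.mem_sup_left b.2))
          (aux (Submodule.mem_sup_left (Q.gradeScale_mem_dual _ a.2))
            (Submodule.mem_sup_right ⟨b, b.2, rfl⟩))
    exact h
  lprTwo_mem := by
    have h : Q.dual ⊔ Q.dual.map (lieDer Q.Phi) ≤ Q.qR.comap lprTwo := by
      refine sup_le (fun x hx => Q.dual_admissible.lprTwo_mem x hx) ?_
      rintro _ ⟨x, hx, rfl⟩
      obtain ⟨r, hr, -⟩ := Q.lprTwo_lieDer_eq hx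
      rw [Submodule.mem_comap, ← hr]
      exact r.2
    exact h

theorem lieDer_mem_dual {x : CofreeLie k V} (hx : x ∈ Q.dual) : lieDer Q.Phi x ∈ Q.dual :=
  Q.le_dual Q.lieDer_admissible (Submodule.mem_sup_right ⟨x, hx, rfl⟩)

theorem lieDer_sq [CharZero k] {x : CofreeLie k V} (hx : x ∈ Q.dual) :
    lieDer Q.Phi (lieDer Q.Phi x) = lieCurv Q.Theta x := by
  suffices h : ∀ n, ∀ x ∈ Q.dual ⊓ lieGr k V n,
      (lieDer Q.Phi ∘ₗ lieDer Q.Phi - lieCurv Q.Theta) x = 0 by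
    have h' : (⨆ n, Q.dual ⊓ lieGr k V n) ≤
        LinearMap.ker (lieDer Q.Phi ∘ₗ lieDer Q.Phi - lieCurv Q.Theta) :=
      iSup_le fun n x hx => h n x hx
    exact sub_eq_zero.mp (h' (Q.dual_admissible.graded hx))
  set E := lieDer Q.Phi ∘ₗ lieDer Q.Phi - lieCurv Q.Theta with hE
  have hcod : lieCobr ∘ₗ E = (TensorProduct.map E LinearMap.id + TensorProduct.map LinearMap.id E)
      ∘ₗ lieCobr := by
    have h1 := lieDer_coderivation Q.Phi
    have h2 := lieCurv_coderivation Q.Theta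
    have h3 := der_sq (lieGr k V) lieGr_internal (lieDer Q.Phi) (lieDer_zero Q.Phi)
      (lieDer_mem Q.Phi)
    rw [hE, LinearMap.comp_sub, h2, ← LinearMap.comp_assoc, h1, LinearMap.comp_assoc, h1,
      ← LinearMap.comp_assoc, h3, ← LinearMap.sub_comp]
    congr 1
    refine TensorProduct.ext' fun x y => ?_
    simp only [LinearMap.sub_apply, LinearMap.add_apply, TensorProduct.map_tmul,
      TensorProduct.sub_tmul, TensorProduct.tmul_sub]
    abel
  have hone : ∀ x ∈ Q.dual, lprOne (E x) = 0 := by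
    intro x hx
    obtain ⟨r, hr, h1, -⟩ := Q.lprTwo_lieDer_eq hx
    rw [hE, LinearMap.sub_apply, map_sub, LinearMap.comp_apply, lprOne_lieDer, ← hr, Phi_apply, h1,
      sub_self]
  intro n
  induction n using Nat.strong_induction_on with
  | _ n ih =>
  rintro x ⟨hx, hxn⟩
  have hmem : E x ∈ lieGr k V (n - 2) := by
    match n, hxn with
    | 0, hxn => rw [lieGr_zero] at hxn; rw [(Submodule.mem_bot k).mp hxn, map_zero]; exact zero_mem _
    | 1, hxn =>
      rw [hE, LinearMap.sub_apply, lieCurv_eq_zero _ 1 (by omega) x hxn, LinearMap.comp_apply,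
        lieDer_zero _ _ (lieDer_mem _ 0 x hxn), sub_zero]
      exact zero_mem _
    | n + 2, hxn =>
      exact sub_mem (lieDer_mem _ n _ (lieDer_mem _ (n + 1) x hxn)) (lieCurv_mem _ n x hxn)
  refine eq_zero_of_primitive hmem (hone x hx) ?_
  have h1 := LinearMap.congr_fun hcod x
  rw [LinearMap.comp_apply, LinearMap.comp_apply] at h1
  rw [h1]
  obtain ⟨w, hw⟩ : ∃ w, w ∈ ⨆ (i : ℕ) (j : ℕ) (_ : i + j = n),
      tensorSub (((cofreeLie k V).restrict Q.dual_admissible.toIsSubcoalgebra).gr i)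
        (((cofreeLie k V).restrict Q.dual_admissible.toIsSubcoalgebra).gr j) ∧
      TensorProduct.map Q.dual.subtype Q.dual.subtype w = lieCobr x :=
    ⟨_, ((cofreeLie k V).restrict Q.dual_admissible.toIsSubcoalgebra).cobr_mem n ⟨x, hx⟩ hxn,
      GradedLieCoalgebra.map_subCobr Q.dual_admissible.toIsSubcoalgebra ⟨x, hx⟩⟩
  rw [← hw.2]
  suffices h : (⨆ (i : ℕ) (j : ℕ) (_ : i + j = n),
      tensorSub (((cofreeLie k V).restrict Q.dual_admissible.toIsSubcoalgebra).gr i)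
        (((cofreeLie k V).restrict Q.dual_admissible.toIsSubcoalgebra).gr j)) ≤
      LinearMap.ker ((TensorProduct.map E LinearMap.id + TensorProduct.map LinearMap.id E) ∘ₗ
        TensorProduct.map Q.dual.subtype Q.dual.subtype) from h hw.1
  refine iSup_le fun i => iSup_le fun j => iSup_le fun hij => ?_
  rw [tensorSub, LinearMap.range_le_ker_iff]
  refine TensorProduct.ext' fun a b => ?_
  have ha : (a : Q.dual).1 ∈ lieGr k V i := a.2
  have hb : (b : Q.dual).1 ∈ lieGr k V j := b.2
  simp only [LinearMap.comp_apply, TensorProduct.map_tmul, Submodule.subtype_apply,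
    LinearMap.add_apply, LinearMap.id_apply, LinearMap.zero_apply]
  by_cases hi : i = 0
  · have ha' : (a : Q.dual).1 ∈ lieGr k V 0 := by simpa only [hi] using ha
    rw [lieGr_zero, Submodule.mem_bot] at ha'
    rw [ha']; simp
  by_cases hj : j = 0
  · have hb' : (b : Q.dual).1 ∈ lieGr k V 0 := by simpa only [hj] using hb
    rw [lieGr_zero, Submodule.mem_bot] at hb'
    rw [hb']; simp
  rw [ih i (by omega) _ ⟨a.1.2, ha⟩, ih j (by omega) _ ⟨b.1.2, hb⟩]
  simp

/-- The graded Lie coalgebra `(qA)^¡`. -/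
def dualLie : GradedLieCoalgebra k Q.dual :=
  GradedLieCoalgebra.restrict Q.dual_admissible.toIsSubcoalgebra

theorem map_dualLie_cobr (x : Q.dual) :
    TensorProduct.map Q.dual.subtype Q.dual.subtype (Q.dualLie.cobr x) = lieCobr (x : CofreeLie k V) :=
  GradedLieCoalgebra.map_subCobr Q.dual_admissible.toIsSubcoalgebra x

/-- The Koszul dual curved Lie coalgebra `((qA)^¡, φ~, θ~)`: the coderivation `φ~` has
corestriction `φ` on weight two, and `θ~` is `θ` on weight two. -/
def koszulDual [CharZero k] : CurvedDGLieCoalgebra k Q.dual where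
  toGradedLieCoalgebra := Q.dualLie
  d := (lieDer Q.Phi).restrict fun _ hx => Q.lieDer_mem_dual hx
  d_zero x hx := Subtype.ext (lieDer_zero Q.Phi x hx)
  d_mem n x hx := lieDer_mem Q.Phi n x hx
  coderivation := by
    refine LinearMap.ext fun x => GradedLieCoalgebra.tensorSub_injective Q.dual ?_
    have h := LinearMap.congr_fun (lieDer_coderivation Q.Phi) (x : CofreeLie k V)
    have hp := gradeScale_natural Q.dualLie.internal lieGr_internal Q.dual.subtype
      (fun _ _ h => h) (fun n => (-1 : k) ^ n)
    rw [LinearMap.comp_apply, map_dualLie_cobr]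
    rw [LinearMap.comp_apply, LinearMap.comp_apply, ← map_dualLie_cobr] at h
    refine h.trans ?_
    rw [LinearMap.comp_apply]
    generalize Q.dualLie.cobr x = w
    rw [LinearMap.add_apply, LinearMap.add_apply, map_add]
    simp only [← LinearMap.comp_apply, ← TensorProduct.map_comp]
    rw [parity, hp]
    rfl
  h := Q.Theta ∘ₗ lprTwo ∘ₗ Q.dual.subtype
  h_mem n hn x hx := by
    rw [LinearMap.comp_apply, LinearMap.comp_apply, lprTwo_of_mem hn hx, map_zero]
  d_sq := by
    refine LinearMap.ext fun x => Subtype.ext ?_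
    refine (Q.lieDer_sq x.2).trans ?_
    rw [lieCurv, LinearMap.comp_apply, LinearMap.comp_apply, LinearMap.comp_apply,
      LinearMap.comp_apply, ← map_dualLie_cobr]
    generalize Q.dualLie.cobr x = w
    induction w using TensorProduct.induction_on with
    | zero => simp
    | add x y hx hy => simp only [map_add, hx, hy, Submodule.coe_add]
    | tmul x y => simp
  h_d := by
    refine LinearMap.ext fun x => ?_
    obtain ⟨r, hr, -, h⟩ := Q.lprTwo_lieDer_eq x.2
    change Q.Theta (lprTwo (lieDer Q.Phi (x : CofreeLie k V))) = 0
    rw [← hr, Theta_apply, h]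

end CommQLC

section Complexes

variable {k : Type*} [Field k] {M : Type*} [AddCommGroup M] [Module k M] {N : Type*}
  [AddCommGroup N] [Module k N]

/-- `(M, d)` is a chain complex for the `ℤ`-indexed family `gr` of subspaces of `M`. -/
structure IsComplex (gr : ℤ → Submodule k M) (d : M →ₗ[k] M) : Prop where
  d_mem : ∀ n, ∀ x ∈ gr n, d x ∈ gr (n - 1)
  d_sq : d ∘ₗ d = 0

/-- `f` is a chain map of degree `0`. -/
structure IsChainMap (gr : ℤ → Submodule k M) (d : M →ₗ[k] M) (gr' : ℤ → Submodule k N)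
    (d' : N →ₗ[k] N) (f : M →ₗ[k] N) : Prop where
  map_mem : ∀ n, ∀ x ∈ gr n, f x ∈ gr' n
  comm : f ∘ₗ d = d' ∘ₗ f

/-- The chain map `f` induces an isomorphism on homology in each degree. -/
structure IsQuasiIso (gr : ℤ → Submodule k M) (d : M →ₗ[k] M) (gr' : ℤ → Submodule k N)
    (d' : N →ₗ[k] N) (f : M →ₗ[k] N) : Prop where
  injective : ∀ n, ∀ x ∈ gr n, d x = 0 → f x ∈ (gr' (n + 1)).map d' → x ∈ (gr (n + 1)).map d
  surjective : ∀ n, ∀ y ∈ gr' n, d' y = 0 →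
    ∃ x ∈ gr n, d x = 0 ∧ f x - y ∈ (gr' (n + 1)).map d'

/-- A vector space `W`, concentrated in degree `0`. -/
def degZero (W : Submodule k M) (n : ℤ) : Submodule k M := if n = 0 then W else ⊥

end Complexes

namespace CommQLC

variable {k : Type*} [Field k] {V : Type*} [AddCommGroup V] [Module k V] (Q : CommQLC k V)

/-- The commutative QLC algebra `A = Sym V / (R)`. -/
abbrev Alg : Type _ :=
  SymmetricAlgebra k V ⧸ Ideal.span (Q.R : Set (SymmetricAlgebra k V))

/-- The quadratic algebra `k ⊕ qA = Sym V / (qR)`. -/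
abbrev QuadAlg : Type _ :=
  SymmetricAlgebra k V ⧸ Ideal.span (Q.qR : Set (SymmetricAlgebra k V))

/-- The nonunital quadratic algebra `qA`: the image in `Sym V / (qR)` of the augmentation ideal of
`Sym V`. -/
def quadIdeal : Submodule k Q.QuadAlg :=
  (LinearMap.ker (SymmetricAlgebra.algebraMapInv (R := k) (M := V)).toLinearMap).map
    (Ideal.Quotient.mkₐ k (Ideal.span (Q.qR : Set (SymmetricAlgebra k V)))).toLinearMap

/-- The algebra morphism on `Sym((qA)^¡[-1])` induced by the map
`(qA)^¡ → sV ≅ V → Sym V / I` of degree `-1`. -/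
def twist (I : Ideal (SymmetricAlgebra k V)) :
    GSym Q.dualLie.gr →ₐ[k] SymmetricAlgebra k V ⧸ I :=
  GSym.lift ((Ideal.Quotient.mkₐ k I).toLinearMap ∘ₗ SymmetricAlgebra.ι k V ∘ₗ lprOne ∘ₗ
      Q.dual.subtype) (by
    intro m n x hx y _
    by_cases hm : m = 1
    · rw [hm, pow_mul, mul_comm]; simp
    · have h : lprOne (x : CofreeLie k V) = 0 := lprOne_of_mem hm hx
      simp [h])

/-- The morphism `g_κ : Ω_Lie(𝔊) → A`, where `𝔊 = ((qA)^¡, φ~, θ~)`. -/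
def gKappa [CharZero k] : Q.koszulDual.LieCobar →ₐ[k] Q.Alg :=
  Q.twist (Ideal.span (Q.R : Set (SymmetricAlgebra k V)))

/-- The morphism `g_κ' : (Ω_Lie((qA)^¡), d₂) → k ⊕ qA`. -/
def gKappa' : Q.dualLie.toCurved.LieCobar →ₐ[k] Q.QuadAlg :=
  Q.twist (Ideal.span (Q.qR : Set (SymmetricAlgebra k V)))

/-- `qA` is Koszul: the canonical projection to `qA` from the augmentation ideal of the Lie cobar
construction of the graded Lie coalgebra `(qA)^¡` (with `d = 0` and `h = 0`) is a
quasi-isomorphism. -/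
def IsKoszul : Prop :=
  IsQuasiIso
    (fun n => GSym.deg Q.dualLie.gr n ⊓
      LinearMap.ker (GSym.augmentation Q.dualLie.gr).toLinearMap)
    Q.dualLie.toCurved.cobarD (degZero Q.quadIdeal) 0 Q.gKappa'.toLinearMap

end CommQLC

end CurvedKoszul

end

/-! The statement `d² = 0` holds for the Lie cobar construction of any curved DG Lie coalgebra. On a
generator the square splits according to how many factors are produced. The scalar part vanishes by
`h ∘ d = 0`. In the part with one factor, `d₁²` cancels `d₀d₂` because `d² = (h ⊗ id) ∘ ]-[`. In the
part with two factors, `d₁d₂` cancels `d₂d₁` because `d` is a coderivation. In the part with three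
factors, `d₂² = 0` is the co-Jacobi identity. As the square of an odd derivation is again a
derivation, generators suffice (`cobarD_cobarD`).

For the quasi-isomorphism, give `s⁻¹x₁ ⋯ s⁻¹xᵣ` degree `∑ (|xᵢ| - 1)` and weight `∑ |xᵢ|`. The
Koszul dual has nothing in degree `0`, so the cobar construction has nothing in negative degree, and
its part of degree `0` is generated by the weight-one elements: it is `Sym V`, and `g_κ` restricted
to it is the quotient map onto `A`. A generator of weight two over `r ∈ qR` has boundary `r - φ(r) +
θ(r)`, which is an element of `R`, and every element of `R` arises so. Since the differential is
linear over `Sym V`, all of `(R)` consists of boundaries, while `g_κ` kills all boundaries. So the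
homology in degree `0` is `A`, and Koszulness plays no role there (`symCobar_mem_map_cobarD`,
`gKappa_cobarD`).

In positive degree the homology must vanish. Koszulness says that it does for `d₂` alone
(`IsKoszul.exists_cobarQuad_eq`). Now `d₂` preserves the weight, while `d₀` and `d₁` lower it. The
leading component of a cycle is therefore a `d₂`-cycle, hence a `d₂`-boundary; subtracting the full
boundary of a primitive of the same weight lowers the weight of the cycle. Weights are natural
numbers, so the process ends (`mem_map_cobarD`). This replaces a spectral sequence argument. -/

noncomputable section

open scoped TensorProduct

namespace CurvedKoszul

/-! ### Degrees in the graded symmetric algebra on the desuspension -/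

section GSymDegree

variable {k : Type*} [Field k] {G : Type*} [AddCommGroup G] [Module k G]
  {gr : ℕ → Submodule k G}

namespace GSym

variable (gr) in
/-- The product `s⁻¹x₁ ⋯ s⁻¹xᵣ` of generators. -/
def mono (l : List (ℕ × G)) : GSym gr := (l.map fun a => ι gr a.2).prod

theorem mono_nil : mono gr [] = 1 := rfl

theorem mono_cons (a : ℕ × G) (l : List (ℕ × G)) :
    mono gr (a :: l) = ι gr a.2 * mono gr l := by
  simp [mono]

theorem mono_append (l m : List (ℕ × G)) : mono gr (l ++ m) = mono gr l * mono gr m := by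
  simp [mono]

variable (gr) in
/-- Lists of homogeneous elements, each paired with its degree. -/
def IsHomog (l : List (ℕ × G)) : Prop := ∀ a ∈ l, a.2 ∈ gr a.1

/-- The degree `∑ (|xᵢ| - 1)` of a product of generators. -/
def listDeg {α : Type*} (l : List (ℕ × α)) : ℤ := (l.map fun a => (a.1 : ℤ) - 1).sum

/-- The weight `∑ |xᵢ|` of a product of generators. -/
def listWeight {α : Type*} (l : List (ℕ × α)) : ℕ := (l.map fun a => a.1).sum

theorem listDeg_cons {α : Type*} (a : ℕ × α) (l : List (ℕ × α)) :
    listDeg (a :: l) = (a.1 : ℤ) - 1 + listDeg l := by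
  simp [listDeg]

theorem listWeight_cons {α : Type*} (a : ℕ × α) (l : List (ℕ × α)) :
    listWeight (a :: l) = a.1 + listWeight l := by
  simp [listWeight]

theorem isHomog_cons {a : ℕ × G} {l : List (ℕ × G)} :
    IsHomog gr (a :: l) ↔ a.2 ∈ gr a.1 ∧ IsHomog gr l := by
  simp [IsHomog]

theorem mono_mem_deg {l : List (ℕ × G)} (hl : IsHomog gr l) : mono gr l ∈ deg gr (listDeg l) :=
  Submodule.subset_span ⟨l, hl, rfl, rfl⟩

theorem deg_le {p : ℤ} {S : Submodule k (GSym gr)}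
    (h : ∀ l, IsHomog gr l → listDeg l = p → mono gr l ∈ S) : deg gr p ≤ S := by
  rw [deg, Submodule.span_le]
  rintro _ ⟨l, hl, hp, rfl⟩
  exact h l hl hp

theorem one_mem_deg : (1 : GSym gr) ∈ deg gr 0 :=
  mono_mem_deg (l := []) (by simp [IsHomog])

theorem ι_mem_deg {n : ℕ} {x : G} (hx : x ∈ gr n) : ι gr x ∈ deg gr ((n : ℤ) - 1) := by
  have h := mono_mem_deg (gr := gr) (l := [(n, x)]) (by simpa [IsHomog] using hx)
  simpa [mono, listDeg] using h

theorem algebraMap_mem_deg (c : k) : algebraMap k (GSym gr) c ∈ deg gr 0 := by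
  rw [Algebra.algebraMap_eq_smul_one]
  exact Submodule.smul_mem _ _ one_mem_deg

theorem mul_mem_deg {p q : ℤ} {s t : GSym gr} (hs : s ∈ deg gr p) (ht : t ∈ deg gr q) :
    s * t ∈ deg gr (p + q) := by
  have h : deg gr p * deg gr q ≤ deg gr (p + q) := by
    rw [deg, deg, Submodule.span_mul_span, Submodule.span_le]
    rintro _ ⟨_, ⟨l, hl, hp, rfl⟩, _, ⟨m, hm, hq, rfl⟩, rfl⟩
    refine Submodule.subset_span ⟨l ++ m, ?_, ?_, ?_⟩
    · intro a ha
      rcases List.mem_append.mp ha with ha | ha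
      exacts [hl a ha, hm a ha]
    · rw [List.map_append, List.sum_append, hp, hq]
    · simp
  exact h (Submodule.mul_mem_mul hs ht)

/-- Products of homogeneous generators suffice because the generator map is linear and every
generator is a sum of homogeneous ones. Identities whose signs depend on degrees can thus be checked
on monomials. -/
theorem span_mono (htop : ⨆ n, gr n = ⊤) :
    Submodule.span k {s | ∃ l, IsHomog gr l ∧ s = mono gr l} = ⊤ := by
  set S := Submodule.span k {s | ∃ l, IsHomog gr l ∧ s = mono gr l} with hS
  rw [eq_top_iff]
  rintro s -
  induction s using GSym.induction with
  | one => exact Submodule.subset_span ⟨[], by simp [IsHomog], rfl⟩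
  | smul c a ha => exact Submodule.smul_mem _ _ ha
  | add a b ha hb => exact Submodule.add_mem _ ha hb
  | mul x a ha =>
    have hx : x ∈ ⨆ n, gr n := htop ▸ Submodule.mem_top
    induction hx using Submodule.iSup_induction' with
    | mem n y hy =>
      induction ha using Submodule.span_induction with
      | mem z hz =>
        obtain ⟨l, hl, rfl⟩ := hz
        exact Submodule.subset_span ⟨(n, y) :: l, isHomog_cons.mpr ⟨hy, hl⟩,
          (mono_cons (n, y) l).symm⟩
      | zero => simp
      | add u v _ _ hu hv => rw [mul_add]; exact Submodule.add_mem _ hu hv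
      | smul c u _ hu => rw [mul_smul_comm]; exact Submodule.smul_mem _ _ hu
    | zero => simp
    | add y z _ _ hy hz => rw [map_add, add_mul]; exact Submodule.add_mem _ hy hz

/-- If there are no generators of degree `0`, then a product of generators of negative degree
vanishes. -/
theorem deg_eq_bot (h0 : gr 0 = ⊥) {p : ℤ} (hp : p < 0) : deg gr p = ⊥ := by
  refine le_bot_iff.mp (deg_le fun l hl hlp => (Submodule.mem_bot k).mpr ?_)
  rw [← hlp] at hp
  clear hlp
  induction l with
  | nil => simp [listDeg] at hp
  | cons a l ih =>
    obtain ⟨ha, hl⟩ : _ := isHomog_cons.mp hl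
    rw [mono_cons]
    -- A head in `gr 0` is zero. Any other head has non-negative degree, so the tail still has
    -- negative degree and the induction applies to it.
    by_cases ha0 : a.1 = 0
    · rw [ha0, h0, Submodule.mem_bot] at ha
      rw [ha, map_zero, zero_mul]
    · rw [listDeg_cons] at hp
      rw [ih (by omega) hl, mul_zero]

/-- Only the empty product survives the augmentation, and it has degree `0`. In nonzero degree the
condition of lying in the augmentation ideal, which occurs in `IsKoszul`, is therefore automatic. -/
theorem augmentation_of_mem {p : ℤ} (hp : p ≠ 0) {s : GSym gr} (hs : s ∈ deg gr p) :
    augmentation gr s = 0 := by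
  suffices h : deg gr p ≤ LinearMap.ker (augmentation gr).toLinearMap from h hs
  refine deg_le fun l _ hlp => ?_
  cases l with
  | nil => exact absurd hlp.symm (by simpa [listDeg] using hp)
  | cons a l =>
    rw [LinearMap.mem_ker, AlgHom.toLinearMap_apply, mono_cons, map_mul, augmentation,
      GSym.lift_ι, LinearMap.zero_apply, zero_mul]

end GSym

end GSymDegree

/-! ### Degree and signs of the Lie cobar differential -/

namespace CurvedDGLieCoalgebra

variable {k : Type*} [Field k] {G : Type*} [AddCommGroup G] [Module k G]
  (C : CurvedDGLieCoalgebra k G)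

theorem iSup_gr : ⨆ n, C.gr n = ⊤ := C.internal.submodule_iSup_eq_top

theorem cobarD_one : C.cobarD 1 = 0 := by
  simp [cobarD]

theorem cobarD_algebraMap (c : k) : C.cobarD (algebraMap k _ c) = 0 := by
  rw [Algebra.algebraMap_eq_smul_one, map_smul, cobarD_one, smul_zero]

/-- Both sides are multiplicative on monomials, so generators decide. The exponent is an integer
because a generator in `gr 0` has degree `-1`; the natural exponent `n + 1` used for generators has
the parity of the degree `n - 1`. -/
theorem cobarSign_of_mem_deg {p : ℤ} {s : C.LieCobar} (hs : s ∈ GSym.deg C.gr p) :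
    C.cobarSign s = (-1 : k) ^ p • s := by
  suffices h : GSym.deg C.gr p ≤
      LinearMap.eqLocus C.cobarSign.toLinearMap ((-1 : k) ^ p • LinearMap.id) from h hs
  refine GSym.deg_le fun l hl hp => ?_
  subst hp
  clear hs
  rw [LinearMap.mem_eqLocus, AlgHom.toLinearMap_apply, LinearMap.smul_apply, LinearMap.id_apply]
  induction l with
  | nil => simp [GSym.mono_nil, GSym.listDeg]
  | cons a l ih =>
    obtain ⟨ha, hl⟩ := GSym.isHomog_cons.mp hl
    have e : (-1 : k) ^ (a.1 + 1) = (-1) ^ ((a.1 : ℤ) - 1) := by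
      rw [zpow_sub₀ (by simp), zpow_natCast, pow_succ, zpow_one, div_neg, div_one, mul_neg_one]
    rw [GSym.mono_cons, map_mul, C.cobarSign_ι ha, ih hl, smul_mul_smul_comm, GSym.listDeg_cons,
      zpow_add₀ (by simp), e]

/-- The product `x ⊗ y ↦ (-1)^|x| s⁻¹x s⁻¹y`. -/
def cobarMul : G ⊗[k] G →ₗ[k] C.LieCobar :=
  LinearMap.mul' k C.LieCobar ∘ₗ
    TensorProduct.map (GSym.ι C.gr ∘ₗ parity C.gr C.internal) (GSym.ι C.gr)

theorem cobarMul_tmul (x y : G) : C.cobarMul (x ⊗ₜ y) =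
    GSym.ι C.gr (parity C.gr C.internal x) * GSym.ι C.gr y := rfl

theorem cobarMul_tmul_of_mem {m : ℕ} {x : G} (hx : x ∈ C.gr m) (y : G) : C.cobarMul (x ⊗ₜ y) =
    (-1 : k) ^ m • (GSym.ι C.gr x * GSym.ι C.gr y) := by
  rw [cobarMul_tmul, parity, gradeScale_of_mem C.gr C.internal _ hx, map_smul, smul_mul_assoc]

theorem cobarGen_apply (x : G) : C.cobarGen x =
    algebraMap k _ (C.h x) - GSym.ι C.gr (C.d x) - (2⁻¹ : k) • C.cobarMul (C.cobr x) := by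
  have h : C.cobarGen₂ x = -(2⁻¹ : k) • C.cobarMul (C.cobr x) := rfl
  rw [cobarGen, LinearMap.add_apply, LinearMap.add_apply, h, neg_smul]
  simp [cobarGen₀, cobarGen₁, sub_eq_add_neg]

/-- Two linear maps agree on the cobracket of an element of degree `n` if they agree on
homogeneous tensors of degree `n`. -/
theorem cobr_ext {M : Type*} [AddCommGroup M] [Module k M] {n : ℕ} {x : G} (hx : x ∈ C.gr n)
    {f g : G ⊗[k] G →ₗ[k] M}
    (h : ∀ i j, i + j = n → ∀ y ∈ C.gr i, ∀ z ∈ C.gr j, f (y ⊗ₜ z) = g (y ⊗ₜ z)) :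
    f (C.cobr x) = g (C.cobr x) := by
  suffices h' : (⨆ (i : ℕ) (j : ℕ) (_ : i + j = n), tensorSub (C.gr i) (C.gr j)) ≤
      LinearMap.eqLocus f g from h' (C.cobr_mem n x hx)
  refine iSup_le fun i => iSup_le fun j => iSup_le fun hij => ?_
  rintro _ ⟨w, rfl⟩
  rw [LinearMap.mem_eqLocus]
  induction w using TensorProduct.induction_on with
  | zero => simp
  | add u v hu hv => simp only [map_add, hu, hv]
  | tmul y z => exact h i j hij _ y.2 _ z.2

/-- The cobracket is homogeneous, and a subspace does not see the signs of `cobarMul`. This is the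
form in which `d₂` is shown to respect both degree and weight. -/
theorem cobarMul_cobr_mem {n : ℕ} {x : G} (hx : x ∈ C.gr n) (S : Submodule k C.LieCobar)
    (hS : ∀ i j, i + j = n → ∀ y ∈ C.gr i, ∀ z ∈ C.gr j, GSym.ι C.gr y * GSym.ι C.gr z ∈ S) :
    C.cobarMul (C.cobr x) ∈ S := by
  rw [← Submodule.Quotient.mk_eq_zero]
  -- Passing to the quotient by `S` turns membership into equality with the zero map, to which
  -- `cobr_ext` applies.
  refine C.cobr_ext hx (f := S.mkQ ∘ₗ C.cobarMul) (g := 0) fun i j hij y hy z hz => ?_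
  rw [LinearMap.comp_apply, C.cobarMul_tmul_of_mem hy, LinearMap.zero_apply, Submodule.mkQ_apply,
    Submodule.Quotient.mk_eq_zero]
  exact S.smul_mem _ (hS i j hij y hy z hz)

/-- Each component has degree `-1`: `h` sees only degree `2` and has values in the scalars of degree
`0`, `d` has degree `-1`, and a term of the cobracket with `i + j = n` gives `(i - 1) + (j - 1) = (n
- 1) - 1`. -/
theorem cobarGen_mem_deg {n : ℕ} {x : G} (hx : x ∈ C.gr n) :
    C.cobarGen x ∈ GSym.deg C.gr ((n : ℤ) - 1 - 1) := by
  rw [cobarGen_apply]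
  refine sub_mem (sub_mem ?_ ?_) (Submodule.smul_mem _ _ ?_)
  · by_cases hn : n = 2
    · subst hn
      exact GSym.algebraMap_mem_deg _
    · rw [C.h_mem n hn x hx, map_zero]; exact zero_mem _
  · cases n with
    | zero => rw [C.d_zero x hx, map_zero]; exact zero_mem _
    | succ n =>
      have h := GSym.ι_mem_deg (C.d_mem n x hx)
      rwa [Nat.cast_succ, add_sub_cancel_right]
  · refine C.cobarMul_cobr_mem hx _ fun i j hij y hy z hz => ?_
    have h := GSym.mul_mem_deg (GSym.ι_mem_deg hy) (GSym.ι_mem_deg hz)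
    rwa [show (i : ℤ) - 1 + (j - 1) = (n : ℤ) - 1 - 1 by rw [← hij]; push_cast; ring] at h

theorem cobarD_mem_deg {p : ℤ} {s : C.LieCobar} (hs : s ∈ GSym.deg C.gr p) :
    C.cobarD s ∈ GSym.deg C.gr (p - 1) := by
  suffices h : GSym.deg C.gr p ≤ (GSym.deg C.gr (p - 1)).comap C.cobarD from h hs
  refine GSym.deg_le fun l hl hp => ?_
  subst hp
  clear hs
  rw [Submodule.mem_comap]
  induction l with
  | nil => rw [GSym.mono_nil, cobarD_one]; exact zero_mem _
  | cons a l ih =>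
    obtain ⟨ha, hl⟩ : _ := GSym.isHomog_cons.mp hl
    rw [GSym.mono_cons, cobarD_mul, cobarD_ι, GSym.listDeg_cons]
    refine add_mem ?_ ?_
    · have h := GSym.mul_mem_deg (C.cobarGen_mem_deg ha) (GSym.mono_mem_deg hl)
      rwa [show (a.1 : ℤ) - 1 - 1 + GSym.listDeg l = a.1 - 1 + GSym.listDeg l - 1 by ring] at h
    · rw [C.cobarSign_ι ha]
      have h := GSym.mul_mem_deg (Submodule.smul_mem _ ((-1 : k) ^ (a.1 + 1)) (GSym.ι_mem_deg ha)) (ih hl)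
      rwa [← add_sub_assoc] at h

theorem parity_parity (x : G) : parity C.gr C.internal (parity C.gr C.internal x) = x := by
  have h : parity C.gr C.internal ∘ₗ parity C.gr C.internal = LinearMap.id := by
    refine graded_ext C.iSup_gr fun n x hx => ?_
    rw [LinearMap.comp_apply, parity, gradeScale_of_mem _ _ _ hx, map_smul,
      gradeScale_of_mem _ _ _ hx, smul_smul, ← mul_pow]
    simp
  exact LinearMap.congr_fun h x

theorem d_parity (x : G) : C.d (parity C.gr C.internal x) = -parity C.gr C.internal (C.d x) := by
  have h : C.d ∘ₗ parity C.gr C.internal = -(parity C.gr C.internal ∘ₗ C.d) := by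
    refine graded_ext C.iSup_gr fun n x hx => ?_
    rw [LinearMap.comp_apply, LinearMap.neg_apply, LinearMap.comp_apply, parity,
      gradeScale_of_mem _ _ _ hx, map_smul]
    cases n with
    | zero => simp [C.d_zero x hx]
    | succ n =>
      rw [gradeScale_of_mem _ _ _ (C.d_mem n x hx), pow_succ]
      simp
  exact LinearMap.congr_fun h x

theorem h_parity (x : G) : C.h (parity C.gr C.internal x) = C.h x := by
  have h : C.h ∘ₗ parity C.gr C.internal = C.h := by
    refine graded_ext C.iSup_gr fun n x hx => ?_
    rw [LinearMap.comp_apply, parity, gradeScale_of_mem _ _ _ hx, map_smul]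
    by_cases hn : n = 2
    · simp [hn]
    · simp [C.h_mem n hn x hx]
  exact LinearMap.congr_fun h x

theorem cobarSign_ι_eq (x : G) :
    C.cobarSign (GSym.ι C.gr x) = -GSym.ι C.gr (parity C.gr C.internal x) := by
  rw [cobarSign, GSym.lift_ι]; rfl

end CurvedDGLieCoalgebra

/-! ### The cobar differential squares to zero -/

namespace CurvedDGLieCoalgebra

variable {k : Type*} [Field k] {G : Type*} [AddCommGroup G] [Module k G]
  (C : CurvedDGLieCoalgebra k G)

/-- The differential of `(-1)^|x| s⁻¹x s⁻¹y`. -/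
theorem cobarD_cobarMul_tmul (x y : G) : C.cobarD (C.cobarMul (x ⊗ₜ y)) =
    C.cobarGen (parity C.gr C.internal x) * GSym.ι C.gr y - GSym.ι C.gr x * C.cobarGen y := by
  rw [cobarMul_tmul, cobarD_mul, cobarD_ι, cobarD_ι, cobarSign_ι_eq, parity_parity, neg_mul,
    sub_eq_add_neg]

/-- The product `x ⊗ y ⊗ z ↦ (-1)^|y| s⁻¹x s⁻¹y s⁻¹z`. -/
def cobarMul₃ : (G ⊗[k] G) ⊗[k] G →ₗ[k] C.LieCobar :=
  LinearMap.mul' k C.LieCobar ∘ₗ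
    TensorProduct.map (LinearMap.mul' k C.LieCobar ∘ₗ
      TensorProduct.map (GSym.ι C.gr) (GSym.ι C.gr ∘ₗ parity C.gr C.internal)) (GSym.ι C.gr)

theorem cobarMul₃_tmul {n : ℕ} (x : G) {y : G} (hy : y ∈ C.gr n) (z : G) :
    C.cobarMul₃ ((x ⊗ₜ y) ⊗ₜ z) =
      (-1 : k) ^ n • (GSym.ι C.gr x * GSym.ι C.gr y * GSym.ι C.gr z) := by
  simp only [cobarMul₃, LinearMap.comp_apply, TensorProduct.map_tmul, LinearMap.mul'_apply]
  rw [parity, gradeScale_of_mem C.gr C.internal _ hy, map_smul, mul_smul_comm, smul_mul_assoc]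

/-- The Koszul signs of `G` and of its desuspension differ, since the generators `s⁻¹x` have shifted
parity. The factor `(-1)^|y|` attached to the middle letter makes up exactly for this difference, so
the triple product is invariant under signed cyclic permutation. -/
theorem cobarMul₃_cycle :
    C.cobarMul₃ ∘ₗ koszulCycle C.gr C.internal = C.cobarMul₃ := by
  refine TensorProduct.ext (graded_ext₂ C.iSup_gr fun l m x hx y hy =>
    graded_ext C.iSup_gr fun n z hz => ?_)
  change C.cobarMul₃ (koszulCycle C.gr C.internal ((x ⊗ₜ y) ⊗ₜ z)) = C.cobarMul₃ ((x ⊗ₜ y) ⊗ₜ z)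
  rw [koszulCycle_tmul _ _ hx hy hz, map_smul, C.cobarMul₃_tmul _ hx, C.cobarMul₃_tmul _ hy,
    GSym.ι_mul_ι hz hx, smul_mul_assoc, mul_assoc, GSym.ι_mul_ι hz hy, mul_smul_comm, mul_assoc]
  simp only [smul_smul, ← pow_add]
  congr 1
  rw [show m * n + l * n + (l + ((n + 1) * (l + 1) + (n + 1) * (m + 1))) =
    m + 2 * (m * n + l * n + l + n + 1) by ring, pow_add, pow_mul]
  simp

/-- By cyclic invariance the three summands of the co-Jacobi identity have the same image, so three
times that image is zero. This is `d₂² = 0` on generators. -/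
theorem cobarMul₃_cobr [CharZero k] (x : G) :
    C.cobarMul₃ (C.cobr.rTensor G (C.cobr x)) = 0 := by
  have h := congrArg C.cobarMul₃ (LinearMap.congr_fun C.coJacobi x)
  have hc : ∀ w, C.cobarMul₃ (koszulCycle C.gr C.internal w) = C.cobarMul₃ w :=
    fun w => LinearMap.congr_fun C.cobarMul₃_cycle w
  simp only [LinearMap.comp_apply, LinearMap.add_apply, LinearMap.id_apply, map_add, hc,
    LinearMap.zero_apply, map_zero] at h
  have h3 : (3 : k) • C.cobarMul₃ (C.cobr.rTensor G (C.cobr x)) = 0 := by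
    rw [← h]; module
  exact (smul_eq_zero.mp h3).resolve_left three_ne_zero

/-- Two applications of the cobracket, with all signs. -/
def cobarTwice : G ⊗[k] G →ₗ[k] C.LieCobar := C.cobarMul₃ ∘ₗ C.cobr.rTensor G

/-- `cobarMul` carries the sign of the first factor, `cobarMul₃` that of the middle one. For a term
`x' ⊗ x''` of the cobracket of `x` one has `|x'| + |x''| = |x|`, so the two signs differ by
`(-1)^|x|`. -/
theorem cobarMul_cobr_mul {m : ℕ} {x : G} (hx : x ∈ C.gr m) (y : G) :
    C.cobarMul (C.cobr x) * GSym.ι C.gr y = (-1 : k) ^ m • C.cobarTwice (x ⊗ₜ y) := by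
  refine C.cobr_ext hx (f := LinearMap.mulRight k (GSym.ι C.gr y) ∘ₗ C.cobarMul)
    (g := (-1 : k) ^ m • C.cobarMul₃ ∘ₗ (TensorProduct.mk k _ G).flip y)
    fun i j hij a ha b hb => ?_
  simp only [LinearMap.comp_apply, LinearMap.mulRight_apply, LinearMap.smul_apply,
    LinearMap.flip_apply, TensorProduct.mk_apply]
  rw [C.cobarMul_tmul_of_mem ha, C.cobarMul₃_tmul _ hb, smul_mul_assoc, smul_smul, ← pow_add,
    ← hij, show i + j + j = i + 2 * j by ring, pow_add, pow_mul]
  simp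

/-- Graded commutativity: the quadratic element has degree `n - 2` and `s⁻¹x` has degree `m - 1`, so
they commute up to `(-1)^(n(m+1))`. -/
theorem mul_cobarMul_cobr {m n : ℕ} {x y : G} (hx : x ∈ C.gr m) (hy : y ∈ C.gr n) :
    GSym.ι C.gr x * C.cobarMul (C.cobr y) =
      (-1 : k) ^ (n * (m + 1)) • (C.cobarMul (C.cobr y) * GSym.ι C.gr x) := by
  refine C.cobr_ext hy (f := LinearMap.mulLeft k (GSym.ι C.gr x) ∘ₗ C.cobarMul)
    (g := (-1 : k) ^ (n * (m + 1)) • LinearMap.mulRight k (GSym.ι C.gr x) ∘ₗ C.cobarMul)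
    fun i j hij a ha b hb => ?_
  simp only [LinearMap.comp_apply, LinearMap.mulRight_apply, LinearMap.smul_apply,
    LinearMap.mulLeft_apply]
  rw [C.cobarMul_tmul_of_mem ha, mul_smul_comm, smul_mul_assoc, ← mul_assoc, GSym.ι_mul_ι hx ha,
    smul_mul_assoc, mul_assoc, GSym.ι_mul_ι hx hb, mul_smul_comm, ← mul_assoc]
  simp only [smul_smul, ← pow_add]
  congr 1
  rw [← hij, show i + ((m + 1) * (i + 1) + (m + 1) * (j + 1)) =
    (i + j) * (m + 1) + i + 2 * (m + 1) by ring, pow_add, pow_mul _ 2]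
  simp

/-- In the Leibniz rule, the contributions of `d₀` and `d₂` to the second factor are moved to the
first by graded commutativity and so appear as the swap of `w`. The contribution of `d₁` is the
usual extension of `d` to the tensor square and needs no swap. When `w` is a cobracket, antisymmetry
turns `w - swap w` into `2w`, which cancels the `½` in the definition of `d₂`. -/
theorem cobarD_cobarMul (w : G ⊗[k] G) : C.cobarD (C.cobarMul w) =
    GSym.ι C.gr (TensorProduct.lid k G (C.h.rTensor G (w - koszulSwap C.gr C.internal w))) +
    C.cobarMul ((TensorProduct.map C.d LinearMap.id +
      TensorProduct.map (parity C.gr C.internal) C.d : G ⊗[k] G →ₗ[k] G ⊗[k] G) w) -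
    (2⁻¹ : k) • C.cobarTwice (w - koszulSwap C.gr C.internal w) := by
  set F : G ⊗[k] G →ₗ[k] G ⊗[k] G := LinearMap.id - koszulSwap C.gr C.internal
  set H : G ⊗[k] G →ₗ[k] G := TensorProduct.lid k G ∘ₗ C.h.rTensor G
  set δ : G ⊗[k] G →ₗ[k] G ⊗[k] G :=
    TensorProduct.map C.d LinearMap.id + TensorProduct.map (parity C.gr C.internal) C.d with hδ
  suffices h : C.cobarD ∘ₗ C.cobarMul = GSym.ι C.gr ∘ₗ H ∘ₗ F + C.cobarMul ∘ₗ δ -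
      (2⁻¹ : k) • C.cobarTwice ∘ₗ F from LinearMap.congr_fun h w
  refine graded_ext₂ C.iSup_gr fun m n x hx y hy => ?_
  have hF : F (x ⊗ₜ y) = x ⊗ₜ y - (-1 : k) ^ (m * n) • y ⊗ₜ x := by
    rw [← koszulSwap_tmul _ C.internal hx hy]; rfl
  have hH : ∀ a b, H (a ⊗ₜ b) = C.h a • b := fun a b => rfl
  -- The curvature is supported in the even degree `2`, so the sign of the swap disappears where it
  -- is nonzero.
  have hh : (-1 : k) ^ (m * n) * C.h y = C.h y := by
    by_cases hn : n = 2
    · rw [hn, pow_mul']; simp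
    · rw [C.h_mem n hn y hy, mul_zero]
  have hP : C.cobr (parity C.gr C.internal x) = (-1 : k) ^ m • C.cobr x := by
    rw [parity, gradeScale_of_mem _ _ _ hx, map_smul]
  simp only [LinearMap.comp_apply, LinearMap.sub_apply, LinearMap.add_apply, LinearMap.smul_apply,
    hF, map_sub, map_smul, hH]
  rw [cobarD_cobarMul_tmul, cobarGen_apply, cobarGen_apply, hP, h_parity, d_parity, sub_mul,
    sub_mul, mul_sub, mul_sub, map_smul, smul_mul_assoc, smul_mul_assoc, mul_smul_comm,
    C.cobarMul_cobr_mul hx, C.mul_cobarMul_cobr hx hy, C.cobarMul_cobr_mul hy, hδ,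
    LinearMap.add_apply, TensorProduct.map_tmul, TensorProduct.map_tmul, map_add, cobarMul_tmul,
    cobarMul_tmul, parity_parity, LinearMap.id_apply, smul_smul ((-1) ^ (m * n)), hh, map_neg,
    ← Algebra.smul_def, ← Algebra.commutes, ← Algebra.smul_def]
  have e1 : (-1 : k) ^ m * (-1) ^ m = 1 := by rw [← mul_pow]; simp
  have e2 : (-1 : k) ^ (n * (m + 1)) * (-1) ^ n = (-1) ^ (m * n) := by
    rw [← pow_add, show n * (m + 1) + n = m * n + 2 * n by ring, pow_add, pow_mul _ 2]
    simp
  rw [smul_smul ((-1) ^ m), e1, smul_smul ((-1) ^ (n * (m + 1))), e2, neg_mul]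
  module

/-- The differential is odd, so it anticommutes with the sign involution. This is what cancels the
cross terms when the Leibniz rule is applied twice. -/
theorem cobarSign_cobarD (s : C.LieCobar) : C.cobarSign (C.cobarD s) = -C.cobarD (C.cobarSign s) := by
  have hgen : ∀ x, C.cobarSign (C.cobarGen x) = -C.cobarD (C.cobarSign (GSym.ι C.gr x)) := by
    intro x
    refine LinearMap.congr_fun (f := C.cobarSign.toLinearMap ∘ₗ C.cobarGen)
      (g := -(C.cobarD ∘ₗ C.cobarSign.toLinearMap ∘ₗ GSym.ι C.gr))
      (graded_ext C.iSup_gr fun n x hx => ?_) x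
    simp only [LinearMap.comp_apply, LinearMap.neg_apply, AlgHom.toLinearMap_apply]
    rw [C.cobarSign_of_mem_deg (C.cobarGen_mem_deg hx), C.cobarSign_of_mem_deg (GSym.ι_mem_deg hx),
      map_smul, cobarD_ι, zpow_sub_one₀ (by simp)]
    simp
  induction s using GSym.induction with
  | one => rw [map_one C.cobarSign, cobarD_one, map_zero, neg_zero]
  | smul c a ha => simp only [map_smul, ha, smul_neg]
  | add a b ha hb => simp only [map_add, ha, hb, neg_add]
  | mul x a ha =>
    rw [cobarD_mul, map_add, map_mul, map_mul, map_mul, cobarD_mul, cobarD_ι, hgen, ha]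
    simp only [neg_mul, mul_neg, neg_add]

/-- The square is a derivation: in it the cross terms `σ(D s⁻¹x) · D a` and `D(σ s⁻¹x) · D a`
cancel, so it vanishes as soon as it does on generators. There each axiom accounts for one number of
factors: `h ∘ d = 0` for none, the curvature equation for one, the coderivation property for two,
co-Jacobi for three. -/
theorem cobarD_cobarD [CharZero k] : C.cobarD ∘ₗ C.cobarD = 0 := by
  have hgen : ∀ x, C.cobarD (C.cobarGen x) = 0 := by
    intro x
    have hs : koszulSwap C.gr C.internal (C.cobr x) = -C.cobr x :=
      LinearMap.congr_fun C.antisymm x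
    have hcod := LinearMap.congr_fun C.coderivation x
    have hsq := LinearMap.congr_fun C.d_sq x
    have hhd := LinearMap.congr_fun C.h_d x
    have h3 : C.cobarTwice (C.cobr x) = 0 := C.cobarMul₃_cobr x
    simp only [LinearMap.comp_apply, LinearEquiv.coe_coe, LinearMap.zero_apply] at hcod hsq hhd
    rw [cobarGen_apply, map_sub, map_sub, map_smul, cobarD_algebraMap, cobarD_ι, cobarGen_apply,
      cobarD_cobarMul, hs, ← hcod, hhd, sub_neg_eq_add, ← two_smul k (C.cobr x), map_smul, map_smul,
      map_smul, map_smul, ← hsq, h3, map_zero]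
    have h2 : (2⁻¹ : k) * 2 = 1 := inv_mul_cancel₀ two_ne_zero
    simp only [smul_add, smul_sub, smul_smul, h2, smul_zero, one_smul]
    abel
  refine LinearMap.ext fun s => ?_
  rw [LinearMap.comp_apply, LinearMap.zero_apply]
  induction s using GSym.induction with
  | one => rw [cobarD_one, map_zero]
  | smul c a ha => rw [map_smul, map_smul, ha, smul_zero]
  | add a b ha hb => rw [map_add, map_add, ha, hb, add_zero]
  | mul x a ha =>
    rw [cobarD_mul, map_add, cobarD_mul, cobarD_mul, ha, mul_zero, add_zero, cobarD_ι, hgen,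
      zero_mul, zero_add, ← add_mul, ← cobarD_ι, cobarSign_cobarD, neg_add_cancel, zero_mul]

theorem isComplex [CharZero k] : IsComplex (GSym.deg C.gr) C.cobarD where
  d_mem _ _ hs := C.cobarD_mem_deg hs
  d_sq := C.cobarD_cobarD

end CurvedDGLieCoalgebra

/-! ### The weight grading of the graded symmetric algebra -/

section GSymWeight

variable {k : Type*} [Field k] {G : Type*} [AddCommGroup G] [Module k G]
  {gr : ℕ → Submodule k G}

namespace GSym

variable (gr) in
/-- The weight-`n` part of the graded symmetric algebra: the span of the products
`s⁻¹x₁ ⋯ s⁻¹xᵣ` of homogeneous generators with `∑ |xᵢ| = n`. -/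
def weight (n : ℕ) : Submodule k (GSym gr) :=
  Submodule.span k {s | ∃ l, IsHomog gr l ∧ listWeight l = n ∧ s = mono gr l}

theorem mono_mem_weight {l : List (ℕ × G)} (hl : IsHomog gr l) :
    mono gr l ∈ weight gr (listWeight l) :=
  Submodule.subset_span ⟨l, hl, rfl, rfl⟩

theorem weight_le {n : ℕ} {S : Submodule k (GSym gr)}
    (h : ∀ l, IsHomog gr l → listWeight l = n → mono gr l ∈ S) : weight gr n ≤ S := by
  rw [weight, Submodule.span_le]
  rintro _ ⟨l, hl, hp, rfl⟩
  exact h l hl hp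

theorem ι_mem_weight {n : ℕ} {x : G} (hx : x ∈ gr n) : ι gr x ∈ weight gr n := by
  have h := mono_mem_weight (gr := gr) (l := [(n, x)]) (by simpa [IsHomog] using hx)
  simpa [mono, listWeight] using h

theorem algebraMap_mem_weight (c : k) : algebraMap k (GSym gr) c ∈ weight gr 0 := by
  rw [Algebra.algebraMap_eq_smul_one]
  exact Submodule.smul_mem _ _ (mono_mem_weight (l := []) (by simp [IsHomog]))

theorem mul_mem_weight {m n : ℕ} {s t : GSym gr} (hs : s ∈ weight gr m) (ht : t ∈ weight gr n) :
    s * t ∈ weight gr (m + n) := by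
  have h : weight gr m * weight gr n ≤ weight gr (m + n) := by
    rw [weight, weight, Submodule.span_mul_span, Submodule.span_le]
    rintro _ ⟨_, ⟨l, hl, hp, rfl⟩, _, ⟨l', hl', hq, rfl⟩, rfl⟩
    refine Submodule.subset_span ⟨l ++ l', ?_, ?_, (mono_append l l').symm⟩
    · intro a ha
      rcases List.mem_append.mp ha with ha | ha
      exacts [hl a ha, hl' a ha]
    · rw [← hp, ← hq]
      simp [listWeight]
  exact h (Submodule.mul_mem_mul hs ht)

theorem mono_induction (htop : ⨆ n, gr n = ⊤) {P : GSym gr → Prop} (mono : ∀ l, IsHomog gr l → P (mono gr l))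
    (smul : ∀ (c : k) a, P a → P (c • a)) (add : ∀ a b, P a → P b → P (a + b)) (s : GSym gr) :
    P s := by
  have hs : s ∈ Submodule.span k {s | ∃ l, IsHomog gr l ∧ s = GSym.mono gr l} :=
    span_mono htop ▸ Submodule.mem_top
  induction hs using Submodule.span_induction with
  | mem s hs => obtain ⟨l, hl, rfl⟩ := hs; exact mono l hl
  | zero => simpa using smul 0 _ (mono [] (by simp [IsHomog]))
  | add a b _ _ ha hb => exact add a b ha hb
  | smul c a _ ha => exact smul c a ha

section Proj

variable (hgr : DirectSum.IsInternal gr)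

/-- The map `s ↦ ∑ sₙ tⁿ` that collects the components `sₙ` of weight `n` of `s`, on
generators. -/
def weightGen : G →ₗ[k] Polynomial (GSym gr) :=
  (DirectSum.toModule k ℕ _ fun n =>
    (Polynomial.monomial n).restrictScalars k ∘ₗ GSym.ι gr ∘ₗ (gr n).subtype) ∘ₗ
    ((LinearEquiv.ofBijective (DirectSum.coeLinearMap gr) hgr).symm :
      G →ₗ[k] DirectSum ℕ fun n => gr n)

theorem weightGen_of_mem {n : ℕ} {x : G} (hx : x ∈ gr n) :
    weightGen hgr x = Polynomial.monomial n (ι gr x) := by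
  have h : (LinearEquiv.ofBijective (DirectSum.coeLinearMap gr) hgr).symm x
      = DirectSum.lof k ℕ (fun n => gr n) n ⟨x, hx⟩ := by
    rw [LinearEquiv.symm_apply_eq]
    exact (DirectSum.coeLinearMap_lof gr n ⟨x, hx⟩).symm
  simp only [weightGen, LinearMap.comp_apply, LinearEquiv.coe_coe, h]
  rw [DirectSum.toModule_lof]
  rfl

/-- The map `s ↦ ∑ sₙ tⁿ` that collects the components `sₙ` of weight `n` of `s`. -/
def weightPoly : GSym gr →ₐ[k] Polynomial (GSym gr) :=
  GSym.lift (weightGen hgr) (by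
    intro m n x hx y hy
    rw [weightGen_of_mem hgr hx, weightGen_of_mem hgr hy, Polynomial.monomial_mul_monomial,
      Polynomial.monomial_mul_monomial, ι_mul_ι hx hy, Polynomial.smul_monomial, add_comm m n])

theorem weightPoly_mono {l : List (ℕ × G)} (hl : IsHomog gr l) :
    weightPoly hgr (mono gr l) = Polynomial.monomial (listWeight l) (mono gr l) := by
  induction l with
  | nil => rw [mono_nil, map_one]; rfl
  | cons a l ih =>
    obtain ⟨ha, hl⟩ := isHomog_cons.mp hl
    rw [mono_cons, map_mul, ih hl, weightPoly, GSym.lift_ι, weightGen_of_mem hgr ha,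
      Polynomial.monomial_mul_monomial, listWeight_cons]

/-- The projection onto weight `n`. -/
def weightProj (n : ℕ) : GSym gr →ₗ[k] GSym gr :=
  (Polynomial.lcoeff (GSym gr) n).restrictScalars k ∘ₗ (weightPoly hgr).toLinearMap

theorem weightProj_mono {l : List (ℕ × G)} (hl : IsHomog gr l) (n : ℕ) :
    weightProj hgr n (mono gr l) = if listWeight l = n then mono gr l else 0 := by
  change (weightPoly hgr (mono gr l)).coeff n = _
  rw [weightPoly_mono hgr hl, Polynomial.coeff_monomial]

/-- `weightPoly` is an algebra morphism to polynomials, so this is the formula for the coefficients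
of a product. -/
theorem weightProj_mul (n : ℕ) (s t : GSym gr) : weightProj hgr n (s * t) =
    ∑ p ∈ Finset.HasAntidiagonal.antidiagonal n, weightProj hgr p.1 s * weightProj hgr p.2 t := by
  change (weightPoly hgr (s * t)).coeff n = _
  rw [map_mul, Polynomial.coeff_mul]
  rfl

theorem weightProj_of_mem {m : ℕ} {s : GSym gr} (hs : s ∈ weight gr m) (n : ℕ) :
    weightProj hgr n s = if m = n then s else 0 := by
  have h : weight gr m ≤
      LinearMap.eqLocus (weightProj hgr n) (if m = n then LinearMap.id else 0) := by
    refine weight_le fun l hl hm => ?_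
    rw [LinearMap.mem_eqLocus, weightProj_mono hgr hl, hm]
    split_ifs <;> rfl
  rw [h hs]
  split_ifs <;> rfl

theorem weightProj_mem (n : ℕ) (s : GSym gr) : weightProj hgr n s ∈ weight gr n := by
  induction s using mono_induction hgr.submodule_iSup_eq_top with
  | mono l hl =>
    rw [weightProj_mono hgr hl]
    split_ifs with h
    · exact h ▸ mono_mem_weight hl
    · exact zero_mem _
  | smul c a ha => rw [map_smul]; exact Submodule.smul_mem _ _ ha
  | add a b ha hb => rw [map_add]; exact add_mem ha hb

theorem weightProj_mem_deg (n : ℕ) {p : ℤ} {s : GSym gr} (hs : s ∈ deg gr p) :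
    weightProj hgr n s ∈ deg gr p := by
  suffices h : deg gr p ≤ (deg gr p).comap (weightProj hgr n) from h hs
  refine deg_le fun l hl hp => ?_
  rw [Submodule.mem_comap, weightProj_mono hgr hl]
  split_ifs
  · exact hp ▸ mono_mem_deg hl
  · exact zero_mem _

/-- An element has finitely many nonzero components. Allowing every larger bound `M` lets the bounds
of two summands be merged by a maximum. -/
theorem exists_sum_weightProj (s : GSym gr) :
    ∃ N, ∀ M ≥ N, s = ∑ n ∈ Finset.range M, weightProj hgr n s := by
  induction s using mono_induction hgr.submodule_iSup_eq_top with
  | mono l hl =>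
    refine ⟨listWeight l + 1, fun M hM => ?_⟩
    simp only [weightProj_mono hgr hl]
    rw [Finset.sum_ite_eq, if_pos (Finset.mem_range.mpr (by omega))]
  | smul c a ha =>
    obtain ⟨N, h⟩ := ha
    refine ⟨N, fun M hM => ?_⟩
    simp only [map_smul]
    rw [← Finset.smul_sum, ← h M hM]
  | add a b ha hb =>
    obtain ⟨N, h⟩ := ha
    obtain ⟨N', h'⟩ := hb
    refine ⟨max N N', fun M hM => ?_⟩
    simp only [map_add]
    rw [Finset.sum_add_distrib, ← h M (le_of_max_le_left hM), ← h' M (le_of_max_le_right hM)]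

/-- The elements whose components all have weight less than `n`. -/
def weightLT (n : ℕ) : Submodule k (GSym gr) :=
  ⨅ (m : ℕ) (_ : n ≤ m), LinearMap.ker (weightProj hgr m)

theorem mem_weightLT {n : ℕ} {s : GSym gr} :
    s ∈ weightLT hgr n ↔ ∀ m, n ≤ m → weightProj hgr m s = 0 := by
  simp [weightLT]

theorem weightLT_mono {m n : ℕ} (h : m ≤ n) : weightLT hgr m ≤ weightLT hgr n := by
  intro s hs
  rw [mem_weightLT] at hs ⊢
  exact fun i hi => hs i (h.trans hi)

theorem weight_le_weightLT {m n : ℕ} (h : m < n) : weight gr m ≤ weightLT hgr n := by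
  intro s hs
  rw [mem_weightLT]
  intro i hi
  rw [weightProj_of_mem hgr hs, if_neg (by omega)]

/-- If all weights of `s` are below `m` and all weights of `t` are at most `n`, their sums are below
`m + n`; strictness in one factor is enough. This is the shape of each term of a Leibniz rule, where
the differential lowers the weight of one factor and leaves the other alone. The primed version has
the roles exchanged. -/
theorem mul_mem_weightLT {m n : ℕ} {s t : GSym gr} (hs : s ∈ weightLT hgr m)
    (ht : t ∈ weightLT hgr (n + 1)) : s * t ∈ weightLT hgr (m + n) := by
  rw [mem_weightLT] at hs ht ⊢
  intro i hi
  rw [weightProj_mul]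
  refine Finset.sum_eq_zero fun p hp => ?_
  rw [Finset.HasAntidiagonal.mem_antidiagonal] at hp
  by_cases h : m ≤ p.1
  · rw [hs _ h, zero_mul]
  · rw [ht _ (by omega), mul_zero]

theorem mul_mem_weightLT' {m n : ℕ} {s t : GSym gr} (hs : s ∈ weightLT hgr (m + 1))
    (ht : t ∈ weightLT hgr n) : s * t ∈ weightLT hgr (m + n) := by
  rw [mem_weightLT] at hs ht ⊢
  intro i hi
  rw [weightProj_mul]
  refine Finset.sum_eq_zero fun p hp => ?_
  rw [Finset.HasAntidiagonal.mem_antidiagonal] at hp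
  by_cases h : n ≤ p.2
  · rw [ht _ h, mul_zero]
  · rw [hs _ (by omega), zero_mul]

theorem eq_sum_weightProj {N : ℕ} {s : GSym gr} (hs : s ∈ weightLT hgr N) :
    s = ∑ n ∈ Finset.range N, weightProj hgr n s := by
  rw [mem_weightLT] at hs
  obtain ⟨M, hM⟩ := exists_sum_weightProj hgr s
  refine (hM (max M N) (le_max_left _ _)).trans (Finset.sum_subset
    (Finset.range_mono (le_max_right _ _)) fun i _ hi => hs i ?_).symm
  simpa using hi

theorem exists_mem_weightLT (s : GSym gr) : ∃ N, s ∈ weightLT hgr N := by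
  obtain ⟨N, h⟩ := exists_sum_weightProj hgr s
  refine ⟨N, ?_⟩
  rw [h N le_rfl]
  exact sum_mem fun i hi => weight_le_weightLT hgr (Finset.mem_range.mp hi)
    (weightProj_mem hgr i s)

end Proj

end GSym

end GSymWeight

/-! ### The weight filtration of the cobar complex and its leading term -/

section CobarWeight

variable {k : Type*} [Field k] {G : Type*} [AddCommGroup G] [Module k G]

open GSym

namespace CurvedDGLieCoalgebra

variable (C : CurvedDGLieCoalgebra k G)

/-- The component `d₂` of the differential: the differential of the Lie cobar construction of the
underlying graded Lie coalgebra. -/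
def cobarQuad : C.LieCobar →ₗ[k] C.LieCobar := C.toGradedLieCoalgebra.toCurved.cobarD

theorem cobarQuad_one : C.cobarQuad 1 = 0 := C.toGradedLieCoalgebra.toCurved.cobarD_one

theorem cobarQuad_ι_mul {n : ℕ} {x : G} (hx : x ∈ C.gr n) (s : C.LieCobar) :
    C.cobarQuad (ι C.gr x * s) = -((2⁻¹ : k) • C.cobarMul (C.cobr x)) * s +
      (-1 : k) ^ (n + 1) • (ι C.gr x * C.cobarQuad s) := by
  set C' := C.toGradedLieCoalgebra.toCurved with hC'
  have hx' : x ∈ C'.gr n := hx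
  -- `C` and its version with `d = 0` and `h = 0` have definitionally the same graded algebra. The
  -- formula is proved for the latter, where only `d₂` survives, and then read in the former.
  have h (s : C'.LieCobar) : C'.cobarD (ι C'.gr x * s) =
      -((2⁻¹ : k) • C'.cobarMul (C'.cobr x)) * s +
        (-1 : k) ^ (n + 1) • (ι C'.gr x * C'.cobarD s) := by
    have h0 : C'.h x = 0 := rfl
    have h1 : C'.d x = 0 := rfl
    rw [cobarD_mul, cobarD_ι, cobarSign_ι _ hx', cobarGen_apply, h0, h1, map_zero, map_zero,
      sub_zero, zero_sub, smul_mul_assoc]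
  exact h s

/-- The sum `d₀ + d₁` of the components of the differential that lower the weight. -/
def cobarLower : C.LieCobar →ₗ[k] C.LieCobar := C.cobarD - C.cobarQuad

theorem cobarD_eq (s : C.LieCobar) : C.cobarD s = C.cobarQuad s + C.cobarLower s := by
  rw [cobarLower, LinearMap.sub_apply, add_sub_cancel]

/-- Both differentials obey the Leibniz rule with the same signs, so their difference does too; on
generators the quadratic terms cancel. -/
theorem cobarLower_ι_mul {n : ℕ} {x : G} (hx : x ∈ C.gr n) (s : C.LieCobar) :
    C.cobarLower (ι C.gr x * s) = (algebraMap k _ (C.h x) - ι C.gr (C.d x)) * s +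
      (-1 : k) ^ (n + 1) • (ι C.gr x * C.cobarLower s) := by
  rw [cobarLower, LinearMap.sub_apply, LinearMap.sub_apply, C.cobarQuad_ι_mul hx, C.cobarD_mul,
    C.cobarD_ι, C.cobarSign_ι hx, cobarGen_apply, mul_sub, smul_sub, smul_mul_assoc, sub_mul]
  rw [neg_mul]
  abel

/-- The cobracket preserves total degree in the coalgebra, and the weight of a monomial is the total
coalgebra degree of its letters. Hence `d₂` changes the number of factors but not the weight. -/
theorem cobarQuad_mem_weight {n : ℕ} {s : C.LieCobar} (hs : s ∈ weight C.gr n) :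
    C.cobarQuad s ∈ weight C.gr n := by
  suffices h : weight C.gr n ≤ (weight C.gr n).comap C.cobarQuad from h hs
  refine weight_le fun l hl hp => ?_
  subst hp
  clear hs
  rw [Submodule.mem_comap]
  induction l with
  | nil => rw [mono_nil, cobarQuad_one]; exact zero_mem _
  | cons a l ih =>
    obtain ⟨ha, hl⟩ := isHomog_cons.mp hl
    have h := C.cobarMul_cobr_mem ha (weight C.gr a.1) fun i j hij y hy z hz =>
        hij ▸ mul_mem_weight (ι_mem_weight hy) (ι_mem_weight hz)
    rw [mono_cons, C.cobarQuad_ι_mul ha, listWeight_cons]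
    exact add_mem (mul_mem_weight (neg_mem (Submodule.smul_mem _ _ h)) (mono_mem_weight hl))
      (Submodule.smul_mem _ _ (mul_mem_weight (ι_mem_weight ha) (ih hl)))

theorem weightProj_cobarQuad (n : ℕ) (s : C.LieCobar) :
    weightProj C.internal n (C.cobarQuad s) = C.cobarQuad (weightProj C.internal n s) := by
  induction s using mono_induction C.iSup_gr with
  | mono l hl =>
    have h := mono_mem_weight hl
    rw [weightProj_of_mem C.internal h, weightProj_of_mem C.internal (C.cobarQuad_mem_weight h)]
    split_ifs
    · rfl
    · rw [map_zero]
  | smul c a ha => simp only [map_smul, ha]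
  | add a b ha hb => simp only [map_add, ha, hb]

/-- On a generator, `d₀` trades weight `2` for a scalar of weight `0`, and `d₁` lowers the weight by
one. By the Leibniz rule the strict drop passes to products. -/
theorem cobarLower_mem {n : ℕ} {s : C.LieCobar} (hs : s ∈ weight C.gr n) :
    C.cobarLower s ∈ weightLT C.internal n := by
  suffices h : weight C.gr n ≤ (weightLT C.internal n).comap C.cobarLower from h hs
  refine weight_le fun l hl hp => ?_
  subst hp
  clear hs
  rw [Submodule.mem_comap]
  induction l with
  | nil =>
    rw [mono_nil, cobarLower, LinearMap.sub_apply, cobarD_one, cobarQuad_one, sub_zero]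
    exact zero_mem _
  | cons a l ih =>
    obtain ⟨ha, hl⟩ := isHomog_cons.mp hl
    rw [mono_cons, C.cobarLower_ι_mul ha, listWeight_cons]
    refine add_mem (mul_mem_weightLT _ (sub_mem ?_ ?_)
      (weight_le_weightLT _ (Nat.lt_succ_self _) (mono_mem_weight hl)))
      (Submodule.smul_mem _ _ (mul_mem_weightLT' _
        (weight_le_weightLT _ (Nat.lt_succ_self _) (ι_mem_weight ha)) (ih hl)))
    · by_cases h2 : a.1 = 2
      · exact weight_le_weightLT _ (by omega) (algebraMap_mem_weight _)
      · rw [C.h_mem _ h2 _ ha, map_zero]; exact zero_mem _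
    · generalize a.1 = n at ha
      cases n with
      | zero => rw [C.d_zero _ ha, map_zero]; exact zero_mem _
      | succ n =>
        exact weight_le_weightLT _ (Nat.lt_succ_self _) (ι_mem_weight (C.d_mem n _ ha))

/-- All components have weight at most `n`, and each of them drops strictly. Thus the lower part of
the differential does not touch the leading weight. -/
theorem cobarLower_mem_of_weightLT {n : ℕ} {s : C.LieCobar}
    (hs : s ∈ weightLT C.internal (n + 1)) : C.cobarLower s ∈ weightLT C.internal n := by
  rw [eq_sum_weightProj _ hs, map_sum]
  exact sum_mem fun i hi => weightLT_mono _ (Nat.lt_succ_iff.mp (Finset.mem_range.mp hi))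
    (C.cobarLower_mem (weightProj_mem _ i s))

/-- If `d₂` is exact in degree `p`, then so is `d₀ + d₁ + d₂`. -/
theorem mem_map_cobarD [CharZero k] {p : ℤ}
    (hp : ∀ s ∈ deg C.gr p, C.cobarQuad s = 0 →
      ∃ t ∈ deg C.gr (p + 1), C.cobarQuad t = s)
    {s : C.LieCobar} (hs : s ∈ deg C.gr p) (hds : C.cobarD s = 0) :
    s ∈ (deg C.gr (p + 1)).map C.cobarD := by
  -- Induction on a strict bound for the weights of the cycle; the bound `0` forces the cycle to
  -- vanish.
  obtain ⟨N, hN⟩ := exists_mem_weightLT C.internal s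
  induction N generalizing s with
  | zero =>
    have h := eq_sum_weightProj _ hN
    rw [Finset.range_zero, Finset.sum_empty] at h
    rw [h]
    exact zero_mem _
  | succ N ih =>
    set u := weightProj C.internal N s with hu
    have hlow : C.cobarQuad s = -C.cobarLower s := by
      rw [eq_neg_iff_add_eq_zero, ← cobarD_eq, hds]
    -- The leading component of a cycle is a `d₂`-cycle: in weight `N` the equation `D s = 0` has no
    -- contribution from `d₀ + d₁`.
    have hdu : C.cobarQuad u = 0 := by
      rw [hu, ← weightProj_cobarQuad, hlow]
      exact (mem_weightLT _).mp (neg_mem (C.cobarLower_mem_of_weightLT hN)) N le_rfl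
    obtain ⟨t, ht, htu⟩ := hp u (weightProj_mem_deg _ _ hs) hdu
    -- The primitive `t` may have components in several weights. As `d₂` commutes with the
    -- projections, its component of weight `N` is a primitive as well, and this choice ensures that
    -- `(d₀ + d₁) v` lies strictly below weight `N`.
    set v := weightProj C.internal N t with hv
    have hvd : v ∈ deg C.gr (p + 1) := weightProj_mem_deg _ _ ht
    have hdv : C.cobarQuad v = u := by
      rw [hv, ← weightProj_cobarQuad, htu, weightProj_of_mem _ (weightProj_mem _ N s), if_pos rfl]
    have hdeg : C.cobarD v ∈ deg C.gr p := by
      have h := C.cobarD_mem_deg hvd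
      rwa [add_sub_cancel_right] at h
    -- Subtracting `D v = u + (d₀ + d₁) v` removes the leading component of `s` and introduces only
    -- terms of weight below `N`.
    have key : s - C.cobarD v ∈ weightLT C.internal N := by
      rw [cobarD_eq, hdv, ← sub_sub]
      refine sub_mem ?_ (C.cobarLower_mem (weightProj_mem _ N t))
      rw [mem_weightLT] at hN ⊢
      intro m hm
      rw [map_sub, weightProj_of_mem _ (weightProj_mem _ N s) m]
      split_ifs with h
      · rw [h, sub_self]
      · rw [hN m (by omega), sub_zero]
    have hcyc : C.cobarD (s - C.cobarD v) = 0 := by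
      rw [map_sub, hds, zero_sub, neg_eq_zero]
      exact LinearMap.congr_fun C.cobarD_cobarD v
    have h := add_mem (ih (sub_mem hs hdeg) hcyc key) ⟨v, hvd, rfl⟩
    rwa [sub_add_cancel] at h

end CurvedDGLieCoalgebra

end CobarWeight

/-! ### The universal property of the symmetric algebra for commuting values -/

section SymLift

variable {k : Type*} [Field k] {V : Type*} [AddCommGroup V] [Module k V] {B : Type*} [Ring B]
  [Algebra k B]

open scoped IsMulCommutative in
/-- A linear map with commuting values, into an algebra that need not be commutative, extends to
the symmetric algebra. -/
theorem exists_symLift (f : V →ₗ[k] B) (hf : ∀ v w, f v * f w = f w * f v) :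
    ∃ F : SymmetricAlgebra k V →ₐ[k] B, ∀ v, F (SymmetricAlgebra.ι k V v) = f v := by
  have hc : ∀ x ∈ Set.range f, ∀ y ∈ Set.range f, x * y = y * x := by
    rintro _ ⟨v, rfl⟩ _ ⟨w, rfl⟩
    exact hf v w
  -- The subalgebra generated by pairwise commuting elements is commutative, so the usual universal
  -- property applies with this subalgebra as target.
  have := Algebra.isMulCommutative_adjoin k hc
  let g : V →ₗ[k] Algebra.adjoin k (Set.range f) :=
    { toFun := fun v => ⟨f v, Algebra.subset_adjoin ⟨v, rfl⟩⟩
      map_add' := fun v w => Subtype.ext (map_add f v w)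
      map_smul' := fun c v => Subtype.ext (map_smul f c v) }
  refine ⟨(Algebra.adjoin k (Set.range f)).val.comp (SymmetricAlgebra.lift g), fun v => ?_⟩
  rw [AlgHom.comp_apply, SymmetricAlgebra.lift_ι_apply]
  rfl

end SymLift

/-! ### The cofree Lie coalgebra in weights one and two -/

section LowWeightLift

variable {k : Type*} [Field k] {V : Type*} [AddCommGroup V] [Module k V]

/-- Weight one is spanned by the classes of single letters, from which `lprOne` recovers the letter.
-/
theorem lword_single_lprOne {x : CofreeLie k V} (hx : x ∈ lieGr k V 1) :
    lword k [lprOne x] = x := by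
  -- As a function of its letter, the class of a one-letter word is linear, which handles sums and
  -- multiples.
  have e : ∀ v : V, lword k [v] = ((shuffleSub k V).mkQ ∘ₗ TensorAlgebra.ι k) v := by
    intro v
    rw [lword, word_cons, word_nil, mul_one]
    rfl
  induction hx using Submodule.span_induction with
  | mem y hy =>
    obtain ⟨l, hl, rfl⟩ := hy
    obtain ⟨a, rfl⟩ := List.length_eq_one_iff.mp hl
    rw [lprOne_lword]
  | zero => rw [e]; simp
  | add a b _ _ ha hb => rw [e] at *; rw [map_add, map_add, ha, hb]
  | smul c a _ ha => rw [e] at *; rw [map_smul, map_smul, ha]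

theorem lieCobr_single (v : V) : lieCobr (lword k [v]) = 0 := by
  rw [lieCobr_lword, splitSum_cons, splitSum_nil, lword_nil]
  simp

theorem exists_lprTwo_eq {r : SymmetricAlgebra k V} (hr : r ∈ symWeight k V 2) :
    ∃ x ∈ lieGr k V 2, lprTwo x = r := by
  refine symWeight_two_induction (P := fun r => ∃ x ∈ lieGr k V 2, lprTwo x = r)
    (fun v w => ⟨lword k [v, w], lword_mem [v, w], lprTwo_lword _⟩) ?_ hr
  rintro _ _ ⟨x, hx, rfl⟩ ⟨y, hy, rfl⟩
  exact ⟨x + y, add_mem hx hy, map_add _ _ _⟩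

/-- Letters have degree `1`, so the part of the cobracket of `ab` with one letter on each side is `a
⊗ b + b ⊗ a`, and its product in the commutative algebra `Sym V` is `2ab`. Words of any other length
have no term with a single letter on both sides. The factor `2` is the one that the `½` in `d₂`
absorbs. -/
theorem mul_lprOne_lieCobr (x : CofreeLie k V) :
    LinearMap.mul' k (SymmetricAlgebra k V)
      (TensorProduct.map (SymmetricAlgebra.ι k V ∘ₗ lprOne) (SymmetricAlgebra.ι k V ∘ₗ lprOne)
        (lieCobr x)) = (2 : k) • lprTwo x := by
  suffices h : LinearMap.mul' k (SymmetricAlgebra k V) ∘ₗ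
      TensorProduct.map (SymmetricAlgebra.ι k V ∘ₗ lprOne) (SymmetricAlgebra.ι k V ∘ₗ lprOne) ∘ₗ
        lieCobr = (2 : k) • lprTwo from LinearMap.congr_fun h x
  refine lword_ext fun l => ?_
  rw [LinearMap.comp_apply, LinearMap.comp_apply, LinearMap.smul_apply, lieCobr_lword]
  by_cases hl : l.length = 2
  · obtain ⟨a, b, rfl⟩ := List.length_eq_two.mp hl
    simp only [splitSum_cons, splitSum_nil, map_add, map_sub, map_smul, TensorProduct.map_tmul,
      lprTwo_lword, lprOne_lword, LinearMap.comp_apply, LinearMap.mul'_apply, map_zero, zero_mul,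
      mul_zero, List.length_cons, List.length_nil]
    rw [mul_comm (SymmetricAlgebra.ι k V b)]
    module
  · rw [lprTwo_of_mem hl (lword_mem l), smul_zero, splitSum_linear, splitSum_linear,
      ← splitSum_zero l]
    have aux : ∀ p q : List V, p.length + q.length = l.length →
        SymmetricAlgebra.ι k V (lprOne (lword k p)) *
          SymmetricAlgebra.ι k V (lprOne (lword k q)) = 0 := by
      intro p q h
      by_cases hp : p.length = 1
      · rw [lprOne_of_mem (by omega) (lword_mem q), map_zero, mul_zero]
      · rw [lprOne_of_mem hp (lword_mem p), map_zero, zero_mul]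
    refine splitSum_congr _ fun p q h => ?_
    simp only [map_sub, map_smul, TensorProduct.map_tmul, LinearMap.comp_apply,
      LinearMap.mul'_apply]
    rw [aux p q h, aux q p (by omega), smul_zero, sub_zero]

end LowWeightLift

/-! ### Low weights of the Koszul dual and degree zero of its cobar construction -/

namespace CommQLC

variable {k : Type*} [Field k] {V : Type*} [AddCommGroup V] [Module k V] (Q : CommQLC k V)

/-- The part of weight at most two of `(qA)^¡` is `sV ⊕ s²qR`. -/
theorem lowWeight_admissible :
    Q.IsAdmissible (lieGr k V 1 ⊔ lieGr k V 2 ⊓ Q.qR.comap lprTwo) where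
  graded := sup_le
    (fun _ hx => Submodule.mem_iSup_of_mem 1 ⟨Submodule.mem_sup_left hx, hx⟩)
    (fun _ hx => Submodule.mem_iSup_of_mem 2 ⟨Submodule.mem_sup_right hx, hx.1⟩)
  cobr_mem := by
    set S := lieGr k V 1 ⊔ lieGr k V 2 ⊓ Q.qR.comap lprTwo with hS
    suffices h : S ≤ (tensorSub S S).comap lieCobr from h
    refine sup_le (fun x hx => ?_) (fun x hx => ?_)
    · rw [Submodule.mem_comap, ← lword_single_lprOne hx, lieCobr_single]
      exact zero_mem _
    · have h : (⨆ (i : ℕ) (j : ℕ) (_ : i + j = 2), tensorSub (lieGr k V i) (lieGr k V j)) ≤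
          tensorSub S S := by
        refine iSup_le fun i => iSup_le fun j => iSup_le fun hij => ?_
        rintro _ ⟨w, rfl⟩
        induction w using TensorProduct.induction_on with
        | zero => simp
        | add u v hu hv => rw [map_add]; exact add_mem hu hv
        | tmul y z =>
          rw [TensorProduct.map_tmul, Submodule.subtype_apply, Submodule.subtype_apply]
          obtain ⟨y, hy⟩ := y
          obtain ⟨z, hz⟩ := z
          -- Weight `0` is zero, so the cobracket of a weight-two element lies in `sV ⊗ sV`, which
          -- is contained in `S ⊗ S` without any condition on relations.
          have hcases : i = 0 ∨ j = 0 ∨ (i = 1 ∧ j = 1) := by omega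
          rcases hcases with rfl | rfl | ⟨rfl, rfl⟩
          · rw [lieGr_zero, Submodule.mem_bot] at hy
            simp only [hy, TensorProduct.zero_tmul]; exact zero_mem _
          · rw [lieGr_zero, Submodule.mem_bot] at hz
            simp only [hz, TensorProduct.tmul_zero]; exact zero_mem _
          · exact ⟨⟨y, Submodule.mem_sup_left hy⟩ ⊗ₜ ⟨z, Submodule.mem_sup_left hz⟩, rfl⟩
      exact h (lieCobr_mem 2 x hx.1)
  lprTwo_mem := by
    suffices h : lieGr k V 1 ⊔ lieGr k V 2 ⊓ Q.qR.comap lprTwo ≤ Q.qR.comap lprTwo from h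
    refine sup_le (fun x hx => ?_) inf_le_right
    rw [Submodule.mem_comap, lprTwo_of_mem (by omega) hx]
    exact zero_mem _

theorem lword_single_mem_dual (v : V) : lword k [v] ∈ Q.dual :=
  Q.le_dual Q.lowWeight_admissible (Submodule.mem_sup_left (lword_mem [v]))

/-- By maximality the Koszul dual contains every weight-two element over `qR`. This provides, for
each relation of `A`, a generator of degree one in the cobar construction to bound it. -/
theorem exists_dual_lprTwo_eq (r : Q.qR) :
    ∃ x : Q.dual, x ∈ Q.dualLie.gr 2 ∧ lprTwo (x : CofreeLie k V) = r := by
  obtain ⟨x, hx, h⟩ := exists_lprTwo_eq (Q.qR_le r.2)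
  refine ⟨⟨x, Q.le_dual Q.lowWeight_admissible (Submodule.mem_sup_right ⟨hx, ?_⟩)⟩, hx, h⟩
  exact (congrArg (· ∈ Q.qR) h).mpr r.2

/-- The empty word is zero in the reduced coalgebra. So the cobar construction has no generators of
degree `-1`, and hence is zero in negative degrees. -/
theorem dualLie_gr_zero : Q.dualLie.gr 0 = ⊥ := by
  refine (Submodule.eq_bot_iff _).mpr fun x hx => Subtype.ext ?_
  have h : (x : CofreeLie k V) ∈ lieGr k V 0 := hx
  rwa [lieGr_zero, Submodule.mem_bot] at h

/-- The inclusion of `sV` as the part of weight one of `(qA)^¡`. -/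
def dualOne : V →ₗ[k] Q.dual :=
  LinearMap.codRestrict Q.dual ((shuffleSub k V).mkQ ∘ₗ TensorAlgebra.ι k) fun v => by
    have h := Q.lword_single_mem_dual v
    rwa [lword, word_cons, word_nil, mul_one] at h

theorem dualOne_coe (v : V) : (Q.dualOne v : CofreeLie k V) = lword k [v] := by
  rw [lword, word_cons, word_nil, mul_one]
  rfl

theorem dualOne_mem (v : V) : Q.dualOne v ∈ Q.dualLie.gr 1 := by
  have h : (Q.dualOne v : CofreeLie k V) ∈ lieGr k V 1 := Q.dualOne_coe v ▸ lword_mem [v]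
  exact h

theorem dualOne_lprOne {x : Q.dual} (hx : x ∈ Q.dualLie.gr 1) :
    Q.dualOne (lprOne (x : CofreeLie k V)) = x :=
  Subtype.ext ((Q.dualOne_coe _).trans (lword_single_lprOne hx))

/-- Generators of weight one have degree `0` in the cobar construction, hence commute without sign:
the exponent is `(1 + 1)(1 + 1)`. -/
theorem exists_symIncl : ∃ F : SymmetricAlgebra k V →ₐ[k] GSym Q.dualLie.gr,
    ∀ v, F (SymmetricAlgebra.ι k V v) = GSym.ι Q.dualLie.gr (Q.dualOne v) :=
  exists_symLift (GSym.ι Q.dualLie.gr ∘ₗ Q.dualOne) fun v w => by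
    have h := GSym.ι_mul_ι (Q.dualOne_mem v) (Q.dualOne_mem w)
    rwa [Even.neg_one_pow (by decide), one_smul] at h

/-- The inclusion of `Sym V` into the Lie cobar construction of `(qA)^¡`. -/
def symIncl : SymmetricAlgebra k V →ₐ[k] GSym Q.dualLie.gr := Q.exists_symIncl.choose

theorem symIncl_ι (v : V) : Q.symIncl (SymmetricAlgebra.ι k V v) =
    GSym.ι Q.dualLie.gr (Q.dualOne v) := Q.exists_symIncl.choose_spec v

theorem symIncl_mem_deg (f : SymmetricAlgebra k V) :
    Q.symIncl f ∈ GSym.deg Q.dualLie.gr 0 := by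
  induction f using SymmetricAlgebra.induction with
  | algebraMap c => rw [AlgHom.commutes]; exact GSym.algebraMap_mem_deg c
  | ι v =>
    rw [symIncl_ι]
    simpa using GSym.ι_mem_deg (Q.dualOne_mem v)
  | mul a b ha hb =>
    rw [map_mul]
    simpa using GSym.mul_mem_deg ha hb
  | add a b ha hb => rw [map_add]; exact add_mem ha hb

/-- Nonzero generators have degree at least `0`, with equality only in weight one. A nonzero product
of degree `0` is therefore a product of elements of `sV`. -/
theorem deg_zero_le_range_symIncl :
    GSym.deg Q.dualLie.gr 0 ≤ LinearMap.range Q.symIncl.toLinearMap := by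
  -- The hypothesis is weakened to degree at most `0` so that it passes to the tail once a head of
  -- non-negative degree is removed.
  have key : ∀ l, GSym.IsHomog Q.dualLie.gr l → GSym.listDeg l ≤ 0 →
      GSym.mono Q.dualLie.gr l ∈ LinearMap.range Q.symIncl.toLinearMap := by
    intro l hl h
    induction l with
    | nil => exact ⟨1, map_one Q.symIncl⟩
    | cons a l ih =>
      obtain ⟨ha, hl'⟩ := GSym.isHomog_cons.mp hl
      rw [GSym.listDeg_cons] at h
      rw [GSym.mono_cons]
      by_cases ha0 : a.1 = 0
      · rw [ha0, dualLie_gr_zero, Submodule.mem_bot] at ha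
        rw [ha, map_zero, zero_mul]
        exact zero_mem _
      obtain ⟨f, hf⟩ := ih hl' (by omega)
      by_cases ha1 : a.1 = 1
      · rw [ha1] at ha
        refine ⟨SymmetricAlgebra.ι k V (lprOne (a.2 : CofreeLie k V)) * f, ?_⟩
        rw [AlgHom.toLinearMap_apply, map_mul, symIncl_ι, Q.dualOne_lprOne ha]
        exact congrArg _ hf
      · have h0 : GSym.mono Q.dualLie.gr l = 0 := by
          have hm := GSym.mono_mem_deg hl'
          rwa [GSym.deg_eq_bot Q.dualLie_gr_zero (by omega), Submodule.mem_bot] at hm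
        rw [h0, mul_zero]
        exact zero_mem _
  exact GSym.deg_le fun l hl h => key l hl h.le

theorem twist_ι (I : Ideal (SymmetricAlgebra k V)) (x : Q.dual) :
    Q.twist I (GSym.ι Q.dualLie.gr x) =
      Ideal.Quotient.mk I (SymmetricAlgebra.ι k V (lprOne (x : CofreeLie k V))) := by
  rw [twist, GSym.lift_ι]
  rfl

/-- Together with `deg_zero_le_range_symIncl`, this identifies the kernel of the induced morphism in
degree `0` with the image of `I`. -/
theorem twist_symIncl (I : Ideal (SymmetricAlgebra k V)) (f : SymmetricAlgebra k V) :
    Q.twist I (Q.symIncl f) = Ideal.Quotient.mk I f := by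
  induction f using SymmetricAlgebra.induction with
  | algebraMap c => rw [AlgHom.commutes, AlgHom.commutes]; rfl
  | ι v => rw [symIncl_ι, twist_ι, dualOne_coe, lprOne_lword]
  | mul a b ha hb => rw [map_mul, map_mul, ha, hb, map_mul]
  | add a b ha hb => rw [map_add, map_add, ha, hb, map_add]

/-- A monomial of nonzero degree contains a letter of weight different from one, and the projection
to `sV` kills that letter. -/
theorem twist_of_mem_deg (I : Ideal (SymmetricAlgebra k V)) {p : ℤ} (hp : p ≠ 0)
    {s : GSym Q.dualLie.gr} (hs : s ∈ GSym.deg Q.dualLie.gr p) : Q.twist I s = 0 := by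
  suffices h : GSym.deg Q.dualLie.gr p ≤ LinearMap.ker (Q.twist I).toLinearMap from h hs
  refine GSym.deg_le fun l hl hlp => ?_
  rw [← hlp] at hp
  clear hlp hs
  rw [LinearMap.mem_ker, AlgHom.toLinearMap_apply]
  induction l with
  | nil => simp [GSym.listDeg] at hp
  | cons a l ih =>
    obtain ⟨ha, hl⟩ := GSym.isHomog_cons.mp hl
    rw [GSym.mono_cons, map_mul]
    by_cases ha1 : a.1 = 1
    · rw [GSym.listDeg_cons, ha1] at hp
      rw [ih (by simpa using hp) hl, mul_zero]
    · have h : lprOne (a.2 : CofreeLie k V) = 0 := lprOne_of_mem ha1 ha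
      rw [twist_ι, h, map_zero, map_zero, zero_mul]

/-! ### The curved cobar construction and its comparison with `A` -/

variable [CharZero k]

/-- The inclusion of `Sym V` into the Lie cobar construction of `((qA)^¡, φ~, θ~)`. -/
def symCobar : SymmetricAlgebra k V →ₐ[k] Q.koszulDual.LieCobar := Q.symIncl

theorem symCobar_ι (v : V) : Q.symCobar (SymmetricAlgebra.ι k V v) =
    GSym.ι Q.koszulDual.gr (Q.dualOne v) := Q.symIncl_ι v

/-- The differential of an element of degree `0` lies in degree `-1`, where there is nothing. -/
theorem cobarD_symCobar (f : SymmetricAlgebra k V) : Q.koszulDual.cobarD (Q.symCobar f) = 0 := by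
  have h := Q.koszulDual.cobarD_mem_deg (Q.symIncl_mem_deg f)
  rw [GSym.deg_eq_bot (gr := Q.koszulDual.gr) Q.dualLie_gr_zero (by omega)] at h
  exact (Submodule.mem_bot k).mp h

/-- In weight two only terms `x' ⊗ x''` with both factors of weight one occur. Then `cobarMul`
contributes the sign `-1` of an odd first factor, and multiplying the letters out gives twice the
corresponding element of `Sym² V`. -/
theorem cobarMul_cobr {x : Q.dual} (hx : x ∈ Q.koszulDual.gr 2) :
    Q.koszulDual.cobarMul (Q.koszulDual.cobr x) =
      -((2 : k) • Q.symCobar (lprTwo (x : CofreeLie k V))) := by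
  rw [← map_smul Q.symCobar, ← mul_lprOne_lieCobr, ← map_dualLie_cobr]
  refine Q.koszulDual.cobr_ext hx (f := Q.koszulDual.cobarMul)
    (g := -(Q.symCobar.toLinearMap ∘ₗ LinearMap.mul' k (SymmetricAlgebra k V) ∘ₗ
      TensorProduct.map (SymmetricAlgebra.ι k V ∘ₗ lprOne) (SymmetricAlgebra.ι k V ∘ₗ lprOne) ∘ₗ
      TensorProduct.map Q.dual.subtype Q.dual.subtype)) fun i j hij y hy z hz => ?_
  have hcases : i = 0 ∨ j = 0 ∨ (i = 1 ∧ j = 1) := by omega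
  rcases hcases with rfl | rfl | ⟨rfl, rfl⟩
  · rw [show y = 0 from (Submodule.mem_bot k).mp (Q.dualLie_gr_zero ▸ hy),
      TensorProduct.zero_tmul, map_zero, map_zero]
  · rw [show z = 0 from (Submodule.mem_bot k).mp (Q.dualLie_gr_zero ▸ hz),
      TensorProduct.tmul_zero, map_zero, map_zero]
  · rw [Q.koszulDual.cobarMul_tmul_of_mem hy, pow_one, neg_one_smul, LinearMap.neg_apply]
    simp only [LinearMap.comp_apply, TensorProduct.map_tmul, LinearMap.mul'_apply,
      AlgHom.toLinearMap_apply, map_mul, symCobar_ι, Submodule.subtype_apply]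
    rw [Q.dualOne_lprOne hy, Q.dualOne_lprOne hz]

/-- The differential of a generator of weight two is the corresponding relation of `A`. -/
theorem cobarD_ι_weight_two {x : Q.dual} (hx : x ∈ Q.koszulDual.gr 2) (r : Q.qR)
    (hr : lprTwo (x : CofreeLie k V) = r) :
    Q.koszulDual.cobarD (GSym.ι Q.koszulDual.gr x) = Q.symCobar (Q.sec r) := by
  have hh : Q.koszulDual.h x = Q.theta r := by
    change Q.Theta (lprTwo (x : CofreeLie k V)) = _
    rw [hr, Theta_apply]
  have hd : Q.koszulDual.d x = Q.dualOne (Q.phi r) := by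
    -- The coderivation takes weight two to weight one, and there an element is determined by its
    -- corestriction, which is `φ`.
    rw [← Q.dualOne_lprOne (Q.koszulDual.d_mem 1 x hx)]
    change Q.dualOne (lprOne (lieDer Q.Phi (x : CofreeLie k V))) = _
    rw [lprOne_lieDer, hr, Phi_apply]
  rw [CurvedDGLieCoalgebra.cobarD_ι, CurvedDGLieCoalgebra.cobarGen_apply, Q.cobarMul_cobr hx, hh,
    hd, hr, sec_eq, map_add, map_sub, symCobar_ι, AlgHom.commutes, smul_neg, smul_smul,
    inv_mul_cancel₀ two_ne_zero, one_smul]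
  abel

/-- A generator of weight `n` has a boundary of degree `n - 2`, so outside weight two `g_κ` kills it
for degree reasons. In weight two the boundary is an element of `R`. -/
theorem gKappa_cobarD_ι (x : Q.dual) :
    Q.gKappa (Q.koszulDual.cobarD (GSym.ι Q.koszulDual.gr x)) = 0 := by
  refine LinearMap.congr_fun (f := Q.gKappa.toLinearMap ∘ₗ Q.koszulDual.cobarD ∘ₗ
    GSym.ι Q.koszulDual.gr) (g := 0) (graded_ext Q.koszulDual.iSup_gr fun n x hx => ?_) x
  rw [LinearMap.comp_apply, LinearMap.comp_apply, LinearMap.zero_apply, AlgHom.toLinearMap_apply]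
  by_cases hn : n = 2
  · subst hn
    rw [Q.cobarD_ι_weight_two hx ⟨_, Q.dual_admissible.lprTwo_mem x x.2⟩ rfl]
    refine (Q.twist_symIncl _ _).trans ?_
    rw [Ideal.Quotient.eq_zero_iff_mem]
    exact Ideal.subset_span (Q.sec_mem _)
  · exact Q.twist_of_mem_deg _ (by omega)
      (Q.koszulDual.cobarD_mem_deg (GSym.ι_mem_deg (gr := Q.koszulDual.gr) hx))

theorem gKappa_cobarD (s : Q.koszulDual.LieCobar) : Q.gKappa (Q.koszulDual.cobarD s) = 0 := by
  induction s using GSym.induction with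
  | one => rw [CurvedDGLieCoalgebra.cobarD_one, map_zero]
  | smul c a ha => rw [map_smul, map_smul, ha, smul_zero]
  | add a b ha hb => rw [map_add, map_add, ha, hb, add_zero]
  | mul x a ha =>
    rw [CurvedDGLieCoalgebra.cobarD_mul, map_add, map_mul, map_mul, ha, gKappa_cobarD_ι, zero_mul,
      mul_zero, add_zero]

theorem gKappa_isChainMap : IsChainMap (GSym.deg Q.koszulDual.gr) Q.koszulDual.cobarD
    (degZero ⊤) 0 Q.gKappa.toLinearMap where
  map_mem n s hs := by
    by_cases hn : n = 0
    · rw [degZero, if_pos hn]; trivial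
    · rw [degZero, if_neg hn]
      exact (Submodule.mem_bot k).mpr (Q.twist_of_mem_deg _ hn hs)
  comm := by
    rw [LinearMap.zero_comp]
    exact LinearMap.ext fun s => Q.gKappa_cobarD s

/-- Elements of degree `0` are cycles of even degree, so the differential commutes with
multiplication by `Sym V`. The boundaries in degree `0` are thus closed under this multiplication,
and it is enough to bound the elements of `R`. -/
theorem symCobar_mem_map_cobarD {f : SymmetricAlgebra k V}
    (hf : f ∈ Ideal.span (Q.R : Set (SymmetricAlgebra k V))) :
    Q.symCobar f ∈ (GSym.deg Q.koszulDual.gr 1).map Q.koszulDual.cobarD := by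
  induction hf using Submodule.span_induction with
  | mem r hr =>
    -- A relation is determined by its quadratic part. The weight-two generator over that part has
    -- as boundary the unique relation with this quadratic part, which is `r`.
    have hq : quadPart k V r ∈ Q.qR := ⟨r, hr, rfl⟩
    obtain ⟨x, hx, hxr⟩ := Q.exists_dual_lprTwo_eq ⟨_, hq⟩
    refine ⟨GSym.ι Q.koszulDual.gr x, ?_, ?_⟩
    · simpa using GSym.ι_mem_deg (gr := Q.koszulDual.gr) hx
    · rw [Q.cobarD_ι_weight_two hx _ hxr, Q.sec_quadPart hr _ rfl]
  | zero => rw [map_zero]; exact zero_mem _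
  | add a b _ _ ha hb => rw [map_add]; exact add_mem ha hb
  | smul a r _ hr =>
    obtain ⟨s, hs, hsr⟩ := hr
    have ha : Q.symCobar a ∈ GSym.deg Q.koszulDual.gr 0 := Q.symIncl_mem_deg a
    refine ⟨Q.symCobar a * s, ?_, ?_⟩
    · have h := GSym.mul_mem_deg ha hs
      rwa [zero_add] at h
    · rw [CurvedDGLieCoalgebra.cobarD_mul, Q.koszulDual.cobarSign_of_mem_deg ha, cobarD_symCobar,
        zero_mul, zero_add, zpow_zero, one_smul, hsr, smul_eq_mul, map_mul]

/-- The target `qA` is concentrated in degree `0`, so in positive degree the quasi-isomorphism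
amounts to exactness of `d₂`. -/
theorem IsKoszul.exists_cobarQuad_eq {Q : CommQLC k V} (hQ : Q.IsKoszul) {p : ℤ} (hp : 0 < p)
    {s : Q.koszulDual.LieCobar} (hs : s ∈ GSym.deg Q.koszulDual.gr p)
    (hd : Q.koszulDual.cobarQuad s = 0) :
    ∃ t ∈ GSym.deg Q.koszulDual.gr (p + 1), Q.koszulDual.cobarQuad t = s := by
  have hg : Q.gKappa' s = 0 := Q.twist_of_mem_deg _ hp.ne' hs
  obtain ⟨t, ht, hts⟩ := hQ.injective p s ⟨hs, GSym.augmentation_of_mem hp.ne' hs⟩ hd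
    ⟨0, zero_mem _, hg.symm⟩
  exact ⟨t, ht.1, hts⟩

/-- Negative degrees are zero. In degree `0` the cycles are all of `Sym V`, and those killed by
`g_κ` form `(R)`, which consists of boundaries. Koszulness enters only in positive degree, where the
exactness of `d₂` is carried over to the full differential by the weight filtration. -/
theorem IsKoszul.gKappa_isQuasiIso {Q : CommQLC k V} (hQ : Q.IsKoszul) :
    IsQuasiIso (GSym.deg Q.koszulDual.gr) Q.koszulDual.cobarD (degZero ⊤) 0
      Q.gKappa.toLinearMap where
  injective n s hs hds hg := by
    rw [Submodule.map_zero, Submodule.mem_bot, AlgHom.toLinearMap_apply] at hg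
    rcases lt_trichotomy n 0 with hn | rfl | hn
    · rw [GSym.deg_eq_bot (gr := Q.koszulDual.gr) Q.dualLie_gr_zero hn, Submodule.mem_bot] at hs
      rw [hs]
      exact zero_mem _
    · obtain ⟨f, rfl⟩ := Q.deg_zero_le_range_symIncl hs
      refine Q.symCobar_mem_map_cobarD ?_
      rw [← Ideal.Quotient.eq_zero_iff_mem]
      exact (Q.twist_symIncl _ f).symm.trans hg
    · exact Q.koszulDual.mem_map_cobarD (fun s hs hd => hQ.exists_cobarQuad_eq hn hs hd) hs hds
  surjective n y hy _ := by
    by_cases hn : n = 0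
    · obtain ⟨f, rfl⟩ := Ideal.Quotient.mk_surjective y
      refine ⟨Q.symCobar f, hn ▸ Q.symIncl_mem_deg f, Q.cobarD_symCobar f, ?_⟩
      have h : Q.gKappa (Q.symCobar f) = Ideal.Quotient.mk _ f := Q.twist_symIncl _ f
      rw [AlgHom.toLinearMap_apply, h, sub_self]
      exact zero_mem _
    · rw [degZero, if_neg hn, Submodule.mem_bot] at hy
      refine ⟨0, zero_mem _, map_zero _, ?_⟩
      rw [hy, map_zero, sub_zero]
      exact zero_mem _

end CommQLC

end CurvedKoszul

end

theorem theorem5p4 {k : Type*} [Field k] [CharZero k] {V : Type*} [AddCommGroup V] [Module k V]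
    (Q : CurvedKoszul.CommQLC k V) (hQ : Q.IsKoszul) :
    CurvedKoszul.IsComplex (CurvedKoszul.GSym.deg Q.koszulDual.gr) Q.koszulDual.cobarD ∧
      CurvedKoszul.IsChainMap (CurvedKoszul.GSym.deg Q.koszulDual.gr) Q.koszulDual.cobarD
        (CurvedKoszul.degZero ⊤) 0 Q.gKappa.toLinearMap ∧
      CurvedKoszul.IsQuasiIso (CurvedKoszul.GSym.deg Q.koszulDual.gr) Q.koszulDual.cobarD
        (CurvedKoszul.degZero ⊤) 0 Q.gKappa.toLinearMap :=
  ⟨Q.koszulDual.isComplex, Q.gKappa_isChainMap, hQ.gKappa_isQuasiIso⟩
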